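/- Let $n\ge 1$ and $m\ge 3$. For an integer $d\ge1$, a homogeneous operator $P_d(\partial_t,\partial_x)=\sum_{k+|\alpha|=d}c_{k,\alpha}\,\partial_t^k\partial_x^\alpha$ on $\mathbb R\times\mathbb R^n$ with $c_{d,0}>0$ is called *strictly hyperbolic* if for every $\xi'\in S^{n-1}$ the roots $\lambda$ of its symbol $P_d(\lambda,\xi')=\sum_{k+|\alpha|=d} c_{k,\alpha}\lambda^k\xi'^\alpha$ are real and distinct. Polynomials $p$, $r$ in one variable, with real roots $b_1\le\dots\le b_{d}$ and $a_1\le\dots\le a_{d+1}$ respectively, *strictly interlace* if $a_1<b_1<a_2<b_2<\dots<b_{d}<a_{d+1}$. For $\sigma\in\mathbb R$ put $\|f\|_{H^\sigma}=\|(1+|\xi|^2)^{\sigma/2}\hat f\|_{L^2}$, and for $s\ge0$ put $\|f\|_{\dot H^s}=\||\xi|^s\hat f\|_{L^2}$. Let $P_m$ and $P_{m-1}$ be strictly hyperbolic, homogeneous of order $m$ and $m-1$ respectively, where the coefficient of $\partial_t^m$ in $P_m$ is $1$, and suppose that $P_{m-1}(\lambda,\xi')$ and $P_m(\lambda,\xi')$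 strictly interlace for every $\xi'\in S^{n-1}$. Let $q\in[1,2]$, let $s_0\ge m-1$ be real, and let $u_j\in H^{s_0-j}\cap L^q$ for $j=0,\dots,m-1$. (i) Let $Q_1=P_m+P_{m-1}$. The Cauchy problem $Q_1(\partial_t,\partial_x)u=0$ for $t\ge0$, $x\in\mathbb R^n$, with $\partial_t^ju(0,\cdot)=u_j$ for $j=0,\dots,m-1$, has a unique (weak) solution $u\in C^{m-1}([0,\infty),L^2)$. Let $k\ge 0$ be an integer and $s\ge0$ a real number with $k+s\le s_0$, and suppose that $k+s\ge m-2$ if $q=2$, and that $n\left(\frac1q-\frac12\right)+k+s>m-2$ if $q<2$. Then $u\in C^k([0,\infty),L^2)$ and, for all $t\ge0$, $$\|\partial_t^ku(t,\cdot)\|_{\dot H^s}\le C(1+t)^{-\frac n2\left(\frac1q-\frac12\right)-\frac{k+s-(m-2)}2}\sum_{j=m-2}^{m-1}\big(\|u_j\|_{L^q}+\|u_j\|_{H^{k+s-j}}\big)+C\sum_{j=0}^{m-3}(1+t)^{-\frac n2\left(\frac1q-\frac12\right)-\frac{k+s-j}2}\big(\|u_j\|_{L^q}+\|u_j\|_{H^{k+s-j}}\big),$$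 where $C>0$ is independent of $t$ and of the initial data. (ii) Let moreover $P_{m-2}$ be strictly hyperbolic, homogeneous of order $m-2$, and suppose that $P_{m-2}(\lambda,\xi')$ and $P_{m-1}(\lambda,\xi')$ strictly interlace for every $\xi'\in S^{n-1}$. Let $Q_2=P_m+P_{m-1}+P_{m-2}$. The Cauchy problem for $Q_2$ with the same data has a unique (weak) solution $u\in C^{m-1}([0,\infty),L^2)$. Let $k\ge0$ be an integer and $s\ge0$ a real number with $k+s\le s_0$, and suppose that $k+s\ge m-3$ if $q=2$, and that $n\left(\frac1q-\frac12\right)+k+s>m-3$ if $q<2$. Then $u\in C^k([0,\infty),L^2)$ and, for all $t\ge0$, $$\|\partial_t^ku(t,\cdot)\|_{\dot H^s}\le C(1+t)^{-\frac n2\left(\frac1q-\frac12\right)-\frac{k+s-(m-3)}2}\sum_{j=m-3}^{m-1}\big(\|u_j\|_{L^q}+\|u_j\|_{H^{k+s-j}}\big)+C\sum_{j=0}^{m-4}(1+t)^{-\frac n2\left(\frac1q-\frac12\right)-\frac{k+s-j}2}\big(\|u_j\|_{L^q}+\|u_j\|_{H^{k+s-j}}\big),$$ where $C>0$ is independent of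 $t$ and of the initial data. -/

import Mathlib

open MeasureTheory Set Polynomial
open scoped FourierTransform SchwartzMap LineDeriv ENNReal

noncomputable section

namespace HypDecay

/-! ### Hyperbolic polynomials and operators -/

/-- A complex polynomial is strictly hyperbolic if its roots are real and simple. -/
def StrictlyHyperbolic (p : ℂ[X]) : Prop :=
  p ≠ 0 ∧ (∀ z ∈ p.roots, z.im = 0) ∧ p.roots.Nodup

/-- `p` (of degree `d`, with real roots `b₁ ≤ … ≤ b_d`) and `q` (of degree `d + 1`, with real roots
`a₁ ≤ … ≤ a_{d+1}`) strictly interlace: `a₁ < b₁ < a₂ < b₂ < … < b_d < a_{d+1}`.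
The roots are listed with multiplicity. -/
def StrictlyInterlace (p q : ℂ[X]) : Prop :=
  p ≠ 0 ∧ q ≠ 0 ∧ ∃ (d : ℕ) (b : Fin d → ℝ) (a : Fin (d + 1) → ℝ),
    p.roots = Finset.univ.val.map (fun i => (b i : ℂ)) ∧
    q.roots = Finset.univ.val.map (fun i => (a i : ℂ)) ∧
    ∀ i : Fin d, a i.castSucc < b i ∧ b i < a i.succ

/-- A constant coefficient operator `∑ c_{k,α} ∂_t^k ∂_x^α` on `ℝ × ℝⁿ`, given by its coefficients
`c_{k,α}`: the variable `none` stands for `∂_t`, the variable `some i` for `∂_{x_i}`. -/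
abbrev DiffOp (n : ℕ) : Type := MvPolynomial (Option (Fin n)) ℂ

/-- The coefficient `c_{k,0}` of `∂_t^k`. -/
def DiffOp.timeCoeff {n : ℕ} (P : DiffOp n) (k : ℕ) : ℂ :=
  MvPolynomial.coeff (Finsupp.single none k) P

/-- The symbol `P(λ, ξ) = ∑ c_{k,α} λ^k ξ^α`, as a polynomial in `λ`, for a fixed `ξ ∈ ℝⁿ`. -/
def DiffOp.symbol {n : ℕ} (P : DiffOp n) (ξ : EuclideanSpace ℝ (Fin n)) : ℂ[X] :=
  MvPolynomial.aeval (fun o : Option (Fin n) => o.elim (X : ℂ[X]) (fun i => C ((ξ i : ℝ) : ℂ))) P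

/-- `P` is a homogeneous operator of order `m` with `c_{m,0} > 0`, and it is strictly hyperbolic:
for any `ξ'` in the unit sphere, the roots of `P(λ, ξ')` are real and distinct. -/
structure DiffOp.IsStrictlyHyperbolic {n : ℕ} (P : DiffOp n) (m : ℕ) : Prop where
  homogeneous : P.IsHomogeneous m
  timeCoeff_pos : ∃ c : ℝ, 0 < c ∧ P.timeCoeff m = (c : ℂ)
  strictlyHyperbolic : ∀ ξ : EuclideanSpace ℝ (Fin n), ‖ξ‖ = 1 → StrictlyHyperbolic (P.symbol ξ)

/-! ### Function spaces -/

/-- The space `L²(ℝⁿ)` of complex valued functions. -/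
abbrev L2 (n : ℕ) : Type := Lp ℂ 2 (volume : Measure (EuclideanSpace ℝ (Fin n)))

/-- The Sobolev norm `‖f‖_{H^s} = ‖(1 + |ξ|²)^{s/2} f̂‖_{L²}`, for any real `s` (it may be infinite).
The frequency variable is `2πξ`, since `𝓕` has the kernel `exp(-2πi x·ξ)`. -/
def sobolevNorm {n : ℕ} (s : ℝ) (f : L2 n) : ℝ≥0∞ :=
  eLpNorm (fun ξ : EuclideanSpace ℝ (Fin n) =>
    (((1 + (2 * Real.pi * ‖ξ‖) ^ 2) ^ (s / 2) : ℝ) : ℂ) * (𝓕 f : L2 n) ξ) 2 volume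

/-- The quantity `‖f‖_{Ḣ^s} = ‖|ξ|^s f̂‖_{L²}`, for `s ≥ 0` (it may be infinite). -/
def homSobolevNorm {n : ℕ} (s : ℝ) (f : L2 n) : ℝ≥0∞ :=
  eLpNorm (fun ξ : EuclideanSpace ℝ (Fin n) =>
    (((2 * Real.pi * ‖ξ‖) ^ s : ℝ) : ℂ) * (𝓕 f : L2 n) ξ) 2 volume

/-- `‖f‖_{L^q} + ‖f‖_{H^s}`. -/
def dataNorm {n : ℕ} (q s : ℝ) (f : L2 n) : ℝ≥0∞ :=
  eLpNorm f (ENNReal.ofReal q) volume + sobolevNorm s f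

/-- `u_j ∈ H^{s₀-j} ∩ L^q` for `j = 0, …, m-1`. -/
def AdmissibleData {n : ℕ} (m : ℕ) (s₀ q : ℝ) (u₀ : ℕ → L2 n) : Prop :=
  ∀ j < m, TemperedDistribution.MemSobolev (s₀ - j) 2 (u₀ j : 𝓢'(EuclideanSpace ℝ (Fin n), ℂ)) ∧
    MemLp (u₀ j) (ENNReal.ofReal q) volume

/-! ### The Cauchy problem -/

/-- The distributional derivative `∂_x^α T = ∂_{x_1}^{α_1} ⋯ ∂_{x_n}^{α_n} T`. -/
def spaceDeriv {n : ℕ} (α : Fin n → ℕ) (T : 𝓢'(EuclideanSpace ℝ (Fin n), ℂ)) :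
    𝓢'(EuclideanSpace ℝ (Fin n), ℂ) :=
  (List.finRange n).foldr
    (fun i S => (fun R : 𝓢'(EuclideanSpace ℝ (Fin n), ℂ) =>
      ∂_{EuclideanSpace.single i (1 : ℝ)} R)^[α i] S) T

/-- The `k`-th time derivative, on `t ≥ 0` (one-sided at `t = 0`), of a function with values in
`L²`. -/
def timeDeriv {n : ℕ} (k : ℕ) (u : ℝ → L2 n) (t : ℝ) : L2 n :=
  iteratedDerivWithin k u (Ici 0) t

/-- `u` is a (weak) solution, for `t ≥ 0`, of the Cauchy problem `Q(∂_t, ∂_x) u = 0` of order `m`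
with `∂_t^j u(0, ·) = u_j` for `j = 0, …, m-1`. Here `u ∈ C^{m-1}([0,∞), L²)`, and the equation holds
in `C^m([0,∞), 𝓢')`, i.e. after testing with any Schwartz function of `x`. Only the values of `u` for
`t ≥ 0` matter. -/
structure IsSolution {n : ℕ} (Q : DiffOp n) (m : ℕ) (u₀ : ℕ → L2 n) (u : ℝ → L2 n) : Prop where
  contDiffOn : ContDiffOn ℝ ((m - 1 : ℕ) : ℕ∞) u (Ici 0)
  initial : ∀ j < m, timeDeriv j u 0 = u₀ j
  contDiffOn_test : ∀ ψ : 𝓢(EuclideanSpace ℝ (Fin n), ℂ),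
    ContDiffOn ℝ (m : ℕ∞) (fun t => (u t : 𝓢'(EuclideanSpace ℝ (Fin n), ℂ)) ψ) (Ici 0)
  equation : ∀ ψ : 𝓢(EuclideanSpace ℝ (Fin n), ℂ), ∀ t : ℝ, 0 ≤ t →
    ∑ d ∈ Q.support, MvPolynomial.coeff d Q *
      iteratedDerivWithin (d none)
        (fun τ => spaceDeriv (fun i => d (some i))
          (u τ : 𝓢'(EuclideanSpace ℝ (Fin n), ℂ)) ψ) (Ici 0) t = 0

end HypDecay

end

/-!
The Fourier transform in `x` turns the Cauchy problem into a family of ordinary differential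
equations `Q(∂_t, i r ω) w = 0`, indexed by the frequencies `r ω` with `r > 0` and `|ω| = 1`. The
theorem follows from pointwise bounds on the fundamental solutions of these equations.

**Dissipation.** Let `b_1, …, b_{m-1}` be the roots of `P_{m-1}(·, ω)`. Expansion in the basis
`∏_{j ≠ i} (λ - b_j)` turns the interlacing conditions into the positivity of coefficients:
`P_m = (λ + β) ∏ (λ - b_j) - ∑ δ_i ∏_{j ≠ i} (λ - b_j)` with `δ_i > 0`, and
`P_{m-2} = ∑ η_i ∏_{j ≠ i} (λ - b_j)` with `η_i > 0`, with bounds uniform in `ω`, as the sphere is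
compact (`exists_decomposition`, `exists_decomposition_of_interlaced`). With the operators
`D = (i r)⁻¹ ∂_t`, `l = ∏ (D - b_j) w` and `y_i = ∏_{j ≠ i} (D - b_j) w`, and with `c` the leading
coefficient of `P_{m-1}`, the equation becomes the star-shaped system
`y_i' = i r (b_i y_i + l)`, `l' = -c l - i r β l + i r ∑ κ_i y_i`, `κ_i = δ_i + r⁻² η_i > 0`.
Only `l` is damped, but each `y_i` is coupled to `l` and the `b_i` are distinct. The energy
`|l|² + ∑ κ_i |y_i|²`, corrected by suitable cross terms, is a Lyapunov functional (`starLyapunov`).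
It decays at a rate comparable to `min(r, 1)²` (`star_decay`, `exists_crude_bound`).

**Low frequencies.** For `r → 0` the equation degenerates to `(∂_t + c) ∂_t^{m-1} w = 0`,
respectively `(∂_t² + c ∂_t + d) ∂_t^{m-2} w = 0` with `c, d > 0`. The factor on the left is
exponentially stable (`StableFilter`), and inverting it shows that each derivative of the remaining
modes gains a power of `r` (`exists_low_bound`, `exists_low_gain`). The outcome
(`exists_fundSol_bound`, `KernelBound`) is that the `k`-th derivative of the `j`-th fundamental
solution is bounded by `r^{k - j} e^{-σ t}` for `r ≥ 1`, and by
`r^{k - min(j, L)} e^{-σ r² t} + e^{-σ t}` for `r ≤ 1`, where `L = m - 2` for `Q₁` and `L = m - 3`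
for `Q₂`. The data `u_j` with `j ≥ L` thus decay at the common rate of the first sum of the theorem.

**From the multipliers to the theorem.** The term with `e^{-σ r² t}` is a (fractional) derivative of
the heat kernel. The `L^q`-`L²` heat estimate is proved by splitting the datum at a level, which
avoids the Hausdorff–Young inequality (`eLpNorm_heat_le`), and it is extended to negative orders by
writing `r^{2a}` as a superposition of gaussians (`exists_heat_decay`). The remaining terms decay
exponentially and are controlled by Sobolev norms. That the Fourier multipliers give a solution
follows by dominated convergence in `L²` (`KernelBound.isSolution`). A weak solution, cut off to a
ball in the frequency space, satisfies an ordinary differential equation in `L²` with bounded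
coefficients, hence it is unique by Gronwall's inequality (`IsSolution.unique`).
-/

noncomputable section

namespace HypDecay

/-! ### A damped star-shaped system -/

section

open Complex ComplexConjugate

/-- The Lyapunov functional of the system `y_i' = i r (b_i y_i + l)`,
`l' = -c l - i r β l + i r ∑ κ_i y_i`: the real part is the energy `|l|² + ∑ κ_i |y_i|²` plus
cross terms of size `a`. The term `l ∑ κ_i ȳ_i` transfers the damping of `l` only to the sum
`∑ κ_i y_i`; the products `y_i ȳ_j` are divided by `b_i - b_j` so that their derivatives replace
`|∑ κ_i y_i|²` by `∑ κ_i² |y_i|²`. -/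
def starLyapunov {N : ℕ} (a : ℝ) (b κ : Fin N → ℝ) (y : Fin N → ℂ) (l : ℂ) : ℂ :=
  l * conj l + ∑ i, (κ i : ℂ) * (y i * conj (y i)) +
    a * (I * (l * conj (∑ i, (κ i : ℂ) * y i)) +
      ∑ i, ∑ j, ((if i = j then 0 else κ i * κ j / (b i - b j) : ℝ) : ℂ) *
        (-I * (y i * conj (y j))))

/-- The derivative of the Lyapunov functional is negative definite in `l` and in all `y_i`, up to
products of `l` with the `y_i` that carry the factor `a`. -/
theorem hasDerivAt_starLyapunov {N : ℕ} (a c β r : ℝ) (b κ : Fin N → ℝ)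
    (hb : ∀ i j, i ≠ j → b i ≠ b j) (y : Fin N → ℝ → ℂ) (l : ℝ → ℂ)
    (hy : ∀ i t, HasDerivAt (y i) (I * r * (b i * y i t + l t)) t)
    (hl : ∀ t, HasDerivAt l (-c * l t - I * r * β * l t + I * r * ∑ i, (κ i : ℂ) * y i t) t)
    (t : ℝ) :
    HasDerivAt (fun t => (starLyapunov a b κ (fun i => y i t) (l t)).re)
      (-2 * c * ‖l t‖ ^ 2 - a * r * ∑ i, κ i ^ 2 * ‖y i t‖ ^ 2 + a * r * (∑ i, κ i) * ‖l t‖ ^ 2 +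
        a * (I * (-c - I * r * β) * (l t * conj (∑ i, (κ i : ℂ) * y i t)) +
          r * (l t * conj (∑ i, (κ i : ℂ) * b i * y i t)) +
          r * ∑ i, ∑ j, ((if i = j then 0 else κ i * κ j / (b i - b j) : ℝ) : ℂ) *
            (l t * conj (y j t) - y i t * conj (l t))).re) t := by
  have hyc : ∀ i t, HasDerivAt (fun s => conj (y i s)) (conj (I * r * (b i * y i t + l t))) t :=
    fun i t => (hy i t).star
  have hlc : ∀ t, HasDerivAt (fun s => conj (l s))
      (conj (-c * l t - I * r * β * l t + I * r * ∑ i, (κ i : ℂ) * y i t)) t :=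
    fun t => (hl t).star
  have hS : ∀ t, HasDerivAt (fun s => ∑ i, (κ i : ℂ) * y i s)
      (∑ i, (κ i : ℂ) * (I * r * (b i * y i t + l t))) t := fun t =>
    HasDerivAt.fun_sum fun i _ => (hy i t).const_mul _
  have hSc : ∀ t, HasDerivAt (fun s => conj (∑ i, (κ i : ℂ) * y i s))
      (conj (∑ i, (κ i : ℂ) * (I * r * (b i * y i t + l t)))) t := fun t => (hS t).star
  have hG := (((hl t).mul (hlc t)).add (HasDerivAt.fun_sum (u := Finset.univ) fun i _ =>
      ((hy i t).mul (hyc i t)).const_mul (κ i : ℂ))).add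
    ((((((hl t).mul (hSc t)).const_mul I)).add
      (HasDerivAt.fun_sum (u := Finset.univ) fun i _ => HasDerivAt.fun_sum (u := Finset.univ)
        fun j _ => (((hy i t).mul (hyc j t)).const_mul (-I)).const_mul
          ((if i = j then 0 else κ i * κ j / (b i - b j) : ℝ) : ℂ))).const_mul (a : ℂ))
  have hre := (Complex.reCLM.hasFDerivAt.comp_hasDerivAt t hG)
  refine (hre.congr_deriv ?_).congr_of_eventuallyEq ?_
  swap
  · exact Filter.Eventually.of_forall fun s => rfl
  have hd : ∑ i, ∑ j, ((if i = j then 0 else κ i * κ j / (b i - b j) : ℝ) : ℂ) *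
      ((b i - b j) * (y i t * conj (y j t))) =
      (∑ i, (κ i : ℂ) * y i t) * conj (∑ i, (κ i : ℂ) * y i t) -
        ∑ i, (κ i : ℂ) ^ 2 * (y i t * conj (y i t)) := by
    rw [map_sum, Finset.sum_mul_sum, ← Finset.sum_sub_distrib]
    refine Finset.sum_congr rfl fun i _ => ?_
    rw [← Finset.add_sum_erase _ _ (Finset.mem_univ i),
      ← Finset.add_sum_erase (Finset.univ) (fun j => (κ i : ℂ) * y i t * conj ((κ j : ℂ) * y j t))
        (Finset.mem_univ i)]
    have : ∀ j ∈ Finset.univ.erase i, ((if i = j then 0 else κ i * κ j / (b i - b j) : ℝ) : ℂ) *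
      ((b i - b j) * (y i t * conj (y j t))) = (κ i : ℂ) * y i t * conj ((κ j : ℂ) * y j t) := by
      intro j hj
      have hij : i ≠ j := (Finset.ne_of_mem_erase hj).symm
      have h0 : (b i : ℂ) - b j ≠ 0 := by
        rw [sub_ne_zero]; exact_mod_cast hb i j hij
      rw [if_neg hij, map_mul, conj_ofReal]
      push_cast
      field_simp
    rw [Finset.sum_congr rfl this]
    simp
    ring
  have h2 : ∑ i, (κ i : ℂ) * (I * r * (b i * y i t + l t) * conj (y i t) +
      y i t * conj (I * r * (b i * y i t + l t))) =
      I * r * (l t * conj (∑ i, (κ i : ℂ) * y i t) - (∑ i, (κ i : ℂ) * y i t) * conj (l t)) := by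
    rw [map_sum, Finset.mul_sum, Finset.sum_mul, ← Finset.sum_sub_distrib, Finset.mul_sum]
    refine Finset.sum_congr rfl fun i _ => ?_
    simp only [map_mul, map_add, conj_ofReal, conj_I]
    ring
  have hS' : ∑ i, (κ i : ℂ) * (I * r * (b i * y i t + l t)) =
      I * r * (∑ i, (κ i : ℂ) * b i * y i t + (∑ i, (κ i : ℂ)) * l t) := by
    rw [Finset.sum_mul, ← Finset.sum_add_distrib, Finset.mul_sum]
    exact Finset.sum_congr rfl fun i _ => by ring
  have h4 : ∑ i, ∑ j, ((if i = j then 0 else κ i * κ j / (b i - b j) : ℝ) : ℂ) *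
      (-I * (I * r * (b i * y i t + l t) * conj (y j t) +
        y i t * conj (I * r * (b j * y j t + l t)))) =
      r * ((∑ i, (κ i : ℂ) * y i t) * conj (∑ i, (κ i : ℂ) * y i t) -
        ∑ i, (κ i : ℂ) ^ 2 * (y i t * conj (y i t))) +
      r * ∑ i, ∑ j, ((if i = j then 0 else κ i * κ j / (b i - b j) : ℝ) : ℂ) *
            (l t * conj (y j t) - y i t * conj (l t)) := by
    rw [← hd, Finset.mul_sum, Finset.mul_sum, ← Finset.sum_add_distrib]
    refine Finset.sum_congr rfl fun i _ => ?_
    rw [Finset.mul_sum, Finset.mul_sum, ← Finset.sum_add_distrib]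
    refine Finset.sum_congr rfl fun j _ => ?_
    simp only [map_mul, map_add, conj_ofReal, conj_I]
    linear_combination (-((if i = j then 0 else κ i * κ j / (b i - b j) : ℝ) : ℂ) * r *
      ((b i - b j) * (y i t * conj (y j t)) + l t * conj (y j t) - y i t * conj (l t))) * I_sq
  have key : ∀ z : ℂ, z = ((-2 * c * ‖l t‖ ^ 2 - a * r * ∑ i, κ i ^ 2 * ‖y i t‖ ^ 2 +
      a * r * (∑ i, κ i) * ‖l t‖ ^ 2 : ℝ) : ℂ) +
        a * (I * (-c - I * r * β) * (l t * conj (∑ i, (κ i : ℂ) * y i t)) +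
          r * (l t * conj (∑ i, (κ i : ℂ) * b i * y i t)) +
          r * ∑ i, ∑ j, ((if i = j then 0 else κ i * κ j / (b i - b j) : ℝ) : ℂ) *
            (l t * conj (y j t) - y i t * conj (l t))) → reCLM z =
      (-2 * c * ‖l t‖ ^ 2 - a * r * ∑ i, κ i ^ 2 * ‖y i t‖ ^ 2 + a * r * (∑ i, κ i) * ‖l t‖ ^ 2 +
        a * (I * (-c - I * r * β) * (l t * conj (∑ i, (κ i : ℂ) * y i t)) +
          r * (l t * conj (∑ i, (κ i : ℂ) * b i * y i t)) +
          r * ∑ i, ∑ j, ((if i = j then 0 else κ i * κ j / (b i - b j) : ℝ) : ℂ) *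
            (l t * conj (y j t) - y i t * conj (l t))).re) := by
    rintro z rfl
    rw [reCLM_apply, add_re, ofReal_re, re_ofReal_mul]
  apply key
  rw [h2, h4, hS']
  push_cast
  simp only [← mul_conj']
  simp only [map_mul, map_add, map_sub, map_neg, conj_ofReal, conj_I, map_sum]
  linear_combination (-(a : ℂ) * r * (l t * ∑ i, (κ i : ℂ) * b i * conj (y i t) +
    (∑ i, (κ i : ℂ)) * (l t * conj (l t))) + a * r * (∑ i, (κ i : ℂ) * y i t) *
    (∑ i, (κ i : ℂ) * conj (y i t))) * I_sq

end

section

open Complex ComplexConjugate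

theorem sq_sum_norm_le {N : ℕ} (y : Fin N → ℂ) :
    (∑ i, ‖y i‖) ^ 2 ≤ N * ∑ i, ‖y i‖ ^ 2 := by
  simpa using sq_sum_le_card_mul_sum_sq (s := Finset.univ) (f := fun i => ‖y i‖)

theorem norm_sum_mul_le {N : ℕ} (κ : Fin N → ℂ) (y : Fin N → ℂ) {A : ℝ}
    (h : ∀ i, ‖κ i‖ ≤ A) : ‖∑ i, κ i * y i‖ ≤ A * ∑ i, ‖y i‖ := by
  refine (norm_sum_le _ _).trans ?_
  rw [Finset.mul_sum]
  refine Finset.sum_le_sum fun i _ => ?_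
  rw [norm_mul]
  exact mul_le_mul_of_nonneg_right (h i) (norm_nonneg _)

theorem norm_off_diag_le {N : ℕ} {b κ : Fin N → ℝ} {g A : ℝ} (hg : 0 < g) (hA : 0 ≤ A)
    (hb : ∀ i j, i ≠ j → g ≤ |b i - b j|) (hκ : ∀ i, |κ i| ≤ A) (i j : Fin N) :
    ‖((if i = j then 0 else κ i * κ j / (b i - b j) : ℝ) : ℂ)‖ ≤ A ^ 2 / g := by
  rw [Complex.norm_real]
  split_ifs with h
  · simpa using by positivity
  · rw [norm_div, norm_mul, Real.norm_eq_abs, Real.norm_eq_abs, Real.norm_eq_abs, sq]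
    exact div_le_div₀ (by positivity)
      (mul_le_mul (hκ i) (hκ j) (abs_nonneg _) hA) hg (hb i j h)

theorem starLyapunov_sub_le {N : ℕ} {a g A : ℝ} {b κ : Fin N → ℝ} (ha : 0 ≤ a) (hg : 0 < g)
    (hA : 0 ≤ A) (hb : ∀ i j, i ≠ j → g ≤ |b i - b j|) (hκ : ∀ i, |κ i| ≤ A)
    (y : Fin N → ℂ) (l : ℂ) :
    |(starLyapunov a b κ y l).re - (‖l‖ ^ 2 + ∑ i, κ i * ‖y i‖ ^ 2)| ≤
      a * (A * ‖l‖ * ∑ i, ‖y i‖) + a * (A ^ 2 / g * (∑ i, ‖y i‖) ^ 2) := by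
  have h : starLyapunov a b κ y l = ((‖l‖ ^ 2 + ∑ i, κ i * ‖y i‖ ^ 2 : ℝ) : ℂ) +
      a * (I * (l * conj (∑ i, (κ i : ℂ) * y i)) +
      ∑ i, ∑ j, ((if i = j then 0 else κ i * κ j / (b i - b j) : ℝ) : ℂ) *
        (-I * (y i * conj (y j)))) := by
    rw [starLyapunov]
    push_cast
    simp only [← mul_conj']
  rw [h, add_re, ofReal_re, add_sub_cancel_left]
  refine (abs_re_le_norm _).trans ?_
  rw [norm_mul, norm_real, Real.norm_of_nonneg ha, ← mul_add]
  refine mul_le_mul_of_nonneg_left ((norm_add_le _ _).trans (add_le_add ?_ ?_)) ha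
  · rw [norm_mul, norm_I, one_mul, norm_mul, RCLike.norm_conj, mul_comm A, mul_assoc]
    refine mul_le_mul_of_nonneg_left (norm_sum_mul_le _ _ fun i => ?_) (norm_nonneg _)
    rw [norm_real]; exact hκ i
  · refine (norm_sum_le _ _).trans ?_
    rw [sq (∑ i, ‖y i‖), Finset.sum_mul_sum, Finset.mul_sum]
    refine Finset.sum_le_sum fun i _ => (norm_sum_le _ _).trans ?_
    rw [Finset.mul_sum]
    refine Finset.sum_le_sum fun j _ => ?_
    rw [norm_mul, norm_mul, norm_mul, norm_neg, norm_I, one_mul, RCLike.norm_conj]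
    exact mul_le_mul_of_nonneg_right (norm_off_diag_le hg hA hb hκ i j) (by positivity)

theorem starLyapunov_error_le {N : ℕ} {c β r B g A : ℝ} {b κ : Fin N → ℝ} (hc : 0 ≤ c)
    (hr : 0 ≤ r) (hg : 0 < g) (hA : 0 ≤ A) (hb : ∀ i j, i ≠ j → g ≤ |b i - b j|)
    (hβ : |β| ≤ B) (hbB : ∀ i, |b i| ≤ B) (hκ : ∀ i, |κ i| ≤ A) (y : Fin N → ℂ) (l : ℂ) :
    (I * (-c - I * r * β) * (l * conj (∑ i, (κ i : ℂ) * y i)) +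
          r * (l * conj (∑ i, (κ i : ℂ) * b i * y i)) +
          r * ∑ i, ∑ j, ((if i = j then 0 else κ i * κ j / (b i - b j) : ℝ) : ℂ) *
            (l * conj (y j) - y i * conj l)).re ≤
      (c * A + 2 * r * B * A + 2 * r * N * (A ^ 2 / g)) * (‖l‖ * ∑ i, ‖y i‖) := by
  have hB : 0 ≤ B := (abs_nonneg _).trans hβ
  refine (re_le_norm _).trans ?_
  have h1 : ‖I * (-c - I * r * β) * (l * conj (∑ i, (κ i : ℂ) * y i))‖ ≤
      (c + r * B) * (‖l‖ * (A * ∑ i, ‖y i‖)) := by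
    rw [norm_mul, norm_mul, norm_mul, norm_I, one_mul, RCLike.norm_conj]
    refine mul_le_mul ?_ (mul_le_mul_of_nonneg_left (norm_sum_mul_le _ _ fun i => ?_)
      (norm_nonneg _)) (by positivity) (by positivity)
    · refine (norm_sub_le _ _).trans ?_
      rw [norm_neg, norm_mul, norm_mul, norm_I, one_mul, norm_real, norm_real, norm_real,
        Real.norm_of_nonneg hc, Real.norm_of_nonneg hr]
      gcongr
      exact hβ
    · rw [norm_real]; exact hκ i
  have h2 : ‖(r : ℂ) * (l * conj (∑ i, (κ i : ℂ) * b i * y i))‖ ≤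
      r * (‖l‖ * ((A * B) * ∑ i, ‖y i‖)) := by
    rw [norm_mul, norm_mul, RCLike.norm_conj, norm_real, Real.norm_of_nonneg hr]
    refine mul_le_mul_of_nonneg_left (mul_le_mul_of_nonneg_left (norm_sum_mul_le _ _ fun i => ?_)
      (norm_nonneg _)) hr
    rw [norm_mul, norm_real, norm_real]
    exact mul_le_mul (hκ i) (hbB i) (abs_nonneg _) hA
  have h3 : ‖(r : ℂ) * ∑ i, ∑ j, ((if i = j then 0 else κ i * κ j / (b i - b j) : ℝ) : ℂ) *
            (l * conj (y j) - y i * conj l)‖ ≤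
      r * (A ^ 2 / g * (2 * N * (‖l‖ * ∑ i, ‖y i‖))) := by
    rw [norm_mul, norm_real, Real.norm_of_nonneg hr]
    refine mul_le_mul_of_nonneg_left ?_ hr
    have : 2 * (N : ℝ) * (‖l‖ * ∑ i, ‖y i‖) =
        ∑ i : Fin N, ∑ j : Fin N, (‖l‖ * ‖y j‖ + ‖y i‖ * ‖l‖) := by
      simp only [Finset.sum_add_distrib, ← Finset.mul_sum, ← Finset.sum_mul, Finset.sum_const,
        Finset.card_univ, Fintype.card_fin, nsmul_eq_mul]
      ring
    rw [this, Finset.mul_sum]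
    refine (norm_sum_le _ _).trans (Finset.sum_le_sum fun i _ => (norm_sum_le _ _).trans ?_)
    rw [Finset.mul_sum]
    refine Finset.sum_le_sum fun j _ => ?_
    rw [norm_mul]
    refine mul_le_mul (norm_off_diag_le hg hA hb hκ i j) ?_ (norm_nonneg _) (by positivity)
    refine (norm_sub_le _ _).trans ?_
    rw [norm_mul, norm_mul, RCLike.norm_conj, RCLike.norm_conj]
  refine (norm_add₃_le).trans ((add_le_add (add_le_add h1 h2) h3).trans (le_of_eq ?_))
  ring

/-- Exponential decay from a differential inequality `F' ≤ -μ F`. -/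
theorem le_mul_exp_of_deriv_le {F F' : ℝ → ℝ} {μ : ℝ} (hF : ∀ t, HasDerivAt F (F' t) t)
    (h : ∀ t, F' t ≤ -μ * F t) {t : ℝ} (ht : 0 ≤ t) : F t ≤ F 0 * Real.exp (-μ * t) := by
  have hd : ∀ s, HasDerivAt (fun s => F s * Real.exp (μ * s))
      (F' s * Real.exp (μ * s) + F s * (Real.exp (μ * s) * μ)) s := fun s =>
    (hF s).mul (by simpa using (((hasDerivAt_id s).const_mul μ).exp))
  have hanti : Antitone fun s => F s * Real.exp (μ * s) := by
    refine antitone_of_deriv_nonpos (fun s => (hd s).differentiableAt) fun s => ?_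
    rw [(hd s).deriv]
    have := mul_le_mul_of_nonneg_right (h s) (Real.exp_pos (μ * s)).le
    nlinarith
  have := hanti ht
  simp only [mul_zero, Real.exp_zero, mul_one] at this
  calc F t = F t * Real.exp (μ * t) * Real.exp (-μ * t) := by
        rw [mul_assoc, ← Real.exp_add]; simp
    _ ≤ _ := mul_le_mul_of_nonneg_right this (Real.exp_pos _).le

/-- The numerical inequality behind the equivalence of the Lyapunov functional and the energy. -/
theorem star_equiv_numeric {a K ε Θ g x n₁ Y₂ N : ℝ} (hN : 0 ≤ N) (hK : 1 ≤ K) (ha : 0 ≤ a)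
    (hΘ : 0 ≤ Θ) (hg : 0 < g) (hx : 0 ≤ x) (hn : 0 ≤ n₁) (hY : 0 ≤ Y₂) (haK : a * K ≤ ε)
    (hn1 : n₁ ^ 2 ≤ N * Y₂) :
    a * (Θ * K * x * n₁) + a * ((Θ * K) ^ 2 / g * n₁ ^ 2) ≤
      ε * (Θ * (1 + N) + Θ ^ 2 / g * N) * (x ^ 2 + K * Y₂) := by
  have hε : 0 ≤ ε := le_trans (by positivity) haK
  have h2 : Y₂ ≤ K * Y₂ := le_mul_of_one_le_left hY hK
  have h0 : 0 ≤ K * Y₂ := hY.trans h2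
  have e1 : a * (Θ * K * x * n₁) ≤ ε * Θ * (1 + N) * (x ^ 2 + K * Y₂) := by
    have : x * n₁ ≤ (1 + N) * (x ^ 2 + K * Y₂) := by
      have h1 : x * n₁ ≤ x ^ 2 + n₁ ^ 2 := by
        nlinarith [sq_nonneg (x - n₁), sq_nonneg x, sq_nonneg n₁]
      have h3 : N * Y₂ ≤ N * (K * Y₂) := by gcongr
      have h4 : 0 ≤ N * x ^ 2 := by positivity
      linarith
    calc a * (Θ * K * x * n₁) = (a * K) * Θ * (x * n₁) := by ring
      _ ≤ ε * Θ * ((1 + N) * (x ^ 2 + K * Y₂)) := by gcongr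
      _ = _ := by ring
  have e2 : a * ((Θ * K) ^ 2 / g * n₁ ^ 2) ≤ ε * (Θ ^ 2 / g * N) * (x ^ 2 + K * Y₂) := by
    calc a * ((Θ * K) ^ 2 / g * n₁ ^ 2) ≤ a * ((Θ * K) ^ 2 / g * (N * Y₂)) := by gcongr
      _ = (a * K) * (Θ ^ 2 / g * N) * (K * Y₂) := by ring
      _ ≤ ε * (Θ ^ 2 / g * N) * (x ^ 2 + K * Y₂) := by
        have : K * Y₂ ≤ x ^ 2 + K * Y₂ := by linarith [sq_nonneg x]
        gcongr
  linarith

theorem star_coefficient_le {c r B Θ K N g D : ℝ} (hc : 0 ≤ c) (hΘ : 0 ≤ Θ) (hK : 0 ≤ K)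
    (hB : 0 ≤ B) (hN : 0 ≤ N) (hg : 0 < g) (hD : 1 ≤ D) (hr : r ≤ D) (hrK : r * K ≤ D) :
    c * (Θ * K) + 2 * r * B * (Θ * K) + 2 * r * N * ((Θ * K) ^ 2 / g) ≤
      (c * Θ + 2 * B * Θ + 2 * N * (Θ ^ 2 / g)) * K * D := by
  have f1 : c * (Θ * K) ≤ c * Θ * K * D := by
    rw [← mul_assoc]
    exact le_mul_of_one_le_right (by positivity) hD
  have f2 : 2 * r * B * (Θ * K) ≤ 2 * B * Θ * K * D := by
    calc 2 * r * B * (Θ * K) = 2 * B * Θ * K * r := by ring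
      _ ≤ _ := by gcongr
  have f3 : 2 * r * N * ((Θ * K) ^ 2 / g) ≤ 2 * N * (Θ ^ 2 / g) * K * D := by
    calc 2 * r * N * ((Θ * K) ^ 2 / g) = 2 * N * (Θ ^ 2 / g) * K * (r * K) := by ring
      _ ≤ _ := by gcongr
  calc _ ≤ c * Θ * K * D + 2 * B * Θ * K * D + 2 * N * (Θ ^ 2 / g) * K * D := by linarith
    _ = _ := by ring

theorem star_cross_le {ε r D C₁ K x n₁ θ Y₂ N : ℝ} (hN : 0 ≤ N) (hε : 0 < ε) (hr : 0 < r)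
    (hD : 0 < D) (hK : 0 < K) (hθ : 0 < θ) (hY : 0 ≤ Y₂)
    (hn1 : n₁ ^ 2 ≤ N * Y₂) :
    ε * r / D ^ 2 * (C₁ * K * D * (x * n₁)) ≤
      ε * (C₁ ^ 2 * N / (2 * θ ^ 2)) * x ^ 2 + ε * r / D ^ 2 * r * (θ * K) ^ 2 / 2 * Y₂ := by
  rcases hN.eq_or_lt with hN | hN'
  · subst hN
    have h0 : n₁ = 0 := by
      rw [zero_mul] at hn1
      exact pow_eq_zero_iff (two_ne_zero) |>.1 (le_antisymm hn1 (sq_nonneg _))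
    have : 0 ≤ ε * r / D ^ 2 * r * (θ * K) ^ 2 / 2 * Y₂ := by positivity
    rw [h0]
    simpa using this
  · have g1 : ε * r / D ^ 2 * r * (θ * K) ^ 2 / 2 * (n₁ ^ 2 / N) ≤
        ε * r / D ^ 2 * r * (θ * K) ^ 2 / 2 * Y₂ := by
      gcongr
      rw [div_le_iff₀ hN']
      linarith
    have h1 : ε * (C₁ ^ 2 * N / (2 * θ ^ 2)) * x ^ 2 +
        ε * r / D ^ 2 * r * (θ * K) ^ 2 / 2 * (n₁ ^ 2 / N) - ε * r / D ^ 2 *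
          (C₁ * K * D * (x * n₁)) =
        ε / (2 * N * θ ^ 2 * D ^ 2) * (C₁ * N * D * x - r * K * θ ^ 2 * n₁) ^ 2 := by
      field_simp
      ring
    have h0 : 0 ≤ ε / (2 * N * θ ^ 2 * D ^ 2) * (C₁ * N * D * x - r * K * θ ^ 2 * n₁) ^ 2 := by
      positivity
    linarith

/-- The numerical inequality behind the decay of the Lyapunov functional. -/
theorem star_dissipation_numeric {c r B Θ θ K N g D ε lam C₁ a x n₁ Y₂ κs κq : ℝ} (hN : 0 ≤ N)
    (hε : 0 < ε) (hr : 0 < r) (hK : 0 < K) (hθ : 0 < θ) (hΘ : 0 ≤ Θ) (hY : 0 ≤ Y₂) (hx : 0 ≤ x)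
    (hn : 0 ≤ n₁) (hc : 0 < c) (hB : 0 ≤ B) (hg : 0 < g) (hD : 1 ≤ D) (hrD : r ≤ D)
    (hrK : r * K ≤ D) (ha : a = ε * r / D ^ 2) (hlam0 : 0 < lam) (hlam1 : lam ≤ 1)
    (harK : a * r * K = ε * lam)
    (hC₁ : C₁ = c * Θ + 2 * B * Θ + 2 * N * (Θ ^ 2 / g))
    (hε1 : ε * (N * Θ + C₁ ^ 2 * N / (2 * θ ^ 2)) ≤ c) (hn1 : n₁ ^ 2 ≤ N * Y₂)
    (hκs : κs ≤ N * (Θ * K)) (hκq : (θ * K) ^ 2 * Y₂ ≤ κq) :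
    -2 * c * x ^ 2 - a * r * κq + a * r * κs * x ^ 2 +
        a * ((c * (Θ * K) + 2 * r * B * (Θ * K) + 2 * r * N * ((Θ * K) ^ 2 / g)) *
          (x * n₁)) ≤ -(min c (ε * θ ^ 2 / 2) * lam) * (x ^ 2 + K * Y₂) := by
  have ha0 : 0 < a := by rw [ha]; positivity
  have e1 := star_coefficient_le hc.le hΘ hK.le hB hN hg hD hrD hrK
  rw [← hC₁] at e1
  have e2 := star_cross_le (C₁ := C₁) (x := x) hN hε hr (lt_of_lt_of_le one_pos hD) hK hθ hY hn1
  rw [← ha] at e2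
  have e3 : a * ((c * (Θ * K) + 2 * r * B * (Θ * K) + 2 * r * N * ((Θ * K) ^ 2 / g)) *
      (x * n₁)) ≤ a * (C₁ * K * D * (x * n₁)) := by gcongr
  have e4 : a * r * κs * x ^ 2 ≤ ε * (N * Θ) * x ^ 2 := by
    calc a * r * κs * x ^ 2 ≤ a * r * (N * (Θ * K)) * x ^ 2 := by gcongr
      _ = (a * r * K) * (N * Θ) * x ^ 2 := by ring
      _ = lam * (ε * (N * Θ) * x ^ 2) := by rw [harK]; ring
      _ ≤ ε * (N * Θ) * x ^ 2 := mul_le_of_le_one_left (by positivity) hlam1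
  have e5 : a * r * ((θ * K) ^ 2 * Y₂) ≤ a * r * κq := by gcongr
  have e6 : ε * (N * Θ) * x ^ 2 + ε * (C₁ ^ 2 * N / (2 * θ ^ 2)) * x ^ 2 ≤ c * x ^ 2 := by
    rw [← add_mul, ← mul_add]
    gcongr
  have e7 : a * r * (θ * K) ^ 2 / 2 * Y₂ = (ε * θ ^ 2 / 2) * lam * (K * Y₂) := by
    linear_combination (θ ^ 2 * K * Y₂ / 2) * harK
  have e7' : a * r * ((θ * K) ^ 2 * Y₂) = 2 * (a * r * (θ * K) ^ 2 / 2 * Y₂) := by ring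
  have e8 : min c (ε * θ ^ 2 / 2) * lam * (K * Y₂) ≤ (ε * θ ^ 2 / 2) * lam * (K * Y₂) := by
    gcongr
    exact min_le_right _ _
  have e9 : min c (ε * θ ^ 2 / 2) * lam * x ^ 2 ≤ c * x ^ 2 := by
    gcongr
    exact (mul_le_of_le_one_right (by positivity) hlam1).trans (min_le_left _ _)
  have e10 : -(min c (ε * θ ^ 2 / 2) * lam) * (x ^ 2 + K * Y₂) =
    -(min c (ε * θ ^ 2 / 2) * lam * x ^ 2) - min c (ε * θ ^ 2 / 2) * lam * (K * Y₂) := by ring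
  rw [e10]
  linarith

set_option maxHeartbeats 400000 in
/-- Decay of the energy of the star system, uniformly in the coefficients. The weights `κ_i` are
comparable to `K`; the relevant cases are `K = 1` and `K = 1 + r⁻²`. -/
theorem star_decay (N : ℕ) {c B g θ Θ : ℝ} (hc : 0 < c) (hB : 0 ≤ B) (hg : 0 < g) (hθ : 0 < θ)
    (hΘ : 0 < Θ) :
    ∃ C c₀ : ℝ, 0 < C ∧ 0 < c₀ ∧ ∀ (b κ : Fin N → ℝ) (β K r : ℝ), |β| ≤ B → (∀ i, |b i| ≤ B) →
      (∀ i j, i ≠ j → g ≤ |b i - b j|) → (∀ i, θ * K ≤ κ i) → (∀ i, κ i ≤ Θ * K) → 1 ≤ K →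
      0 < r → ∀ (y : Fin N → ℝ → ℂ) (l : ℝ → ℂ),
      (∀ i t, HasDerivAt (y i) (I * r * (b i * y i t + l t)) t) →
      (∀ t, HasDerivAt l (-c * l t - I * r * β * l t + I * r * ∑ i, (κ i : ℂ) * y i t) t) →
      ∀ t, 0 ≤ t → ‖l t‖ ^ 2 + K * ∑ i, ‖y i t‖ ^ 2 ≤
        C * Real.exp (-(c₀ * (r ^ 2 * K / (1 + r + r * K) ^ 2)) * t) *
          (‖l 0‖ ^ 2 + K * ∑ i, ‖y i 0‖ ^ 2) := by
  -- `C₂` bounds the cross terms of the Lyapunov functional, and `C₁` those of its derivative. For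
  -- small `ε`, and with `a = ε r / (1 + r + r K)²`, both are absorbed, whatever `r` and `K` are.
  set C₁ : ℝ := c * Θ + 2 * B * Θ + 2 * N * (Θ ^ 2 / g) with hC₁
  set C₂ : ℝ := Θ * (1 + N) + Θ ^ 2 / g * N with hC₂
  set e₀ : ℝ := min 1 θ with he₀
  have hC₁0 : 0 < C₁ := by positivity
  have hC₂0 : 0 < C₂ := by positivity
  have he₀0 : 0 < e₀ := by positivity
  obtain ⟨ε, hε, hε1, hε2⟩ : ∃ ε : ℝ, 0 < ε ∧ ε * (N * Θ + C₁ ^ 2 * N / (2 * θ ^ 2)) ≤ c ∧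
      ε * C₂ ≤ e₀ / 2 := by
    set X : ℝ := N * Θ + C₁ ^ 2 * N / (2 * θ ^ 2)
    have hX : 0 ≤ X := by positivity
    refine ⟨min (c / (X + 1)) (e₀ / 2 / C₂), by positivity, ?_, ?_⟩
    · calc _ ≤ c / (X + 1) * X := mul_le_mul_of_nonneg_right (min_le_left _ _) hX
        _ ≤ c := by
          rw [div_mul_eq_mul_div, div_le_iff₀ (by positivity)]
          nlinarith
    · calc _ ≤ (e₀ / 2 / C₂) * C₂ := mul_le_mul_of_nonneg_right (min_le_right _ _) hC₂0.le
        _ = _ := by field_simp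
  set c₂ : ℝ := min c (ε * θ ^ 2 / 2) with hc₂
  have hc₂0 : 0 < c₂ := by positivity
  set Θ' : ℝ := max 1 Θ + e₀ / 2 with hΘ'
  have hΘ'0 : 0 < Θ' := by positivity
  refine ⟨2 * Θ' / e₀, c₂ / Θ', by positivity, by positivity, ?_⟩
  intro b κ β K r hβ hbB hbg hκ1 hκ2 hK hr y l hy hl t ht
  have hK0 : 0 < K := by linarith
  set D : ℝ := 1 + r + r * K with hD
  have hD1 : 1 ≤ D := by rw [hD]; nlinarith [mul_pos hr hK0]
  set a : ℝ := ε * r / D ^ 2 with ha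
  have ha0 : 0 < a := by positivity
  set lam : ℝ := r ^ 2 * K / D ^ 2 with hlam
  have hlam0 : 0 < lam := by positivity
  have hrK : r * K ≤ D := by rw [hD]; linarith
  have hrD : r ≤ D := by rw [hD]; nlinarith [mul_pos hr hK0]
  have hlam1 : lam ≤ 1 := by
    rw [hlam, div_le_one (by positivity)]
    nlinarith [mul_pos hr hK0]
  have harK : a * r * K = ε * lam := by rw [ha, hlam]; field_simp
  have haK : a * K ≤ ε := by
    rw [ha, div_mul_eq_mul_div, div_le_iff₀ (by positivity)]
    nlinarith [mul_le_mul_of_nonneg_left hrK hε.le, mul_le_mul_of_nonneg_left hD1 hε.le]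
  have hκ0 : ∀ i, 0 < κ i := fun i => lt_of_lt_of_le (by positivity) (hκ1 i)
  have hκabs : ∀ i, |κ i| ≤ Θ * K := fun i => by rw [abs_of_pos (hκ0 i)]; exact hκ2 i
  have hbne : ∀ i j, i ≠ j → b i ≠ b j := fun i j h h' => by
    have := hbg i j h
    rw [h', sub_self, abs_zero] at this
    linarith
  have hder := hasDerivAt_starLyapunov a c β r b κ hbne y l hy hl
  set F : ℝ → ℝ := fun t => (starLyapunov a b κ (fun i => y i t) (l t)).re with hF
  set X : ℝ → ℝ := fun t => ‖l t‖ ^ 2 + K * ∑ i, ‖y i t‖ ^ 2 with hX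
  -- `F` is equivalent to the energy `X`
  have hclose : ∀ s, |F s - (‖l s‖ ^ 2 + ∑ i, κ i * ‖y i s‖ ^ 2)| ≤ e₀ / 2 * X s := by
    intro s
    refine (starLyapunov_sub_le ha0.le hg (by positivity) hbg hκabs _ _).trans ?_
    have hX0 : 0 ≤ X s := by simp only [hX]; positivity
    calc _ ≤ (ε * C₂) * X s := star_equiv_numeric (Nat.cast_nonneg N) hK ha0.le hΘ.le hg
          (norm_nonneg _) (Finset.sum_nonneg fun i _ => norm_nonneg _)
          (Finset.sum_nonneg fun i _ => by positivity) haK (sq_sum_norm_le fun i => y i s)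
      _ ≤ _ := by gcongr
  have hElow : ∀ s, e₀ * X s ≤ ‖l s‖ ^ 2 + ∑ i, κ i * ‖y i s‖ ^ 2 := by
    intro s
    simp only [hX, mul_add]
    refine add_le_add ?_ ?_
    · nlinarith [min_le_left 1 θ, sq_nonneg ‖l s‖]
    · rw [← mul_assoc, Finset.mul_sum]
      refine Finset.sum_le_sum fun i _ => mul_le_mul_of_nonneg_right ?_ (by positivity)
      exact (mul_le_mul_of_nonneg_right (min_le_right _ _) hK0.le).trans (hκ1 i)
  have hEup : ∀ s, ‖l s‖ ^ 2 + ∑ i, κ i * ‖y i s‖ ^ 2 ≤ max 1 Θ * X s := by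
    intro s
    simp only [hX, mul_add]
    refine add_le_add ?_ ?_
    · nlinarith [le_max_left 1 Θ, sq_nonneg ‖l s‖]
    · rw [← mul_assoc, Finset.mul_sum]
      refine Finset.sum_le_sum fun i _ => mul_le_mul_of_nonneg_right ?_ (by positivity)
      exact (hκ2 i).trans (mul_le_mul_of_nonneg_right (le_max_right _ _) hK0.le)
  have hFlow : ∀ s, e₀ / 2 * X s ≤ F s := fun s => by
    have := (abs_le.1 (hclose s)).1
    linarith [hElow s]
  have hFup : ∀ s, F s ≤ Θ' * X s := fun s => by
    have := (abs_le.1 (hclose s)).2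
    rw [hΘ', add_mul]
    linarith [hEup s]
  -- the differential inequality
  have hdecay := le_mul_exp_of_deriv_le (μ := c₂ / Θ' * lam) hder (fun s => ?_) ht
  · have h1 := hFlow t
    have h2 : F t ≤ Θ' * X 0 * Real.exp (-(c₂ / Θ' * lam) * t) :=
      hdecay.trans (mul_le_mul_of_nonneg_right (hFup 0) (Real.exp_pos _).le)
    have h3 : X t ≤ (Θ' * X 0 * Real.exp (-(c₂ / Θ' * lam) * t)) / (e₀ / 2) := by
      rw [le_div_iff₀ (by positivity)]
      linarith
    refine h3.trans (le_of_eq ?_)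
    change _ = 2 * Θ' / e₀ * _ * X 0
    field_simp
  · have herr := starLyapunov_error_le (A := Θ * K) hc.le hr.le hg (by positivity) hbg hβ hbB hκabs
      (fun i => y i s) (l s)
    have hmain : -2 * c * ‖l s‖ ^ 2 - a * r * ∑ i, κ i ^ 2 * ‖y i s‖ ^ 2 +
        a * r * (∑ i, κ i) * ‖l s‖ ^ 2 +
        a * ((c * (Θ * K) + 2 * r * B * (Θ * K) + 2 * r * N * ((Θ * K) ^ 2 / g)) *
          (‖l s‖ * ∑ i, ‖y i s‖)) ≤ -(c₂ * lam) * X s := by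
      have hκsum : ∑ i, κ i ≤ N * (Θ * K) := by
        simpa using Finset.sum_le_sum fun i (_ : i ∈ Finset.univ) => hκ2 i
      have hκsq : (θ * K) ^ 2 * ∑ i, ‖y i s‖ ^ 2 ≤ ∑ i, κ i ^ 2 * ‖y i s‖ ^ 2 := by
        rw [Finset.mul_sum]
        refine Finset.sum_le_sum fun i _ => mul_le_mul_of_nonneg_right ?_ (by positivity)
        exact pow_le_pow_left₀ (by positivity) (hκ1 i) 2
      exact star_dissipation_numeric (Nat.cast_nonneg N) hε hr hK0 hθ hΘ.le
        (Finset.sum_nonneg fun i _ => by positivity) (norm_nonneg _)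
        (Finset.sum_nonneg fun i _ => norm_nonneg _) hc hB hg hD1 hrD hrK ha hlam0 hlam1 harK hC₁
        hε1 (sq_sum_norm_le fun i => y i s) hκsum hκsq
    have hle : -(c₂ * lam) * X s ≤ -(c₂ / Θ' * lam) * F s := by
      have : c₂ / Θ' * lam * F s ≤ c₂ / Θ' * lam * (Θ' * X s) := by gcongr; exact hFup s
      have h' : c₂ / Θ' * lam * (Θ' * X s) = c₂ * lam * X s := by field_simp
      linarith
    refine le_trans ?_ (hmain.trans hle)
    gcongr

end

/-! ### Jets and stable filters -/

/-- A scalar function together with all its derivatives: `w k` is the `k`-th derivative. -/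
def IsJet (w : ℕ → ℝ → ℂ) : Prop := ∀ k t, HasDerivAt (w k) (w (k + 1) t) t

/-- `w` is the jet of a solution of `w^{(m)} + ∑_{j<m} q_j w^{(j)} = 0`. The differentiated
equations are part of the definition. -/
structure SolvesODE (m : ℕ) (q : ℕ → ℂ) (w : ℕ → ℝ → ℂ) : Prop where
  isJet : IsJet w
  equation : ∀ l t, w (m + l) t = -∑ j ∈ Finset.range m, q j * w (l + j) t

theorem IsJet.shift {w : ℕ → ℝ → ℂ} (hw : IsJet w) (k : ℕ) : IsJet fun i => w (k + i) :=
  fun i t => hw (k + i) t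

/-- The operator `∑_{i≤h} H_i ∂_t^i` is stable with rate `σ`: the decay of the right hand side,
which may be slower than `exp (-σ t)`, is inherited by the solution. -/
def StableFilter (h : ℕ) (H : ℕ → ℂ) (σ : ℝ) : Prop :=
  ∀ C : ℝ, 0 ≤ C → ∃ C' : ℝ, 0 ≤ C' ∧ ∀ (y : ℕ → ℝ → ℂ) (g ρ : ℝ), IsJet y → 0 ≤ g → ρ ≤ σ →
    (∀ i < h, ‖y i 0‖ ≤ C) →
    (∀ t, 0 ≤ t → ‖∑ i ∈ Finset.range (h + 1), H i * y i t‖ ≤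
      C * (g * Real.exp (-ρ * t) + Real.exp (-σ * t))) →
    ∀ t, 0 ≤ t → ‖y 0 t‖ ≤ C' * (g * Real.exp (-ρ * t) + Real.exp (-σ * t))

/-- Duhamel's formula for `y' = α y + f`, where `α` decays faster than the right hand side. -/
theorem norm_le_of_first_order {α : ℂ} {σ ρ g C₀ C : ℝ} {y f : ℝ → ℂ} (hα : α.re < -σ)
    (hρ : ρ ≤ σ) (hg : 0 ≤ g) (hC : 0 ≤ C)
    (hy : ∀ t, HasDerivAt y (α * y t + f t) t) (h0 : ‖y 0‖ ≤ C₀)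
    (hf : ∀ t, 0 ≤ t → ‖f t‖ ≤ C * (g * Real.exp (-ρ * t) + Real.exp (-σ * t))) {t : ℝ}
    (ht : 0 ≤ t) :
    ‖y t‖ ≤ (C₀ + C / (-α.re - σ)) * (g * Real.exp (-ρ * t) + Real.exp (-σ * t)) := by
  set μ : ℝ := -α.re with hμ
  have hμσ : 0 < μ - σ := by rw [hμ]; linarith
  have hd : ∀ s : ℝ, HasDerivAt (fun s : ℝ => Complex.exp (-α * s) * y s)
      (Complex.exp (-α * s) * f s) s := by
    intro s
    have h1 : HasDerivAt (fun s : ℝ => Complex.exp (-α * s)) (Complex.exp (-α * s) * (-α)) s := by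
      simpa using ((hasDerivAt_id (s : ℂ)).const_mul (-α)).cexp.comp_ofReal
    convert! h1.mul (hy s) using 1
    ring
  have hnorm : ∀ s : ℝ, ‖Complex.exp (-α * s)‖ = Real.exp (μ * s) := fun s => by
    rw [Complex.norm_exp]; simp [hμ]
  set B : ℝ → ℝ := fun s => C₀ + C / (μ - σ) *
    (g * Real.exp ((μ - ρ) * s) + Real.exp ((μ - σ) * s))
  have hexp : ∀ a s : ℝ, HasDerivAt (fun s => Real.exp (a * s)) (Real.exp (a * s) * a) s :=
    fun a s => by simpa using ((hasDerivAt_id s).const_mul a).exp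
  have hB : ∀ s, HasDerivAt B (C / (μ - σ) * (g * (Real.exp ((μ - ρ) * s) * (μ - ρ)) +
      Real.exp ((μ - σ) * s) * (μ - σ))) s := fun s =>
    ((((hexp _ s).const_mul g).add (hexp _ s)).const_mul _).const_add C₀
  have hle := image_norm_le_of_norm_deriv_right_le_deriv_boundary (a := 0) (b := t)
    (f := fun s : ℝ => Complex.exp (-α * s) * y s) (f' := fun s => Complex.exp (-α * s) * f s)
    (fun s _ => (hd s).continuousAt.continuousWithinAt) (fun s _ => (hd s).hasDerivWithinAt)
    (B := B) (by
      simp only [Complex.ofReal_zero, mul_zero, Complex.exp_zero, one_mul, B, Real.exp_zero]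
      have : 0 ≤ C / (μ - σ) * (g * 1 + 1) := by positivity
      linarith) hB (fun s hs => by
      rw [norm_mul, hnorm]
      have e1 : ∀ ν, Real.exp (μ * s) * Real.exp (-ν * s) = Real.exp ((μ - ν) * s) := fun ν => by
        rw [← Real.exp_add]; ring_nf
      calc Real.exp (μ * s) * ‖f s‖
          ≤ Real.exp (μ * s) * (C * (g * Real.exp (-ρ * s) + Real.exp (-σ * s))) := by
            gcongr; exact hf s hs.1
        _ = C / (μ - σ) * (g * (Real.exp ((μ - ρ) * s) * (μ - σ)) +
              Real.exp ((μ - σ) * s) * (μ - σ)) := by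
            rw [← e1, ← e1]; field_simp
        _ ≤ _ := by gcongr) (right_mem_Icc.2 ht)
  rw [norm_mul, hnorm] at hle
  have e1 : ∀ ν, Real.exp (-μ * t) * Real.exp ((μ - ν) * t) = Real.exp (-ν * t) := fun ν => by
    rw [← Real.exp_add]; ring_nf
  have hC₀ : 0 ≤ C₀ := (norm_nonneg _).trans h0
  calc ‖y t‖ = Real.exp (-μ * t) * (Real.exp (μ * t) * ‖y t‖) := by
        rw [← mul_assoc, ← Real.exp_add]; simp
    _ ≤ Real.exp (-μ * t) * B t := by gcongr
    _ = C₀ * Real.exp (-μ * t) +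
        C / (μ - σ) * (g * Real.exp (-ρ * t) + Real.exp (-σ * t)) := by
        rw [← e1 ρ, ← e1 σ]; simp only [B]; ring
    _ ≤ C₀ * (g * Real.exp (-ρ * t) + Real.exp (-σ * t)) +
        C / (μ - σ) * (g * Real.exp (-ρ * t) + Real.exp (-σ * t)) := by
        gcongr
        have : Real.exp (-μ * t) ≤ Real.exp (-σ * t) := by
          apply Real.exp_le_exp.2; nlinarith
        have : 0 ≤ g * Real.exp (-ρ * t) := by positivity
        linarith
    _ = _ := by ring

theorem stableFilter_one {H : ℕ → ℂ} {c σ : ℝ} (h0 : H 0 = c) (h1 : H 1 = 1) (hσ : σ < c) :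
    StableFilter 1 H σ := by
  intro C hC
  refine ⟨C + C / (c - σ), by have : 0 < c - σ := by linarith
                              positivity, ?_⟩
  intro y g ρ hy hg hρ hi hf t ht
  have := norm_le_of_first_order (α := -(c : ℂ)) (σ := σ) (ρ := ρ) (g := g) (C₀ := C) (C := C)
    (y := y 0) (f := fun t => ∑ i ∈ Finset.range (1 + 1), H i * y i t) (by simpa using hσ) hρ hg hC
    (fun t => (hy 0 t).congr_deriv (by simp [Finset.sum_range_succ, h0, h1]))
    (hi 0 one_pos) hf ht
  simpa using this

/-- The roots of `X² + c X + d` with `c, d > 0` are in the left half plane. -/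
theorem exists_roots_re_neg {c d : ℝ} (hc : 0 < c) (hd : 0 < d) :
    ∃ α β : ℂ, α.re < 0 ∧ β.re < 0 ∧ α + β = -c ∧ α * β = d := by
  obtain ⟨s, hs⟩ := IsAlgClosed.exists_pow_nat_eq ((c : ℂ) ^ 2 - 4 * d) two_pos
  have hre := congrArg Complex.re hs
  have him := congrArg Complex.im hs
  simp only [sq, Complex.mul_re, Complex.sub_re, Complex.ofReal_re, Complex.ofReal_im,
    Complex.mul_im, Complex.sub_im, Complex.re_ofNat, Complex.im_ofNat] at hre him
  have hlt : |s.re| < c := by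
    refine abs_lt_of_sq_lt_sq ?_ hc.le
    rcases mul_eq_zero.1 (show s.re * s.im = 0 by linarith) with h | h
    · rw [h]; nlinarith
    · rw [h] at hre; nlinarith
  refine ⟨(-c + s) / 2, (-c - s) / 2, ?_, ?_, by ring, by linear_combination -hs / 4⟩
  · have := (abs_lt.1 hlt).2
    simp
    linarith
  · have := (abs_lt.1 hlt).1
    simp
    linarith

theorem stableFilter_two {H : ℕ → ℂ} {c d : ℝ} (hc : 0 < c) (hd : 0 < d) (h0 : H 0 = d)
    (h1 : H 1 = c) (h2 : H 2 = 1) : ∃ σ₀ : ℝ, 0 < σ₀ ∧ ∀ σ < σ₀, StableFilter 2 H σ := by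
  obtain ⟨α, β, hα, hβ, hαβ, hp⟩ := exists_roots_re_neg hc hd
  refine ⟨min (-α.re) (-β.re), lt_min (by linarith) (by linarith), fun σ hσ C hC => ?_⟩
  have hσα : α.re < -σ := by linarith [hσ.trans_le (min_le_left (-α.re) (-β.re))]
  have hσβ : β.re < -σ := by linarith [hσ.trans_le (min_le_right (-α.re) (-β.re))]
  have hα0 : 0 < -α.re - σ := by linarith
  have hβ0 : 0 < -β.re - σ := by linarith
  set C₁ : ℝ := C + ‖β‖ * C + C / (-α.re - σ) with hC₁
  have hC₁0 : 0 ≤ C₁ := by positivity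
  refine ⟨C + C₁ / (-β.re - σ), by positivity, ?_⟩
  intro y g ρ hy hg hρ hi hf t ht
  refine norm_le_of_first_order (f := fun t => y 1 t - β * y 0 t) hσβ hρ hg hC₁0
    (fun t => (hy 0 t).congr_deriv (by simp)) (hi 0 two_pos) (fun s hs => ?_) ht
  refine norm_le_of_first_order (f := fun t => ∑ i ∈ Finset.range (2 + 1), H i * y i t)
    hσα hρ hg hC (fun t => ((hy 1 t).sub ((hy 0 t).const_mul β)).congr_deriv ?_) ?_ hf hs
  · simp only [Finset.sum_range_succ, Finset.sum_range_zero, h0, h1, h2, zero_add,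
      Pi.sub_apply]
    linear_combination (-y 1 t) * hαβ + y 0 t * hp
  · refine (norm_sub_le _ _).trans (add_le_add (hi 1 one_lt_two) ?_)
    rw [norm_mul]
    exact mul_le_mul_of_nonneg_left (hi 0 two_pos) (norm_nonneg _)

/-! ### Bounds for higher derivatives -/

/-- The equation propagates bounds by weights `W k` for `k < m` to all higher derivatives, if the
weights are compatible with the size of the coefficients. -/
theorem SolvesODE.norm_le_weight {m : ℕ} {q : ℕ → ℂ} {w : ℕ → ℝ → ℂ} (hw : SolvesODE m q w)
    {A C t : ℝ} {W : ℕ → ℝ} (hA : 0 ≤ A) (hC : 0 ≤ C) (hW0 : ∀ k, 0 ≤ W k)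
    (hW : ∀ j < m, ∀ l, ‖q j‖ * W (l + j) ≤ A * W (m + l))
    (h : ∀ k < m, ‖w k t‖ ≤ C * W k) (k : ℕ) : ‖w k t‖ ≤ C * (1 + m * A) ^ k * W k := by
  have h1 : 1 ≤ 1 + m * A := by
    have : 0 ≤ m * A := by positivity
    linarith
  induction k using Nat.strong_induction_on with
  | _ k ih =>
    rcases lt_or_ge k m with hk | hk
    · refine (h k hk).trans (mul_le_mul_of_nonneg_right ?_ (hW0 k))
      exact le_mul_of_one_le_right hC (one_le_pow₀ h1)
    · obtain ⟨l, rfl⟩ := Nat.exists_eq_add_of_le hk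
      rw [hw.equation, norm_neg]
      rcases Nat.eq_zero_or_pos m with hm | hm
      · subst hm
        simpa using mul_nonneg hC (hW0 _)
      calc ‖∑ j ∈ Finset.range m, q j * w (l + j) t‖
          ≤ ∑ j ∈ Finset.range m, C * (1 + m * A) ^ (m + l - 1) * (A * W (m + l)) := by
            refine norm_sum_le_of_le _ fun j hj => ?_
            have hj' := Finset.mem_range.1 hj
            rw [norm_mul]
            calc ‖q j‖ * ‖w (l + j) t‖ ≤ ‖q j‖ * (C * (1 + m * A) ^ (l + j) * W (l + j)) := by
                  gcongr; exact ih _ (by omega)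
              _ = C * (1 + m * A) ^ (l + j) * (‖q j‖ * W (l + j)) := by ring
              _ ≤ C * (1 + m * A) ^ (m + l - 1) * (A * W (m + l)) := by
                  refine mul_le_mul (mul_le_mul_of_nonneg_left (pow_le_pow_right₀ h1 (by omega)) hC)
                    (hW j hj' l) (mul_nonneg (norm_nonneg _) (hW0 _)) (by positivity)
        _ = C * (1 + m * A) ^ (m + l - 1) * (m * A) * W (m + l) := by
            rw [Finset.sum_const, Finset.card_range, nsmul_eq_mul]; ring
        _ ≤ C * (1 + m * A) ^ (m + l - 1) * (1 + m * A) * W (m + l) := by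
            gcongr
            · exact hW0 _
            · linarith
        _ = _ := by
            rw [mul_assoc C, ← pow_succ]
            congr 3
            omega

/-- For `r ≥ 1`, where each derivative costs a power of `r`. -/
theorem SolvesODE.norm_le_high {m : ℕ} {q : ℕ → ℂ} {w : ℕ → ℝ → ℂ} (hw : SolvesODE m q w)
    {A C t r G : ℝ} (hA : 0 ≤ A) (hC : 0 ≤ C) (hr : 0 ≤ r) (hG : 0 ≤ G)
    (hq : ∀ j < m, ‖q j‖ ≤ A * r ^ (m - j))
    (h : ∀ k < m, ‖w k t‖ ≤ C * (r ^ k * G)) (k : ℕ) :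
    ‖w k t‖ ≤ C * (1 + m * A) ^ k * (r ^ k * G) := by
  refine hw.norm_le_weight (W := fun k => r ^ k * G) hA hC (fun k => by positivity)
    (fun j hj l => ?_) h k
  calc ‖q j‖ * (r ^ (l + j) * G) ≤ A * r ^ (m - j) * (r ^ (l + j) * G) := by
        gcongr; exact hq j hj
    _ = A * (r ^ ((m - j) + (l + j)) * G) := by rw [pow_add]; ring
    _ = _ := by congr 3; omega

/-- For `r ≤ 1`, where only the first `M` derivatives gain a power of `r`, and the other modes decay
like `G'` without any gain. -/
theorem SolvesODE.norm_le_low {m M : ℕ} {q : ℕ → ℂ} {w : ℕ → ℝ → ℂ} (hw : SolvesODE m q w)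
    {A C t r G G' : ℝ} (hA : 0 ≤ A) (hC : 0 ≤ C) (hr : 0 ≤ r) (hr1 : r ≤ 1)
    (hG : 0 ≤ G) (hG' : 0 ≤ G') (hq : ∀ j < m, ‖q j‖ ≤ A * r ^ (M - j))
    (h : ∀ k < m, ‖w k t‖ ≤ C * (r ^ min k M * G + G')) (k : ℕ) :
    ‖w k t‖ ≤ C * (1 + m * A) ^ k * (r ^ min k M * G + G') := by
  refine hw.norm_le_weight (W := fun k => r ^ min k M * G + G') hA hC (fun k => by positivity)
    (fun j hj l => ?_) h k
  calc ‖q j‖ * (r ^ min (l + j) M * G + G')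
      ≤ A * r ^ (M - j) * (r ^ min (l + j) M * G + G') := by gcongr; exact hq j hj
    _ = A * (r ^ (M - j + min (l + j) M) * G + r ^ (M - j) * G') := by rw [pow_add]; ring
    _ ≤ A * (r ^ min (m + l) M * G + 1 * G') := by
        gcongr A * (?_ * G + ?_ * G')
        · exact pow_le_pow_of_le_one hr hr1 (by omega)
        · exact pow_le_one₀ hr hr1
    _ = _ := by rw [one_mul]

/-- Bootstrap at low frequencies: of the `m` modes, `m - M` are damped. The light ones gain a power
of `r` for each derivative, and the stable filter transfers this gain to all derivatives. -/
theorem exists_low_bound {m M : ℕ} (hM : M ≤ m) {H : ℕ → ℂ} (hH : H (m - M) = 1) {A σ : ℝ}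
    (hA : 0 ≤ A) (hstable : StableFilter (m - M) H σ) {C : ℝ} (hC : 0 ≤ C) (N : ℕ) :
    ∃ C' : ℕ → ℝ, (∀ k, 0 ≤ C' k) ∧ ∀ (q : ℕ → ℂ) (r g ρ : ℝ) (w : ℕ → ℝ → ℂ), 0 ≤ r → r ≤ 1 →
      0 ≤ g → g * r ^ M ≤ 1 → ρ ≤ σ → (∀ j < m, ‖q j‖ ≤ A * r ^ (M - j)) →
      (∀ i < m - M, ‖q (M + i) - H i‖ ≤ A * r) → SolvesODE m q w →
      (∀ k < m, ∀ t, 0 ≤ t →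
        ‖w k t‖ ≤ C * (r ^ min k M * (g * Real.exp (-ρ * t)) + Real.exp (-σ * t))) →
      ∀ k t, 0 ≤ t →
        ‖w k t‖ ≤ C' k * (r ^ min k (M + N) * (g * Real.exp (-ρ * t)) + Real.exp (-σ * t)) := by
  induction N with
  | zero =>
    refine ⟨fun k => C * (1 + m * A) ^ k, fun k => by positivity, ?_⟩
    intro q r g ρ w hr hr1 hg hgr hρ hq hqH hw h k t ht
    exact hw.norm_le_low hA hC hr hr1 (by positivity) (Real.exp_pos _).le hq
      (fun k hk => h k hk t ht) k
  | succ N ih =>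
    obtain ⟨C₁, hC₁, ih⟩ := ih
    set S : ℕ → ℝ := fun k => ∑ i ∈ Finset.range (k + m + 1), C₁ i
    have hS : ∀ k i, i < k + m + 1 → C₁ i ≤ S k := fun k i hi =>
      Finset.single_le_sum (fun i _ => hC₁ i) (Finset.mem_range.2 hi)
    have hS0 : ∀ k, 0 ≤ S k := fun k => Finset.sum_nonneg fun i _ => hC₁ i
    choose C₂ hC₂ hfilter using fun k => hstable ((2 + 2 * m * A) * S k)
      (mul_nonneg (by positivity) (hS0 k))
    refine ⟨fun k => max (C₁ k) (C₂ k), fun k => le_max_of_le_left (hC₁ k), ?_⟩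
    intro q r g ρ w hr hr1 hg hgr hρ hq hqH hw h k t ht
    have hk := ih q r g ρ w hr hr1 hg hgr hρ hq hqH hw h
    have hexp : ∀ t, 0 ≤ r ^ (M + (N + 1)) * (g * Real.exp (-ρ * t)) + Real.exp (-σ * t) :=
      fun t => by positivity
    rcases le_or_gt k (M + N) with hkN | hkN
    · refine (hk k t ht).trans ?_
      rw [min_eq_left hkN, min_eq_left (by omega)]
      gcongr
      exact le_max_left _ _
    · rw [min_eq_right (by omega)]
      have := hfilter k (fun i => w (k + i)) (r ^ (M + (N + 1)) * g) ρ (hw.isJet.shift k)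
        (by positivity) hρ (fun i hi => ?_) (fun s hs => ?_) t ht
      · rw [mul_assoc] at this
        refine this.trans ?_
        gcongr
        exact le_max_right _ _
      · refine (hk (k + i) 0 le_rfl).trans ?_
        rw [min_eq_right (by omega)]
        have h1 : r ^ (M + N) * g ≤ 1 := by
          rw [pow_add]
          calc r ^ M * r ^ N * g = g * r ^ M * r ^ N := by ring
            _ ≤ 1 * 1 := by gcongr; exact pow_le_one₀ hr hr1
            _ = 1 := one_mul 1
        have h3 : 0 ≤ 2 * m * A * S k := mul_nonneg (by positivity) (hS0 k)
        simp only [mul_zero, Real.exp_zero, mul_one]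
        nlinarith [hS k (k + i) (by omega), hC₁ (k + i), hS0 k]
      · set G : ℝ := r ^ (M + (N + 1)) * g * Real.exp (-ρ * s) + Real.exp (-σ * s) with hG
        have hG0 : 0 ≤ G := by positivity
        have hsplit : ∑ i ∈ Finset.range (m - M + 1), H i * w (k + i) s =
            -∑ i ∈ Finset.range M, q i * w (k - M + i) s -
              ∑ i ∈ Finset.range (m - M), (q (M + i) - H i) * w (k + i) s := by
          have e1 := hw.equation (k - M) s
          have e2 : Finset.range m = Finset.range (M + (m - M)) := by congr 1; omega
          rw [e2, Finset.sum_range_add] at e1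
          have e3 : m + (k - M) = k + (m - M) := by omega
          have e4 : ∀ i, k - M + (M + i) = k + i := fun i => by omega
          simp only [e3, e4] at e1
          rw [Finset.sum_range_succ, hH, one_mul, e1]
          simp only [sub_mul, Finset.sum_sub_distrib]
          ring
        rw [hsplit]
        have b1 : ‖∑ i ∈ Finset.range M, q i * w (k - M + i) s‖ ≤ M * (A * (S k * G)) := by
          refine (norm_sum_le_of_le _ fun i hi => ?_).trans (b := ∑ i ∈ Finset.range M,
            A * (S k * G)) (by simp)
          have hi' := Finset.mem_range.1 hi
          rw [norm_mul]
          calc ‖q i‖ * ‖w (k - M + i) s‖ ≤ (A * r ^ (M - i)) * (S k *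
                (r ^ min (k - M + i) (M + N) * (g * Real.exp (-ρ * s)) + Real.exp (-σ * s))) := by
                refine mul_le_mul (hq i (by omega)) ((hk _ s hs).trans ?_) (norm_nonneg _)
                  (by positivity)
                gcongr
                exact hS k _ (by omega)
            _ = A * (S k * (r ^ (M - i + min (k - M + i) (M + N)) * g * Real.exp (-ρ * s) +
                  r ^ (M - i) * Real.exp (-σ * s))) := by rw [pow_add]; ring
            _ ≤ A * (S k * (r ^ (M + (N + 1)) * g * Real.exp (-ρ * s) +
                  1 * Real.exp (-σ * s))) := by
                have := hS0 k
                gcongr A * (S k * (?_ * g * _ + ?_ * _))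
                · exact pow_le_pow_of_le_one hr hr1 (by omega)
                · exact pow_le_one₀ hr hr1
            _ = _ := by rw [one_mul]
        have b2 : ‖∑ i ∈ Finset.range (m - M), (q (M + i) - H i) * w (k + i) s‖ ≤
            (m - M : ℕ) * (A * (S k * G)) := by
          refine (norm_sum_le_of_le _ fun i hi => ?_).trans (b := ∑ i ∈ Finset.range (m - M),
            A * (S k * G)) (by simp)
          have hi' := Finset.mem_range.1 hi
          rw [norm_mul]
          calc ‖q (M + i) - H i‖ * ‖w (k + i) s‖ ≤ (A * r) * (S k *
                (r ^ min (k + i) (M + N) * (g * Real.exp (-ρ * s)) + Real.exp (-σ * s))) := by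
                refine mul_le_mul (hqH i hi') ((hk _ s hs).trans ?_) (norm_nonneg _)
                  (by positivity)
                gcongr
                exact hS k _ (by omega)
            _ = A * (S k * (r ^ (M + (N + 1)) * g * Real.exp (-ρ * s) +
                  r * Real.exp (-σ * s))) := by
                rw [min_eq_right (by omega), ← add_assoc, pow_succ]; ring
            _ ≤ A * (S k * (r ^ (M + (N + 1)) * g * Real.exp (-ρ * s) +
                  1 * Real.exp (-σ * s))) := by
                have := hS0 k
                gcongr
            _ = _ := by rw [one_mul]
        refine (norm_sub_le _ _).trans ?_
        rw [norm_neg]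
        refine (add_le_add b1 b2).trans ?_
        have e5 : (M : ℝ) + (m - M : ℕ) = m := by
          rw [← Nat.cast_add]; congr 1; omega
        calc (M : ℝ) * (A * (S k * G)) + (m - M : ℕ) * (A * (S k * G)) =
              (m * A) * (S k * G) := by rw [← e5]; ring
          _ ≤ (2 + 2 * m * A) * (S k * G) := by
              have : 0 ≤ S k * G := mul_nonneg (hS0 k) hG0
              have : 0 ≤ m * A := by positivity
              gcongr
              linarith
          _ = _ := by ring

/-- The last fundamental solution gains one more power of `r`, since the damped part of the operator
maps it to a fundamental solution of lower index, up to errors of size `r`. -/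
theorem exists_low_gain {h : ℕ} {H : ℕ → ℂ} (hH : H h = 1) {A σ : ℝ} (hA : 0 ≤ A)
    (hstable : StableFilter h H σ) {C : ℕ → ℝ} (hC : ∀ k, 0 ≤ C k) :
    ∃ C' : ℕ → ℝ, (∀ k, 0 ≤ C' k) ∧ ∀ (p : ℕ → ℂ) (r g ρ : ℝ) (u v : ℕ → ℝ → ℂ), 0 ≤ r → r ≤ 1 →
      0 ≤ g → ρ ≤ σ → (∀ i < h, ‖p i - H i‖ ≤ A * r) → IsJet u →
      (∀ k t, v k t = u (k + h) t + ∑ i ∈ Finset.range h, p i * u (k + i) t) →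
      (∀ k, ‖u k 0‖ ≤ C k) →
      (∀ k t, 0 ≤ t →
        ‖u k t‖ ≤ C k * (r ^ k * g * Real.exp (-ρ * t) + Real.exp (-σ * t))) →
      (∀ k t, 0 ≤ t →
        ‖v k t‖ ≤ C k * (r ^ (k + 1) * g * Real.exp (-ρ * t) + Real.exp (-σ * t))) →
      ∀ k t, 0 ≤ t →
        ‖u k t‖ ≤ C' k * (r ^ (k + 1) * g * Real.exp (-ρ * t) + Real.exp (-σ * t)) := by
  set S : ℕ → ℝ := fun k => ∑ i ∈ Finset.range (k + h + 1), C i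
  have hS : ∀ k i, i < k + h + 1 → C i ≤ S k := fun k i hi =>
    Finset.single_le_sum (fun i _ => hC i) (Finset.mem_range.2 hi)
  have hS0 : ∀ k, 0 ≤ S k := fun k => Finset.sum_nonneg fun i _ => hC i
  choose C₂ hC₂ hfilter using fun k => hstable ((1 + h * A) * S k)
    (mul_nonneg (by positivity) (hS0 k))
  refine ⟨C₂, hC₂, ?_⟩
  intro p r g ρ u v hr hr1 hg hρ hp hu hv h0 hub hvb k t ht
  have hhA : 0 ≤ h * A := by positivity
  refine hfilter k (fun i => u (k + i)) (r ^ (k + 1) * g) ρ (hu.shift k) (by positivity) hρ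
    (fun i hi => ?_) (fun s hs => ?_) t ht
  · refine (h0 _).trans ((hS k _ (by omega)).trans ?_)
    nlinarith [hS0 k]
  · set G : ℝ := r ^ (k + 1) * g * Real.exp (-ρ * s) + Real.exp (-σ * s) with hG
    have hG0 : 0 ≤ G := by positivity
    have hsplit : ∑ i ∈ Finset.range (h + 1), H i * u (k + i) s =
        v k s - ∑ i ∈ Finset.range h, (p i - H i) * u (k + i) s := by
      rw [Finset.sum_range_succ, hH, one_mul, hv]
      simp only [sub_mul, Finset.sum_sub_distrib]
      ring
    rw [hsplit]
    have b2 : ‖∑ i ∈ Finset.range h, (p i - H i) * u (k + i) s‖ ≤ h * (A * (S k * G)) := by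
      refine (norm_sum_le_of_le _ fun i hi => ?_).trans (b := ∑ i ∈ Finset.range h,
        A * (S k * G)) (by simp)
      have hi' := Finset.mem_range.1 hi
      rw [norm_mul]
      calc ‖p i - H i‖ * ‖u (k + i) s‖ ≤ (A * r) * (S k *
            (r ^ k * g * Real.exp (-ρ * s) + Real.exp (-σ * s))) := by
            refine mul_le_mul (hp i hi') ((hub _ s hs).trans ?_) (norm_nonneg _)
              (by positivity)
            have := hS0 k
            gcongr ?_ * (?_ * g * _ + _)
            · exact hS k _ (by omega)
            · exact pow_le_pow_of_le_one hr hr1 (by omega)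
        _ = A * (S k * (r ^ (k + 1) * g * Real.exp (-ρ * s) + r * Real.exp (-σ * s))) := by
            rw [pow_succ]; ring
        _ ≤ A * (S k * (r ^ (k + 1) * g * Real.exp (-ρ * s) + 1 * Real.exp (-σ * s))) := by
            have := hS0 k
            gcongr
        _ = _ := by rw [one_mul]
    refine (norm_sub_le _ _).trans ((add_le_add (hvb k s hs) b2).trans ?_)
    calc C k * G + h * (A * (S k * G)) ≤ S k * G + h * (A * (S k * G)) := by
          gcongr; exact hS k k (by omega)
      _ = _ := by ring

/-! ### Symbols -/

/-- The symbol `∑ c_{k,α} λ^k ζ^α` as a polynomial in `λ`, for `ζ ∈ ℂⁿ`. -/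
def DiffOp.csymbol {n : ℕ} (P : DiffOp n) (ζ : Fin n → ℂ) : ℂ[X] :=
  MvPolynomial.aeval (fun o : Option (Fin n) => o.elim (X : ℂ[X]) (fun i => C (ζ i))) P

theorem DiffOp.symbol_eq_csymbol {n : ℕ} (P : DiffOp n) (ξ : EuclideanSpace ℝ (Fin n)) :
    P.symbol ξ = P.csymbol (fun i => (ξ i : ℂ)) := rfl

theorem DiffOp.csymbol_add {n : ℕ} (P Q : DiffOp n) (ζ : Fin n → ℂ) :
    (P + Q).csymbol ζ = P.csymbol ζ + Q.csymbol ζ := map_add _ _ _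

theorem DiffOp.csymbol_eq_sum {n : ℕ} (P : DiffOp n) (ζ : Fin n → ℂ) :
    P.csymbol ζ = ∑ d ∈ P.support,
      C (MvPolynomial.coeff d P * ∏ i, ζ i ^ d (some i)) * X ^ d none := by
  rw [csymbol, MvPolynomial.aeval_def, MvPolynomial.eval₂_eq']
  refine Finset.sum_congr rfl fun d _ => ?_
  rw [Fintype.prod_option]
  simp only [Option.elim, map_mul, map_prod, map_pow, Polynomial.algebraMap_apply,
    Algebra.algebraMap_self, RingHom.id_apply]
  ring

theorem DiffOp.coeff_csymbol {n : ℕ} (P : DiffOp n) (ζ : Fin n → ℂ) (k : ℕ) :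
    (P.csymbol ζ).coeff k = ∑ d ∈ P.support,
      if k = d none then MvPolynomial.coeff d P * ∏ i, ζ i ^ d (some i) else 0 := by
  rw [csymbol_eq_sum, finsetSum_coeff]
  exact Finset.sum_congr rfl fun d _ => by rw [coeff_C_mul_X_pow]

theorem continuous_coeff_csymbol {n : ℕ} (P : DiffOp n) (k : ℕ) :
    Continuous fun ζ : Fin n → ℂ => (P.csymbol ζ).coeff k := by
  simp only [DiffOp.coeff_csymbol]
  refine continuous_finsetSum _ fun d _ => ?_
  split_ifs <;> fun_prop

theorem continuous_eval_csymbol {n : ℕ} (P : DiffOp n) :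
    Continuous fun p : (Fin n → ℂ) × ℂ => (P.csymbol p.1).eval p.2 := by
  simp only [DiffOp.csymbol_eq_sum, eval_finsetSum, eval_mul, eval_C, eval_pow, eval_X]
  fun_prop

theorem degree_eq_none_add {n : ℕ} (d : Option (Fin n) →₀ ℕ) :
    d.degree = d none + ∑ i, d (some i) := by
  rw [Finsupp.degree_eq_sum, Fintype.sum_option]

theorem none_add_eq_of_mem_support {n D : ℕ} {P : DiffOp n} (hP : P.IsHomogeneous D)
    {d : Option (Fin n) →₀ ℕ} (hd : d ∈ P.support) : d none + ∑ i, d (some i) = D := by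
  rw [← degree_eq_none_add]
  by_contra h
  exact (MvPolynomial.mem_support_iff.1 hd) (hP.coeff_eq_zero h)

theorem DiffOp.coeff_csymbol_eq_zero {n D : ℕ} {P : DiffOp n} (hP : P.IsHomogeneous D)
    (ζ : Fin n → ℂ) {k : ℕ} (hk : D < k) : (P.csymbol ζ).coeff k = 0 := by
  rw [coeff_csymbol]
  refine Finset.sum_eq_zero fun d hd => if_neg ?_
  have := none_add_eq_of_mem_support hP hd
  omega

theorem eq_single_none_iff {n D : ℕ} {d : Option (Fin n) →₀ ℕ} (h : d none + ∑ i, d (some i) = D) :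
    D = d none ↔ d = Finsupp.single none D := by
  constructor
  · intro hD
    have h0 : ∑ i, d (some i) = 0 := by omega
    ext o
    cases o with
    | none => simp [hD]
    | some i => simpa using (Finset.sum_eq_zero_iff.1 h0) i (Finset.mem_univ i)
  · rintro rfl
    simp

theorem DiffOp.coeff_csymbol_self {n D : ℕ} {P : DiffOp n} (hP : P.IsHomogeneous D)
    (ζ : Fin n → ℂ) : (P.csymbol ζ).coeff D = P.timeCoeff D := by
  rw [coeff_csymbol, timeCoeff]
  have : ∀ d ∈ P.support, (if D = d none then MvPolynomial.coeff d P * ∏ i, ζ i ^ d (some i)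
      else 0) = if d = Finsupp.single none D then MvPolynomial.coeff d P else 0 := by
    intro d hd
    have h := none_add_eq_of_mem_support hP hd
    by_cases hD : D = d none
    · rw [if_pos hD, if_pos ((eq_single_none_iff h).1 hD)]
      have h0 : ∑ i, d (some i) = 0 := by omega
      rw [Finset.prod_eq_one, mul_one]
      intro i hi
      rw [(Finset.sum_eq_zero_iff.1 h0) i hi, pow_zero]
    · rw [if_neg hD, if_neg (fun h' => hD ((eq_single_none_iff h).2 h'))]
  rw [Finset.sum_congr rfl this, Finset.sum_ite_eq']
  split_ifs with h
  · rfl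
  · exact (MvPolynomial.notMem_support_iff.1 h).symm

theorem DiffOp.coeff_csymbol_smul {n D : ℕ} {P : DiffOp n} (hP : P.IsHomogeneous D)
    (ζ : Fin n → ℂ) (s : ℂ) (k : ℕ) :
    (P.csymbol (fun i => s * ζ i)).coeff k = s ^ (D - k) * (P.csymbol ζ).coeff k := by
  rw [coeff_csymbol, coeff_csymbol, Finset.mul_sum]
  refine Finset.sum_congr rfl fun d hd => ?_
  have h := none_add_eq_of_mem_support hP hd
  by_cases hk : k = d none
  · rw [if_pos hk, if_pos hk]
    have h1 : D - k = ∑ i, d (some i) := by omega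
    simp only [mul_pow]
    rw [Finset.prod_mul_distrib, Finset.prod_pow_eq_pow_sum, h1]
    ring
  · rw [if_neg hk, if_neg hk, mul_zero]

/-! ### Interlacing polynomials -/

theorem strictMono_of_interlace {d : ℕ} {b : Fin d → ℝ} {a : Fin (d + 1) → ℝ}
    (h : ∀ i : Fin d, a i.castSucc < b i ∧ b i < a i.succ) : StrictMono a :=
  Fin.strictMono_iff_lt_succ.2 fun i => (h i).1.trans (h i).2

theorem strictMono_of_interlace' {d : ℕ} {b : Fin d → ℝ} {a : Fin (d + 1) → ℝ}
    (h : ∀ i : Fin d, a i.castSucc < b i ∧ b i < a i.succ) : StrictMono b := fun i j hij =>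
  (h i).2.trans_le (((strictMono_of_interlace h).monotone
    (Fin.succ_le_castSucc_iff.2 hij)).trans (h j).1.le)

/-- The sign of the coefficients in the expansion of `∏ (X - a_j)` with respect to the polynomials
`∏_{j ≠ i} (X - b_j)`. -/
theorem prod_mul_prod_neg {d : ℕ} {b : Fin d → ℝ} {a : Fin (d + 1) → ℝ}
    (h : ∀ i : Fin d, a i.castSucc < b i ∧ b i < a i.succ) (i : Fin d) :
    (∏ j, (b i - a j)) * ∏ j ∈ Finset.univ.erase i, (b i - b j) < 0 := by
  have ha := strictMono_of_interlace h
  have hb := strictMono_of_interlace' h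
  rw [Fin.prod_univ_succAbove _ i.castSucc, ← Finset.mul_prod_erase _ _ (Finset.mem_univ i),
    Fin.succAbove_castSucc_self, mul_assoc, mul_assoc, ← Finset.prod_mul_distrib]
  refine mul_neg_of_pos_of_neg (sub_pos.2 (h i).1)
    (mul_neg_of_neg_of_pos (sub_neg.2 (h i).2) (Finset.prod_pos fun j hj => ?_))
  rcases lt_or_gt_of_ne (Finset.ne_of_mem_erase hj) with hji | hij
  · rw [Fin.succAbove_of_castSucc_lt _ _ (by simpa using hji)]
    refine mul_pos (sub_pos.2 ?_) (sub_pos.2 (hb hji))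
    exact (ha (by simpa using hji)).trans (h i).1
  · rw [Fin.succAbove_of_le_castSucc _ _ (by simpa using hij.le)]
    refine mul_pos_of_neg_of_neg (sub_neg.2 ?_) (sub_neg.2 (hb hij))
    exact (h i).2.trans (ha (by simpa using hij))

/-- The sign of the coefficients in the expansion of `∏ (X - b_j)` with respect to the polynomials
`∏_{j ≠ i} (X - a_j)`. -/
theorem prod_mul_prod_pos {d : ℕ} {b : Fin d → ℝ} {a : Fin (d + 1) → ℝ}
    (h : ∀ i : Fin d, a i.castSucc < b i ∧ b i < a i.succ) (i : Fin (d + 1)) :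
    0 < (∏ j, (a i - b j)) * ∏ j ∈ Finset.univ.erase i, (a i - a j) := by
  have ha := strictMono_of_interlace h
  have he : ∏ j ∈ Finset.univ.erase i, (a i - a j) = ∏ j : Fin d, (a i - a (i.succAbove j)) := by
    have h1 : (Finset.univ.erase i : Finset (Fin (d + 1))) =
        Finset.univ.map i.succAboveEmb := by
      ext j
      simp [Fin.exists_succAbove_eq_iff]
    rw [h1, Finset.prod_map]
    rfl
  rw [he, ← Finset.prod_mul_distrib]
  refine Finset.prod_pos fun j _ => ?_
  rcases lt_or_ge j.castSucc i with hji | hij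
  · rw [Fin.succAbove_of_castSucc_lt _ _ hji]
    refine mul_pos (sub_pos.2 ?_) (sub_pos.2 (ha hji))
    exact (h j).2.trans_le (ha.monotone (Fin.castSucc_lt_iff_succ_le.1 hji))
  · rw [Fin.succAbove_of_le_castSucc _ _ hij]
    have h1 : a i < b j := (ha.monotone hij).trans_lt (h j).1
    exact mul_pos_of_neg_of_neg (sub_neg.2 h1) (sub_neg.2 (h1.trans (h j).2))

/-! ### Partial fractions -/

/-- The polynomial `∏ (X - b_i)`. -/
def nodal {R : Type*} [CommRing R] {N : ℕ} (b : Fin N → R) : R[X] := ∏ j, (X - C (b j))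

/-- The polynomial `∏_{j ≠ i} (X - b_j)`. -/
def nodalErase {R : Type*} [CommRing R] {N : ℕ} (b : Fin N → R) (i : Fin N) : R[X] :=
  ∏ j ∈ Finset.univ.erase i, (X - C (b j))

theorem mul_nodalErase {R : Type*} [CommRing R] {N : ℕ} (b : Fin N → R) (i : Fin N) :
    (X - C (b i)) * nodalErase b i = nodal b :=
  Finset.mul_prod_erase Finset.univ (fun j => X - C (b j)) (Finset.mem_univ i)

theorem map_nodal {N : ℕ} (b : Fin N → ℝ) :
    (nodal b).map (algebraMap ℝ ℂ) = nodal fun i => (b i : ℂ) := by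
  simp [nodal, Polynomial.map_prod]

theorem map_nodalErase {N : ℕ} (b : Fin N → ℝ) (i : Fin N) :
    (nodalErase b i).map (algebraMap ℝ ℂ) = nodalErase (fun i => (b i : ℂ)) i := by
  simp [nodalErase, Polynomial.map_prod]

theorem monic_nodal {N : ℕ} (b : Fin N → ℝ) : (nodal b).Monic :=
  monic_prod_of_monic _ _ fun _ _ => monic_X_sub_C _

theorem natDegree_nodal {N : ℕ} (b : Fin N → ℝ) : (nodal b).natDegree = N := by
  rw [nodal, natDegree_prod_of_monic _ _ fun i _ => monic_X_sub_C _]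
  simp

theorem eval_nodal {R : Type*} [CommRing R] {N : ℕ} (b : Fin N → R) (x : R) :
    (nodal b).eval x = ∏ j, (x - b j) := by
  simp [nodal, eval_prod]

theorem eval_nodalErase {R : Type*} [CommRing R] {N : ℕ} (b : Fin N → R) (i : Fin N) (x : R) :
    (nodalErase b i).eval x = ∏ j ∈ Finset.univ.erase i, (x - b j) := by
  simp [nodalErase, eval_prod]

theorem degree_nodalErase_lt {N : ℕ} (b : Fin N → ℝ) (i : Fin N) :
    (nodalErase b i).degree < N := by
  have hm : (nodalErase b i).Monic := monic_prod_of_monic _ _ fun i _ => monic_X_sub_C _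
  rw [degree_eq_natDegree hm.ne_zero, nodalErase,
    natDegree_prod_of_monic _ _ fun i _ => monic_X_sub_C _]
  simp only [natDegree_X_sub_C, Finset.sum_const, smul_eq_mul, mul_one,
    Finset.card_erase_of_mem (Finset.mem_univ i), Finset.card_univ, Fintype.card_fin]
  have := i.pos
  exact_mod_cast (by omega : N - 1 < N)

theorem prod_erase_ne_zero {N : ℕ} {b : Fin N → ℝ} (hb : Function.Injective b) (i : Fin N) :
    ∏ j ∈ Finset.univ.erase i, (b i - b j) ≠ 0 :=
  Finset.prod_ne_zero_iff.2 fun _ hj => sub_ne_zero.2 fun h =>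
    (Finset.ne_of_mem_erase hj) (hb h).symm

/-- Lagrange interpolation at the nodes `b_i`. -/
theorem eq_sum_nodalErase {N : ℕ} {b : Fin N → ℝ} (hb : Function.Injective b) {f : ℝ[X]}
    (hf : f.degree < N) :
    f = ∑ i, C (f.eval (b i) / ∏ j ∈ Finset.univ.erase i, (b i - b j)) * nodalErase b i := by
  refine Polynomial.eq_of_degrees_lt_of_eval_index_eq (s := Finset.univ) (v := b)
    hb.injOn (by simpa using hf) ?_ fun i _ => ?_
  · rw [Finset.card_univ, Fintype.card_fin]
    refine (Polynomial.degree_sum_le _ _).trans_lt ?_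
    rw [Finset.sup_lt_iff (by exact WithBot.bot_lt_coe N)]
    intro i _
    rw [← smul_eq_C_mul]
    exact (degree_smul_le _ _).trans_lt (degree_nodalErase_lt b i)
  · rw [eval_finsetSum, Finset.sum_eq_single i]
    · rw [eval_mul, eval_C, eval_nodalErase, div_mul_cancel₀ _ (prod_erase_ne_zero hb i)]
    · intro k _ hk
      have h0 : (nodalErase b k).eval (b i) = 0 := by
        rw [eval_nodalErase]
        exact Finset.prod_eq_zero (Finset.mem_erase.2 ⟨hk.symm, Finset.mem_univ i⟩) (sub_self _)
      rw [eval_mul, h0, mul_zero]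
    · simp

/-- Division of a monic polynomial of degree `N + 1` by `∏ (X - b_i)`. -/
theorem exists_eq_mul_nodal_add {N : ℕ} {b : Fin N → ℝ} (hb : Function.Injective b) {f : ℝ[X]}
    (hf : f.Monic) (hdeg : f.natDegree = N + 1) :
    ∃ β : ℝ, f = (X + C β) * nodal b +
      ∑ i, C (f.eval (b i) / ∏ j ∈ Finset.univ.erase i, (b i - b j)) * nodalErase b i := by
  have hm := monic_nodal b
  have hq : (f /ₘ nodal b).natDegree = 1 := by
    rw [natDegree_divByMonic _ hm, hdeg, natDegree_nodal]; omega
  have hqm : (f /ₘ nodal b).Monic := by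
    rw [Monic, leadingCoeff_divByMonic_of_monic hm, hf.leadingCoeff]
    rw [degree_eq_natDegree hm.ne_zero, degree_eq_natDegree hf.ne_zero, hdeg, natDegree_nodal]
    exact_mod_cast Nat.le_succ N
  refine ⟨(f /ₘ nodal b).coeff 0, ?_⟩
  rw [← hqm.eq_X_add_C hq]
  have hr : (f %ₘ nodal b).degree < N := by
    have := degree_modByMonic_lt f hm
    rwa [degree_eq_natDegree hm.ne_zero, natDegree_nodal] at this
  have he : ∀ i, f.eval (b i) = (f %ₘ nodal b).eval (b i) := by
    intro i
    conv_lhs => rw [← modByMonic_add_div f (nodal b)]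
    rw [eval_add, eval_mul, eval_nodal, Finset.prod_eq_zero (Finset.mem_univ i) (sub_self _)]
    ring
  simp only [he]
  rw [← eq_sum_nodalErase hb hr, add_comm, mul_comm]
  exact (modByMonic_add_div f (nodal b)).symm

/-! ### Uniform decompositions of interlacing symbols -/

theorem exists_uniform_bounds {X : Type*} [TopologicalSpace X] {K : Set X} (hK : IsCompact K)
    {ι : Type*} [Finite ι] {f : ι → X → ℝ} (hf : ∀ i, ContinuousOn (f i) K)
    (hpos : ∀ i, ∀ x ∈ K, 0 < f i x) :
    ∃ θ Θ : ℝ, 0 < θ ∧ 0 < Θ ∧ ∀ x ∈ K, ∀ i, θ ≤ f i x ∧ f i x ≤ Θ := by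
  have h1 : ∀ i, ∃ θ > 0, ∀ x ∈ K, θ ≤ f i x := fun i => by
    obtain ⟨a, ha, h⟩ := hK.exists_forall_le' (hf i) (hpos i)
    exact ⟨a, ha, h⟩
  have h2 : ∀ i, ∃ Θ, ∀ x ∈ K, f i x ≤ Θ := fun i => by
    obtain ⟨Θ, h⟩ := (hK.image_of_continuousOn (hf i)).bddAbove
    exact ⟨Θ, fun x hx => h (mem_image_of_mem _ hx)⟩
  choose θ hθ hθ' using h1
  choose Θ hΘ using h2
  obtain ⟨θ₀, h, hpos'⟩ := ((Filter.eventually_all.2 fun i =>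
    (eventually_le_nhds (hθ i)).filter_mono nhdsWithin_le_nhds).and
      (self_mem_nhdsWithin : Ioi (0 : ℝ) ∈ nhdsWithin 0 (Ioi 0))).exists
  obtain ⟨Θ₀, h', hpos''⟩ := ((Filter.eventually_all.2 fun i =>
    Filter.eventually_ge_atTop (Θ i)).and (Filter.eventually_gt_atTop (0 : ℝ))).exists
  exact ⟨θ₀, Θ₀, hpos', hpos'', fun x hx i => ⟨(h i).trans (hθ' i x hx),
    (hΘ i x hx).trans (h' i)⟩⟩

theorem roots_nodal {N : ℕ} (b : Fin N → ℂ) : (nodal b).roots = Finset.univ.val.map b := by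
  have : nodal b = ((Finset.univ.val.map b).map fun a => X - C a).prod := by
    rw [Multiset.map_map]; rfl
  rw [this, roots_multiset_prod_X_sub_C]

theorem eq_of_nodal_eq {N : ℕ} {b b' : Fin N → ℝ} (hb : Monotone b) (hb' : StrictMono b')
    (h : nodal (fun i => (b i : ℂ)) = nodal fun i => (b' i : ℂ)) : b = b' := by
  have hr := congrArg Polynomial.roots h
  rw [roots_nodal, roots_nodal] at hr
  have hinj : Function.Injective b := by
    have hn : (Finset.univ.val.map fun i => (b i : ℂ)).Nodup := by
      rw [hr]
      exact Multiset.Nodup.map (fun i j hij => hb'.injective (by exact_mod_cast hij))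
        Finset.univ.nodup
    intro i j hij
    exact Multiset.inj_on_of_nodup_map hn i (Finset.mem_univ i) j (Finset.mem_univ j)
      (by exact_mod_cast hij)
  refine ((hb.strictMono_of_injective hinj).range_inj hb').1 ?_
  ext x
  have hx := congrArg (fun s => (x : ℂ) ∈ s) hr
  simpa using hx

theorem symbol_eq_C_mul_nodal {n D d : ℕ} {P : DiffOp n} {c : ℝ} (hP : P.IsHomogeneous D)
    (hc : 0 < c) (ht : P.timeCoeff D = c) {ω : EuclideanSpace ℝ (Fin n)} {b : Fin d → ℝ}
    (hb : (P.symbol ω).roots = Finset.univ.val.map fun i => (b i : ℂ)) :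
    d = D ∧ P.symbol ω = C (c : ℂ) * nodal fun i => (b i : ℂ) := by
  rw [DiffOp.symbol_eq_csymbol] at *
  have hD : (P.csymbol fun i => (ω i : ℂ)).coeff D = c :=
    (DiffOp.coeff_csymbol_self hP _).trans ht
  have hc' : (c : ℂ) ≠ 0 := by exact_mod_cast hc.ne'
  have hdeg : (P.csymbol fun i => (ω i : ℂ)).natDegree = D :=
    natDegree_eq_of_le_of_coeff_ne_zero
      (natDegree_le_iff_coeff_eq_zero.2 fun k hk => DiffOp.coeff_csymbol_eq_zero hP _ hk)
      (by rw [hD]; exact hc')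
  have hcard : (P.csymbol fun i => (ω i : ℂ)).roots.card =
      (P.csymbol fun i => (ω i : ℂ)).natDegree :=
    (splits_iff_card_roots.1 (IsAlgClosed.splits _))
  refine ⟨by rw [hb, hdeg] at hcard; simpa using hcard, ?_⟩
  rw [← C_leadingCoeff_mul_prod_multiset_X_sub_C hcard, leadingCoeff, hdeg, hD, hb,
    Multiset.map_map]
  rfl

/-- The unit frequencies `ω` together with the ordered roots `b` of the symbol `P(·, ω)` of a
homogeneous operator of order `N`, with leading coefficient `c`. Adding the roots as parameters
makes all root-dependent quantities continuous on a compact set. -/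
def rootSet {n N : ℕ} (P : DiffOp n) (c B : ℝ) : Set (EuclideanSpace ℝ (Fin n) × (Fin N → ℝ)) :=
  {p | p.1 ∈ Metric.sphere 0 1 ∧ p.2 ∈ Set.Icc (fun _ => -B) (fun _ => B) ∧ Monotone p.2 ∧
    ∀ z : ℂ, (P.symbol p.1).eval z = c * ∏ i, (z - p.2 i)}

theorem continuous_eval_symbol {n : ℕ} (P : DiffOp n) :
    Continuous fun p : EuclideanSpace ℝ (Fin n) × ℂ => (P.symbol p.1).eval p.2 := by
  have := (continuous_eval_csymbol P).comp (f := fun p : EuclideanSpace ℝ (Fin n) × ℂ =>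
    ((fun i => ((p.1 i : ℝ) : ℂ)), p.2)) (by fun_prop)
  exact this

theorem isCompact_rootSet {n N : ℕ} (P : DiffOp n) (c B : ℝ) :
    IsCompact (rootSet (N := N) P c B) := by
  refine ((isCompact_sphere (0 : EuclideanSpace ℝ (Fin n)) 1).prod
    (isCompact_Icc (a := fun _ : Fin N => -B) (b := fun _ => B))).of_isClosed_subset ?_
    fun p hp => ⟨hp.1, hp.2.1⟩
  simp only [rootSet, ofPred_and, ofPred_forall, Monotone]
  refine (Metric.isClosed_sphere.preimage continuous_fst).inter
    ((isClosed_Icc.preimage continuous_snd).inter (IsClosed.inter ?_ ?_))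
  · refine isClosed_iInter fun i => isClosed_iInter fun j => isClosed_iInter fun _ => ?_
    exact isClosed_le (by fun_prop) (by fun_prop)
  · refine isClosed_iInter fun z => ?_
    refine isClosed_eq ((continuous_eval_symbol P).comp (f := fun p : EuclideanSpace ℝ (Fin n) ×
      (Fin N → ℝ) => (p.1, z)) (by fun_prop)) (by fun_prop)

theorem symbol_eq_of_mem_rootSet {n N : ℕ} {P : DiffOp n} {c B : ℝ}
    {p : EuclideanSpace ℝ (Fin n) × (Fin N → ℝ)} (hp : p ∈ rootSet P c B) :
    P.symbol p.1 = C (c : ℂ) * nodal fun i => (p.2 i : ℂ) :=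
  Polynomial.funext fun z => by rw [hp.2.2.2 z, eval_mul, eval_C, eval_nodal]

theorem exists_coeff_bound {n : ℕ} (P : DiffOp n) :
    ∃ A : ℝ, 0 ≤ A ∧ ∀ ω : EuclideanSpace ℝ (Fin n), ‖ω‖ = 1 → ∀ k, ‖(P.symbol ω).coeff k‖ ≤ A := by
  have hcont : ∀ d : Option (Fin n) →₀ ℕ, Continuous fun ω : EuclideanSpace ℝ (Fin n) =>
      ‖MvPolynomial.coeff d P * ∏ i, ((ω i : ℝ) : ℂ) ^ d (some i)‖ := fun d => by fun_prop
  have hb : ∀ d : Option (Fin n) →₀ ℕ, ∃ A : ℝ, ∀ ω ∈ Metric.sphere (0 : EuclideanSpace ℝ (Fin n)) 1,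
      ‖MvPolynomial.coeff d P * ∏ i, ((ω i : ℝ) : ℂ) ^ d (some i)‖ ≤ A := fun d => by
    obtain ⟨A, hA⟩ := ((isCompact_sphere (0 : EuclideanSpace ℝ (Fin n)) 1).image
      (hcont d)).bddAbove
    exact ⟨A, fun ω hω => hA (mem_image_of_mem _ hω)⟩
  choose A hA using hb
  refine ⟨∑ d ∈ P.support, max 0 (A d), Finset.sum_nonneg fun d _ => le_max_left _ _, ?_⟩
  intro ω hω k
  rw [DiffOp.symbol_eq_csymbol, DiffOp.coeff_csymbol]
  refine norm_sum_le_of_le _ fun d _ => ?_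
  split_ifs
  · exact (hA d ω (by simpa using hω)).trans (le_max_right _ _)
  · simp

/-- All roots lie in a common interval `[-B, B]`, by Cauchy's bound, as the coefficients are bounded
on the sphere. -/
theorem exists_mem_rootSet {n D : ℕ} {P₁ : DiffOp n} {c : ℝ} (hP₁ : P₁.IsHomogeneous D)
    (hc : 0 < c) (ht : P₁.timeCoeff D = c)
    (hroots : ∀ ω : EuclideanSpace ℝ (Fin n), ‖ω‖ = 1 → ∃ (d : ℕ) (b : Fin d → ℝ), Monotone b ∧
      (P₁.symbol ω).roots = Finset.univ.val.map fun i => (b i : ℂ)) :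
    ∃ B : ℝ, 0 < B ∧ ∀ ω : EuclideanSpace ℝ (Fin n), ‖ω‖ = 1 →
      ∃ b : Fin D → ℝ, (ω, b) ∈ rootSet P₁ c B := by
  obtain ⟨A, hA0, hA⟩ := exists_coeff_bound P₁
  refine ⟨A / c + 1, by positivity, fun ω hω => ?_⟩
  obtain ⟨d, b, hb, hr⟩ := hroots ω hω
  obtain ⟨rfl, hs⟩ := symbol_eq_C_mul_nodal hP₁ hc ht hr
  have hroot : ∀ i, |b i| ≤ A / c + 1 := by
    intro i
    have hi : (b i : ℂ) ∈ (P₁.symbol ω).roots := by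
      rw [hr]; exact Multiset.mem_map_of_mem _ (Finset.mem_univ i)
    have h0 := (mem_roots'.1 hi).1
    have h1 := (mem_roots'.1 hi).2.norm_lt_cauchyBound h0
    have h2 : ‖(P₁.symbol ω).leadingCoeff‖₊ = c.toNNReal := by
      have hm : (nodal fun i => (b i : ℂ)).Monic :=
        monic_prod_of_monic _ _ fun i _ => monic_X_sub_C _
      rw [hs, leadingCoeff_mul, leadingCoeff_C, hm.leadingCoeff, mul_one, Complex.nnnorm_real,
        Real.nnnorm_of_nonneg hc.le, Real.toNNReal_of_nonneg hc.le]
    have h3 : cauchyBound (P₁.symbol ω) ≤ A.toNNReal / c.toNNReal + 1 := by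
      rw [cauchyBound, h2]
      gcongr
      refine Finset.sup_le fun k _ => ?_
      rw [← NNReal.coe_le_coe, coe_nnnorm, Real.coe_toNNReal _ hA0]
      exact hA ω hω k
    have h4 : ‖(b i : ℂ)‖ ≤ A / c + 1 := by
      have := NNReal.coe_le_coe.2 (h1.le.trans h3)
      simpa [Real.coe_toNNReal _ hA0, Real.coe_toNNReal _ hc.le] using this
    simpa using h4
  refine ⟨b, by simpa using hω, ⟨fun i => (abs_le.1 (hroot i)).1, fun i => (abs_le.1 (hroot i)).2⟩,
    hb, fun z => ?_⟩
  rw [hs, eval_mul, eval_C, eval_nodal]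

/-- On the root set of `P₁`, the roots of the polynomial `P` interlaced by `P₁` exist. -/
theorem interlace_of_mem_rootSet {n D D' : ℕ} {P P₁ : DiffOp n} {c c' B : ℝ}
    (hP₁ : P₁.IsHomogeneous D) (ht : P₁.timeCoeff D = c) (hc : 0 < c)
    (hP : P.IsHomogeneous D') (ht' : P.timeCoeff D' = c') (hc' : 0 < c')
    {p : EuclideanSpace ℝ (Fin n) × (Fin D → ℝ)} (hp : p ∈ rootSet P₁ c B)
    (h : StrictlyInterlace (P₁.symbol p.1) (P.symbol p.1)) :
    ∃ a : Fin (D + 1) → ℝ, (∀ i : Fin D, a i.castSucc < p.2 i ∧ p.2 i < a i.succ) ∧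
      P.symbol p.1 = C (c' : ℂ) * nodal fun i => (a i : ℂ) := by
  obtain ⟨-, -, d, b, a, hb, ha, hab⟩ := h
  obtain ⟨rfl, hs⟩ := symbol_eq_C_mul_nodal hP₁ hc ht hb
  obtain ⟨-, hs'⟩ := symbol_eq_C_mul_nodal hP hc' ht' ha
  have hpb : p.2 = b := by
    refine eq_of_nodal_eq hp.2.2.1 (strictMono_of_interlace' hab) ?_
    have h1 := symbol_eq_of_mem_rootSet hp
    rw [hs] at h1
    have hc0 : C (c : ℂ) ≠ 0 := by simpa using hc.ne'
    exact (mul_left_cancel₀ hc0 h1).symm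
  exact ⟨a, by rwa [hpb], hs'⟩

/-- On the root set of `P₁`, the roots of the polynomial `P` that interlaces `P₁` exist. -/
theorem interlace_of_mem_rootSet_of_interlaced {n D D' : ℕ} {P P₁ : DiffOp n} {c c' B : ℝ}
    (hP₁ : P₁.IsHomogeneous (D + 1)) (ht : P₁.timeCoeff (D + 1) = c) (hc : 0 < c)
    (hP : P.IsHomogeneous D') (ht' : P.timeCoeff D' = c') (hc' : 0 < c')
    {p : EuclideanSpace ℝ (Fin n) × (Fin (D + 1) → ℝ)} (hp : p ∈ rootSet P₁ c B)
    (h : StrictlyInterlace (P.symbol p.1) (P₁.symbol p.1)) :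
    ∃ a : Fin D → ℝ, (∀ i : Fin D, p.2 i.castSucc < a i ∧ a i < p.2 i.succ) ∧
      P.symbol p.1 = C (c' : ℂ) * nodal fun i => (a i : ℂ) := by
  obtain ⟨-, -, d, a, b, ha, hb, hab⟩ := h
  obtain ⟨hd, hs⟩ := symbol_eq_C_mul_nodal hP₁ hc ht hb
  obtain rfl : d = D := by omega
  obtain ⟨-, hs'⟩ := symbol_eq_C_mul_nodal hP hc' ht' ha
  have hpb : p.2 = b := by
    refine eq_of_nodal_eq hp.2.2.1 (strictMono_of_interlace hab) ?_
    have h1 := symbol_eq_of_mem_rootSet hp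
    rw [hs] at h1
    have hc0 : C (c : ℂ) ≠ 0 := by simpa using hc.ne'
    exact (mul_left_cancel₀ hc0 h1).symm
  exact ⟨a, by rwa [hpb], hs'⟩

theorem eval_C_mul_nodal_re {N : ℕ} (c : ℝ) (a : Fin N → ℝ) (x : ℝ) :
    ((C (c : ℂ) * nodal fun i => (a i : ℂ)).eval (x : ℂ)).re = c * ∏ j, (x - a j) := by
  rw [eval_mul, eval_C, eval_nodal]
  norm_cast

theorem continuous_eval_symbol_re {n N : ℕ} (P : DiffOp n) (i : Fin N) :
    Continuous fun p : EuclideanSpace ℝ (Fin n) × (Fin N → ℝ) =>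
      ((P.symbol p.1).eval (p.2 i : ℂ)).re :=
  Complex.continuous_re.comp ((continuous_eval_symbol P).comp
    (f := fun p : EuclideanSpace ℝ (Fin n) × (Fin N → ℝ) => (p.1, (p.2 i : ℂ))) (by fun_prop))

/-- Uniform decomposition of `P_m` in terms of the roots of `P_{m-1}`. -/
theorem exists_decomposition {n D : ℕ} {P P₁ : DiffOp n} {c B : ℝ}
    (hP₁ : P₁.IsHomogeneous D) (ht : P₁.timeCoeff D = c) (hc : 0 < c)
    (hP : P.IsHomogeneous (D + 1)) (ht' : P.timeCoeff (D + 1) = 1)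
    (hint : ∀ ω : EuclideanSpace ℝ (Fin n), ‖ω‖ = 1 →
      StrictlyInterlace (P₁.symbol ω) (P.symbol ω)) :
    ∃ B' g θ Θ : ℝ, 0 < g ∧ 0 < θ ∧ 0 < Θ ∧ ∀ p ∈ rootSet (N := D) P₁ c B, ∃ (β : ℝ) (δ : Fin D → ℝ),
      |β| ≤ B' ∧ (∀ i j, i ≠ j → g ≤ |p.2 i - p.2 j|) ∧ (∀ i, θ ≤ δ i ∧ δ i ≤ Θ) ∧
      P.symbol p.1 = (X + C (β : ℂ)) * nodal (fun i => (p.2 i : ℂ)) -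
        ∑ i, C (δ i : ℂ) * nodalErase (fun i => (p.2 i : ℂ)) i := by
  have hK := isCompact_rootSet (N := D) P₁ c B
  have hI := fun (p : EuclideanSpace ℝ (Fin n) × (Fin D → ℝ)) (hp : p ∈ rootSet P₁ c B) =>
    interlace_of_mem_rootSet hP₁ ht hc hP (c' := 1) (by simpa using ht') one_pos hp
      (hint p.1 (by simpa using hp.1))
  have hinj : ∀ p ∈ rootSet (N := D) P₁ c B, Function.Injective p.2 := fun p hp => by
    obtain ⟨a, ha, -⟩ := hI p hp
    exact (strictMono_of_interlace' ha).injective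
  obtain ⟨g, G, hg, hG, hgap⟩ := exists_uniform_bounds hK
    (ι := {q : Fin D × Fin D // q.1 ≠ q.2}) (f := fun q p => |p.2 q.1.1 - p.2 q.1.2|)
    (fun q => by fun_prop)
    (fun q p hp => abs_pos.2 (sub_ne_zero.2 fun h => q.2 (hinj p hp h)))
  set f : Fin D → EuclideanSpace ℝ (Fin n) × (Fin D → ℝ) → ℝ := fun i p =>
    -((P.symbol p.1).eval (p.2 i : ℂ)).re / ∏ j ∈ Finset.univ.erase i, (p.2 i - p.2 j) with hf
  have hfc : ∀ i, ContinuousOn (f i) (rootSet P₁ c B) := fun i =>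
    ContinuousOn.div (continuous_eval_symbol_re P i).neg.continuousOn (by fun_prop)
      fun p hp => prod_erase_ne_zero (hinj p hp) i
  have hfpos : ∀ i, ∀ p ∈ rootSet P₁ c B, 0 < f i p := fun i p hp => by
    obtain ⟨a, ha, hs⟩ := hI p hp
    simp only [hf, hs]
    rw [eval_C_mul_nodal_re, one_mul, neg_div, neg_pos]
    rcases mul_neg_iff.1 (prod_mul_prod_neg ha i) with h | h
    · exact div_neg_of_pos_of_neg h.1 h.2
    · exact div_neg_of_neg_of_pos h.1 h.2
  obtain ⟨θ, Θ, hθ, hΘ, hδ⟩ := exists_uniform_bounds hK hfc hfpos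
  -- the constant `β` is found by evaluation at a point to the right of all roots
  have hx : ∀ p ∈ rootSet (N := D) P₁ c B, ∏ j, (B + 1 - p.2 j) ≠ 0 := fun p hp =>
    (Finset.prod_pos fun j _ => by
      have : p.2 j ≤ B := hp.2.1.2 j
      linarith).ne'
  have hβc : ContinuousOn (fun p : EuclideanSpace ℝ (Fin n) × (Fin D → ℝ) =>
      (((P.symbol p.1).eval ((B + 1 : ℝ) : ℂ)).re +
        ∑ i, f i p * ∏ j ∈ Finset.univ.erase i, (B + 1 - p.2 j)) / ∏ j, (B + 1 - p.2 j) - (B + 1))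
      (rootSet P₁ c B) := by
    refine ((ContinuousOn.add ?_ ?_).div (by fun_prop) hx).sub continuousOn_const
    · exact (Complex.continuous_re.comp ((continuous_eval_symbol P).comp
        (f := fun p : EuclideanSpace ℝ (Fin n) × (Fin D → ℝ) => (p.1, ((B + 1 : ℝ) : ℂ)))
        (by fun_prop))).continuousOn
    · exact continuousOn_finsetSum _ fun i _ => (hfc i).mul (by fun_prop)
  obtain ⟨B', hB'⟩ := (hK.image_of_continuousOn hβc.abs).bddAbove
  refine ⟨B', g, θ, Θ, hg, hθ, hΘ, fun p hp => ?_⟩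
  obtain ⟨a, ha, hs⟩ := hI p hp
  obtain ⟨β, hβ⟩ := exists_eq_mul_nodal_add (hinj p hp) (monic_nodal a) (natDegree_nodal a)
  have hre : ∀ x : ℝ, ((P.symbol p.1).eval (x : ℂ)).re = (nodal a).eval x := fun x => by
    rw [hs, eval_C_mul_nodal_re, one_mul, eval_nodal]
  have hfe : ∀ i, f i p = -((nodal a).eval (p.2 i) /
      ∏ j ∈ Finset.univ.erase i, (p.2 i - p.2 j)) := fun i => by
    simp only [hf, hre, neg_div]
  refine ⟨β, fun i => f i p, ?_, fun i j hij => (hgap p hp ⟨(i, j), hij⟩).1,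
    fun i => hδ p hp i, ?_⟩
  · have h1 := hB' (mem_image_of_mem _ hp)
    have h2 : (((P.symbol p.1).eval ((B + 1 : ℝ) : ℂ)).re +
        ∑ i, f i p * ∏ j ∈ Finset.univ.erase i, (B + 1 - p.2 j)) / ∏ j, (B + 1 - p.2 j) -
        (B + 1) = β := by
      rw [hre]
      have h3 := congrArg (Polynomial.eval (B + 1)) hβ
      simp only [eval_add, eval_mul, eval_finsetSum, eval_X, eval_C, eval_nodalErase] at h3
      rw [h3, eval_nodal]
      simp only [hfe, neg_mul, Finset.sum_neg_distrib]
      have := hx p hp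
      field_simp
      ring
    rw [← h2]
    exact h1
  · have h1 := congrArg (Polynomial.map (algebraMap ℝ ℂ)) hβ
    rw [map_nodal, Polynomial.map_add, Polynomial.map_mul, Polynomial.map_add, map_nodal,
      Polynomial.map_sum] at h1
    simp only [Polynomial.map_mul, map_nodalErase, map_X, map_C] at h1
    rw [hs, Complex.ofReal_one, C_1, one_mul, h1, sub_eq_add_neg, ← Finset.sum_neg_distrib]
    congr 1
    refine Finset.sum_congr rfl fun i _ => ?_
    have h2 : ((f i p : ℝ) : ℂ) = -(algebraMap ℝ ℂ) ((nodal a).eval (p.2 i) /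
        ∏ j ∈ Finset.univ.erase i, (p.2 i - p.2 j)) := by rw [hfe i]; simp
    simp only [h2, C_neg, neg_mul, neg_neg]

/-- Uniform decomposition of `P_{m-2}` in terms of the roots of `P_{m-1}`. -/
theorem exists_decomposition_of_interlaced {n D : ℕ} {P P₁ : DiffOp n} {c c' B : ℝ}
    (hP₁ : P₁.IsHomogeneous (D + 1)) (ht : P₁.timeCoeff (D + 1) = c) (hc : 0 < c)
    (hP : P.IsHomogeneous D) (ht' : P.timeCoeff D = c') (hc' : 0 < c')
    (hint : ∀ ω : EuclideanSpace ℝ (Fin n), ‖ω‖ = 1 →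
      StrictlyInterlace (P.symbol ω) (P₁.symbol ω)) :
    ∃ θ Θ : ℝ, 0 < θ ∧ 0 < Θ ∧ ∀ p ∈ rootSet (N := D + 1) P₁ c B, ∃ η : Fin (D + 1) → ℝ,
      (∀ i, θ ≤ η i ∧ η i ≤ Θ) ∧
      P.symbol p.1 = ∑ i, C (η i : ℂ) * nodalErase (fun i => (p.2 i : ℂ)) i := by
  have hK := isCompact_rootSet (N := D + 1) P₁ c B
  have hI := fun (p : EuclideanSpace ℝ (Fin n) × (Fin (D + 1) → ℝ)) (hp : p ∈ rootSet P₁ c B) =>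
    interlace_of_mem_rootSet_of_interlaced hP₁ ht hc hP ht' hc' hp (hint p.1 (by simpa using hp.1))
  have hinj : ∀ p ∈ rootSet (N := D + 1) P₁ c B, Function.Injective p.2 := fun p hp => by
    obtain ⟨a, ha, -⟩ := hI p hp
    exact (strictMono_of_interlace ha).injective
  set f : Fin (D + 1) → EuclideanSpace ℝ (Fin n) × (Fin (D + 1) → ℝ) → ℝ := fun i p =>
    ((P.symbol p.1).eval (p.2 i : ℂ)).re / ∏ j ∈ Finset.univ.erase i, (p.2 i - p.2 j) with hf
  have hfc : ∀ i, ContinuousOn (f i) (rootSet P₁ c B) := fun i =>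
    ContinuousOn.div (continuous_eval_symbol_re P i).continuousOn (by fun_prop)
      fun p hp => prod_erase_ne_zero (hinj p hp) i
  have hfpos : ∀ i, ∀ p ∈ rootSet P₁ c B, 0 < f i p := fun i p hp => by
    obtain ⟨a, ha, hs⟩ := hI p hp
    simp only [hf, hs]
    rw [eval_C_mul_nodal_re, mul_div_assoc]
    refine mul_pos hc' ?_
    rcases mul_pos_iff.1 (prod_mul_prod_pos ha i) with h | h
    · exact div_pos h.1 h.2
    · exact div_pos_of_neg_of_neg h.1 h.2
  obtain ⟨θ, Θ, hθ, hΘ, hη⟩ := exists_uniform_bounds hK hfc hfpos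
  refine ⟨θ, Θ, hθ, hΘ, fun p hp => ⟨fun i => f i p, fun i => hη p hp i, ?_⟩⟩
  obtain ⟨a, ha, hs⟩ := hI p hp
  have hdeg : (C c' * nodal a).degree < (D + 1 : ℕ) := by
    rw [degree_C_mul hc'.ne', degree_eq_natDegree (monic_nodal a).ne_zero, natDegree_nodal]
    exact_mod_cast Nat.lt_succ_self D
  have h1 := congrArg (Polynomial.map (algebraMap ℝ ℂ)) (eq_sum_nodalErase (hinj p hp) hdeg)
  rw [Polynomial.map_mul, map_nodal, map_C, Polynomial.map_sum] at h1
  simp only [Polynomial.map_mul, map_nodalErase, map_C] at h1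
  refine hs.trans (h1.trans (Finset.sum_congr rfl fun i _ => ?_))
  simp only [hf, hs]
  rw [eval_C_mul_nodal_re, eval_mul, eval_C, eval_nodal]
  rfl

/-! ### Polynomials acting on jets -/

/-- The value `∑ p_k z_k` of the polynomial `p` at the sequence `z`. If `z_k = D^k w`, then this is
`p(D) w`. -/
def jetEval (z : ℕ → ℂ) : ℂ[X] →ₗ[ℂ] ℂ := Polynomial.lsum fun k => LinearMap.mulRight ℂ (z k)

theorem jetEval_monomial (z : ℕ → ℂ) (k : ℕ) (a : ℂ) : jetEval z (monomial k a) = a * z k := by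
  rw [jetEval, lsum_apply, sum_monomial_index] <;> simp

theorem jetEval_X_pow (z : ℕ → ℂ) (k : ℕ) : jetEval z (X ^ k) = z k := by
  rw [X_pow_eq_monomial, jetEval_monomial, one_mul]

theorem jetEval_C_mul (z : ℕ → ℂ) (a : ℂ) (p : ℂ[X]) : jetEval z (C a * p) = a * jetEval z p := by
  rw [← smul_eq_C_mul, map_smul, smul_eq_mul]

theorem jetEval_X_mul (z : ℕ → ℂ) (p : ℂ[X]) :
    jetEval z (X * p) = jetEval (fun k => z (k + 1)) p := by
  induction p using Polynomial.induction_on' with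
  | add p q hp hq => rw [mul_add, map_add, map_add, hp, hq]
  | monomial k a => rw [X_mul_monomial, jetEval_monomial, jetEval_monomial]

theorem jetEval_X_sub_C_mul (z : ℕ → ℂ) (b : ℂ) (p : ℂ[X]) :
    jetEval z ((X - C b) * p) = jetEval (fun k => z (k + 1)) p - b * jetEval z p := by
  rw [sub_mul, map_sub, jetEval_X_mul, jetEval_C_mul]

theorem jetEval_eq_sum_range (z : ℕ → ℂ) {p : ℂ[X]} {n : ℕ} (h : p.natDegree < n) :
    jetEval z p = ∑ k ∈ Finset.range n, p.coeff k * z k := by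
  rw [jetEval, lsum_apply, sum_over_range' _ (by simp) n h]
  rfl

theorem hasDerivAt_jetEval {z : ℕ → ℝ → ℂ} {s : ℂ} {t : ℝ}
    (hz : ∀ k, HasDerivAt (z k) (s * z (k + 1) t) t) (p : ℂ[X]) :
    HasDerivAt (fun t => jetEval (fun k => z k t) p) (s * jetEval (fun k => z k t) (X * p)) t := by
  induction p using Polynomial.induction_on' with
  | add p q hp hq =>
    simp only [mul_add, map_add]
    exact hp.fun_add hq
  | monomial k a =>
    simp only [X_mul_monomial, jetEval_monomial]
    exact ((hz k).const_mul a).congr_deriv (by ring)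

theorem norm_jetEval_prod_le {ι : Type*} [DecidableEq ι] {B : ℝ} {b : ι → ℂ}
    (hb : ∀ i, ‖b i‖ ≤ B) (s : Finset ι) :
    ∀ (z : ℕ → ℂ) (M : ℝ), (∀ k ≤ s.card, ‖z k‖ ≤ M) →
      ‖jetEval z (∏ i ∈ s, (X - C (b i)))‖ ≤ (1 + B) ^ s.card * M := by
  induction s using Finset.induction_on with
  | empty =>
    intro z M h
    rw [Finset.prod_empty, ← pow_zero (X : ℂ[X]), jetEval_X_pow, Finset.card_empty, pow_zero, one_mul]
    exact h 0 le_rfl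
  | insert a s ha ih =>
    intro z M h
    rw [Finset.prod_insert ha, jetEval_X_sub_C_mul, Finset.card_insert_of_notMem ha]
    rw [Finset.card_insert_of_notMem ha] at h
    have h1 := ih (fun k => z (k + 1)) M fun k hk => h _ (by omega)
    have h2 := ih z M fun k hk => h _ (by omega)
    calc _ ≤ (1 + B) ^ s.card * M + B * ((1 + B) ^ s.card * M) := by
          refine (norm_sub_le _ _).trans (add_le_add h1 ?_)
          rw [norm_mul]
          exact mul_le_mul (hb a) h2 (norm_nonneg _) ((norm_nonneg _).trans (hb a))
      _ = _ := by ring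

theorem norm_jetEval_prod_sub_le {ι : Type*} [DecidableEq ι] {B : ℝ} {b : ι → ℂ}
    (hb : ∀ i, ‖b i‖ ≤ B) (s : Finset ι) : ∀ (z : ℕ → ℂ) (M : ℝ), (∀ k < s.card, ‖z k‖ ≤ M) →
      ‖jetEval z (∏ i ∈ s, (X - C (b i))) - z s.card‖ ≤ ((1 + B) ^ s.card - 1) * M := by
  induction s using Finset.induction_on with
  | empty =>
    intro z M h
    rw [Finset.prod_empty, ← pow_zero (X : ℂ[X]), jetEval_X_pow, Finset.card_empty, pow_zero,
      sub_self, norm_zero, sub_self, zero_mul]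
  | insert a s ha ih =>
    intro z M h
    rw [Finset.prod_insert ha, jetEval_X_sub_C_mul, Finset.card_insert_of_notMem ha]
    rw [Finset.card_insert_of_notMem ha] at h
    have h1 := ih (fun k => z (k + 1)) M fun k hk => h _ (by omega)
    have h2 := norm_jetEval_prod_le hb s z M fun k hk => h _ (by omega)
    calc _ = ‖(jetEval (fun k => z (k + 1)) (∏ i ∈ s, (X - C (b i))) - z (s.card + 1)) -
            b a * jetEval z (∏ i ∈ s, (X - C (b i)))‖ := by congr 1; ring
      _ ≤ ((1 + B) ^ s.card - 1) * M + B * ((1 + B) ^ s.card * M) := by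
          refine (norm_sub_le _ _).trans (add_le_add h1 ?_)
          rw [norm_mul]
          exact mul_le_mul (hb a) h2 (norm_nonneg _) ((norm_nonneg _).trans (hb a))
      _ = _ := by ring

/-- The jet up to order `N - 1` is recovered from the variables `y_i`, by Lagrange interpolation. -/
theorem jetEval_X_pow_eq_sum {N : ℕ} {b : Fin N → ℝ} (hb : Function.Injective b) (z : ℕ → ℂ) {k : ℕ}
    (hk : k < N) :
    z k = ∑ i, ((b i ^ k / ∏ j ∈ Finset.univ.erase i, (b i - b j) : ℝ) : ℂ) *
      jetEval z (nodalErase (fun i => (b i : ℂ)) i) := by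
  have hdeg : (X ^ k : ℝ[X]).degree < N := by
    rw [degree_X_pow]; exact_mod_cast hk
  have h1 := congrArg (Polynomial.map (algebraMap ℝ ℂ)) (eq_sum_nodalErase hb hdeg)
  rw [Polynomial.map_sum] at h1
  simp only [Polynomial.map_mul, map_nodalErase, map_C, Polynomial.map_pow, map_X, eval_pow,
    eval_X] at h1
  rw [← jetEval_X_pow z k, h1, map_sum]
  simp only [jetEval_C_mul]
  rfl

/-- Equivalence of the energy in the variables of the star system with the energy of the jet. -/
theorem exists_energy_equiv (N : ℕ) {B g : ℝ} (hB : 0 ≤ B) (hg : 0 < g) :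
    ∃ C : ℝ, 0 < C ∧ ∀ (b : Fin N → ℝ) (K : ℝ) (z : ℕ → ℂ), 1 ≤ K → (∀ i, |b i| ≤ B) →
      (∀ i j, i ≠ j → g ≤ |b i - b j|) →
      (‖jetEval z (nodal fun i => (b i : ℂ))‖ ^ 2 +
          K * ∑ i, ‖jetEval z (nodalErase (fun i => (b i : ℂ)) i)‖ ^ 2 ≤
        C * (‖z N‖ ^ 2 + K * ∑ k ∈ Finset.range N, ‖z k‖ ^ 2)) ∧
      (‖z N‖ ^ 2 + K * ∑ k ∈ Finset.range N, ‖z k‖ ^ 2 ≤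
        C * (‖jetEval z (nodal fun i => (b i : ℂ))‖ ^ 2 +
          K * ∑ i, ‖jetEval z (nodalErase (fun i => (b i : ℂ)) i)‖ ^ 2)) := by
  set a : ℝ := (1 + B) ^ N with ha
  have ha1 : 1 ≤ a := one_le_pow₀ (by linarith)
  set e : ℝ := a / min g 1 ^ N with he
  have hg' : 0 < min g 1 := by positivity
  have he0 : 0 < e := by positivity
  refine ⟨2 + (2 * a ^ 2 + N * a ^ 2) + (2 * a ^ 2 + 1) * (N * (e ^ 2 * N)), by positivity, ?_⟩
  intro b K z hK hbB hbg
  have hinj : Function.Injective b := fun i j hij => by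
    by_contra h
    have := hbg i j h
    rw [hij, sub_self, abs_zero] at this
    linarith
  have hbB' : ∀ i, ‖(b i : ℂ)‖ ≤ B := fun i => by simpa using hbB i
  set T : ℝ := ∑ k ∈ Finset.range N, ‖z k‖ ^ 2 with hT
  set Y : ℝ := ∑ i, ‖jetEval z (nodalErase (fun i => (b i : ℂ)) i)‖ ^ 2 with hY
  set l := jetEval z (nodal fun i => (b i : ℂ)) with hl
  have hT0 : 0 ≤ T := Finset.sum_nonneg fun _ _ => by positivity
  have hY0 : 0 ≤ Y := Finset.sum_nonneg fun _ _ => by positivity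
  have hzT : ∀ k < N, ‖z k‖ ≤ √T := fun k hk => Real.le_sqrt_of_sq_le
    (Finset.single_le_sum (f := fun k => ‖z k‖ ^ 2) (fun _ _ => by positivity)
      (Finset.mem_range.2 hk))
  have hsq : √T ^ 2 = T := Real.sq_sqrt hT0
  -- `l - z N` involves only the `z k` with `k < N`, which are controlled by the `y_i`
  have hlz : ‖l - z N‖ ≤ a * √T := by
    have := norm_jetEval_prod_sub_le hbB' Finset.univ z (√T) (by simpa using hzT)
    rw [Finset.card_univ, Fintype.card_fin] at this
    refine this.trans ?_
    gcongr
    linarith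
  have hlz2 : ‖l‖ ^ 2 ≤ 2 * ‖z N‖ ^ 2 + 2 * a ^ 2 * T := by
    have h1 : ‖l‖ ≤ ‖z N‖ + a * √T := by
      calc ‖l‖ = ‖z N + (l - z N)‖ := by congr 1; ring
        _ ≤ _ := (norm_add_le _ _).trans (by gcongr)
    calc ‖l‖ ^ 2 ≤ (‖z N‖ + a * √T) ^ 2 := by gcongr
      _ ≤ 2 * ‖z N‖ ^ 2 + 2 * a ^ 2 * √T ^ 2 := by nlinarith [sq_nonneg (‖z N‖ - a * √T)]
      _ = _ := by rw [hsq]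
  have hzl2 : ‖z N‖ ^ 2 ≤ 2 * ‖l‖ ^ 2 + 2 * a ^ 2 * T := by
    have h1 : ‖z N‖ ≤ ‖l‖ + a * √T := by
      calc ‖z N‖ = ‖l - (l - z N)‖ := by congr 1; ring
        _ ≤ _ := (norm_sub_le _ _).trans (by gcongr)
    calc ‖z N‖ ^ 2 ≤ (‖l‖ + a * √T) ^ 2 := by gcongr
      _ ≤ 2 * ‖l‖ ^ 2 + 2 * a ^ 2 * √T ^ 2 := by nlinarith [sq_nonneg (‖l‖ - a * √T)]
      _ = _ := by rw [hsq]
  have hYT : Y ≤ N * a ^ 2 * T := by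
    have : ∀ i ∈ (Finset.univ : Finset (Fin N)),
        ‖jetEval z (nodalErase (fun i => (b i : ℂ)) i)‖ ^ 2 ≤ a ^ 2 * T := by
      intro i hi
      have hcard : (Finset.univ.erase i).card = N - 1 := by
        rw [Finset.card_erase_of_mem hi, Finset.card_univ, Fintype.card_fin]
      have hN := i.pos
      have h1 := norm_jetEval_prod_le hbB' (Finset.univ.erase i) z (√T) (fun k hk => hzT k (by omega))
      calc _ ≤ ((1 + B) ^ (Finset.univ.erase i).card * √T) ^ 2 := by gcongr; exact h1
        _ ≤ (a * √T) ^ 2 := by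
          gcongr
          rw [ha, hcard]
          exact pow_le_pow_right₀ (by linarith) (by omega)
        _ = _ := by rw [mul_pow, hsq]
    calc Y ≤ ∑ _i : Fin N, a ^ 2 * T := Finset.sum_le_sum this
      _ = _ := by simp; ring
  have hTY : T ≤ N * (e ^ 2 * N) * Y := by
    have : ∀ k ∈ Finset.range N, ‖z k‖ ^ 2 ≤ e ^ 2 * N * Y := by
      intro k hk
      have hk' := Finset.mem_range.1 hk
      have h1 : ‖z k‖ ≤ e * ∑ i, ‖jetEval z (nodalErase (fun i => (b i : ℂ)) i)‖ := by
        conv_lhs => rw [jetEval_X_pow_eq_sum hinj z hk']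
        refine norm_sum_mul_le _ _ fun i => ?_
        rw [Complex.norm_real, norm_div, norm_pow, norm_prod]
        refine div_le_div₀ (by positivity) ?_ (by positivity) ?_
        · calc ‖b i‖ ^ k ≤ (1 + B) ^ k := by
                gcongr
                rw [Real.norm_eq_abs]
                linarith [hbB i]
            _ ≤ _ := pow_le_pow_right₀ (by linarith) hk'.le
        · calc min g 1 ^ N ≤ min g 1 ^ (Finset.univ.erase i).card := by
                refine pow_le_pow_of_le_one hg'.le (min_le_right _ _) ?_
                exact (Finset.card_le_univ _).trans (by simp)
            _ = ∏ j ∈ Finset.univ.erase i, min g 1 := by simp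
            _ ≤ _ := Finset.prod_le_prod (fun _ _ => hg'.le) fun j hj =>
                (min_le_left _ _).trans (hbg i j (Finset.ne_of_mem_erase hj).symm)
      calc ‖z k‖ ^ 2 ≤ (e * ∑ i, ‖jetEval z (nodalErase (fun i => (b i : ℂ)) i)‖) ^ 2 := by gcongr
        _ = e ^ 2 * (∑ i, ‖jetEval z (nodalErase (fun i => (b i : ℂ)) i)‖) ^ 2 := by ring
        _ ≤ e ^ 2 * (N * Y) := by gcongr; exact sq_sum_norm_le _
        _ = _ := by ring
    calc T ≤ ∑ _k ∈ Finset.range N, e ^ 2 * N * Y := Finset.sum_le_sum this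
      _ = _ := by simp; ring
  have hKT : T ≤ K * T := le_mul_of_one_le_left hT0 hK
  have hKY : Y ≤ K * Y := le_mul_of_one_le_left hY0 hK
  constructor
  · have h1 : K * Y ≤ N * a ^ 2 * (K * T) := by
      calc K * Y ≤ K * (N * a ^ 2 * T) := by gcongr
        _ = _ := by ring
    have h2 : 2 * a ^ 2 * T ≤ 2 * a ^ 2 * (K * T) := by gcongr
    have h3 : 0 ≤ (2 * a ^ 2 + N * a ^ 2 + (2 * a ^ 2 + 1) * (N * (e ^ 2 * N))) * ‖z N‖ ^ 2 := by
      positivity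
    have h4 : 0 ≤ (2 + (2 * a ^ 2 + 1) * (N * (e ^ 2 * N))) * (K * T) := by positivity
    linarith
  · have h1 : (2 * a ^ 2 + 1) * (K * T) ≤ (2 * a ^ 2 + 1) * (N * (e ^ 2 * N)) * (K * Y) := by
      calc (2 * a ^ 2 + 1) * (K * T) ≤ (2 * a ^ 2 + 1) * (K * (N * (e ^ 2 * N) * Y)) := by gcongr
        _ = _ := by ring
    have h2 : 2 * a ^ 2 * T ≤ 2 * a ^ 2 * (K * T) := by gcongr
    have h3 : 0 ≤ (2 * a ^ 2 + N * a ^ 2 + (2 * a ^ 2 + 1) * (N * (e ^ 2 * N))) * ‖l‖ ^ 2 := by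
      positivity
    have h4 : 0 ≤ (2 + (2 * a ^ 2 + N * a ^ 2)) * (K * Y) := by positivity
    linarith

/-- Decay of the energy of a single Fourier mode, with the frequency `r ω` scaled to `ω`. -/
theorem exists_mode_decay (N : ℕ) {c B g θ Θ : ℝ} (hc : 0 < c) (hB : 0 ≤ B) (hg : 0 < g)
    (hθ : 0 < θ) (hΘ : 0 < Θ) :
    ∃ A c₀ : ℝ, 0 < A ∧ 0 < c₀ ∧ ∀ (b δ η : Fin N → ℝ) (β K r : ℝ) (P P₂ : ℂ[X]), |β| ≤ B →
      (∀ i, |b i| ≤ B) → (∀ i j, i ≠ j → g ≤ |b i - b j|) →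
      (∀ i, θ * K ≤ δ i + r⁻¹ ^ 2 * η i) → (∀ i, δ i + r⁻¹ ^ 2 * η i ≤ Θ * K) → 1 ≤ K → 0 < r →
      P = (X + C (β : ℂ)) * nodal (fun i => (b i : ℂ)) -
        ∑ i, C (δ i : ℂ) * nodalErase (fun i => (b i : ℂ)) i →
      P₂ = ∑ i, C (η i : ℂ) * nodalErase (fun i => (b i : ℂ)) i →
      ∀ z : ℕ → ℝ → ℂ, (∀ k t, HasDerivAt (z k) (Complex.I * r * z (k + 1) t) t) →
      (∀ t, jetEval (fun k => z k t) P = Complex.I * (r : ℂ)⁻¹ *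
          (c * jetEval (fun k => z k t) (nodal fun i => (b i : ℂ))) +
          (r : ℂ)⁻¹ ^ 2 * jetEval (fun k => z k t) P₂) →
      ∀ t, 0 ≤ t → ‖z N t‖ ^ 2 + K * ∑ k ∈ Finset.range N, ‖z k t‖ ^ 2 ≤
        A * Real.exp (-(c₀ * (r ^ 2 * K / (1 + r + r * K) ^ 2)) * t) *
          (‖z N 0‖ ^ 2 + K * ∑ k ∈ Finset.range N, ‖z k 0‖ ^ 2) := by
  obtain ⟨C₁, c₀, hC₁, hc₀, h1⟩ := star_decay N hc hB hg hθ hΘ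
  obtain ⟨C₂, hC₂, h2⟩ := exists_energy_equiv N hB hg
  refine ⟨C₂ * C₁ * C₂, c₀, by positivity, hc₀, ?_⟩
  rintro b δ η β K r P P₂ hβ hbB hbg hκ1 hκ2 hK hr rfl rfl z hz heq t ht
  have hr' : (r : ℂ) ≠ 0 := by exact_mod_cast hr.ne'
  have h := h1 b (fun i => δ i + r⁻¹ ^ 2 * η i) β K r hβ hbB hbg hκ1 hκ2 hK hr
    (fun i t => jetEval (fun k => z k t) (nodalErase (fun i => (b i : ℂ)) i))
    (fun t => jetEval (fun k => z k t) (nodal fun i => (b i : ℂ)))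
    (fun i t => (hasDerivAt_jetEval (fun k => hz k t) _).congr_deriv ?_)
    (fun t => (hasDerivAt_jetEval (fun k => hz k t) _).congr_deriv ?_) t ht
  · calc _ ≤ C₂ * _ := (h2 b K (fun k => z k t) hK hbB hbg).2
      _ ≤ C₂ * (C₁ * Real.exp (-(c₀ * (r ^ 2 * K / (1 + r + r * K) ^ 2)) * t) *
          (C₂ * (‖z N 0‖ ^ 2 + K * ∑ k ∈ Finset.range N, ‖z k 0‖ ^ 2))) := by
        gcongr
        refine h.trans ?_
        gcongr
        exact (h2 b K (fun k => z k 0) hK hbB hbg).1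
      _ = _ := by ring
  · have := congrArg (jetEval fun k => z k t) (mul_nodalErase (fun i => (b i : ℂ)) i)
    rw [sub_mul, map_sub, jetEval_C_mul] at this
    rw [← this]
    ring
  · have h3 := heq t
    rw [add_mul, map_sub, map_add, jetEval_C_mul, map_sum, map_sum] at h3
    simp only [jetEval_C_mul] at h3
    have h4 : jetEval (fun k => z k t) (X * nodal fun i => (b i : ℂ)) =
        Complex.I * (r : ℂ)⁻¹ * (c * jetEval (fun k => z k t) (nodal fun i => (b i : ℂ))) -
        β * jetEval (fun k => z k t) (nodal fun i => (b i : ℂ)) +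
        ∑ i, ((δ i + r⁻¹ ^ 2 * η i : ℝ) : ℂ) *
          jetEval (fun k => z k t) (nodalErase (fun i => (b i : ℂ)) i) := by
      push_cast
      simp only [add_mul, Finset.sum_add_distrib, mul_assoc, ← Finset.mul_sum]
      linear_combination h3
    have hrr : (r : ℂ) * (r : ℂ)⁻¹ = 1 := mul_inv_cancel₀ hr'
    rw [h4]
    linear_combination (c * jetEval (fun k => z k t) (nodal fun i => (b i : ℂ))) *
      (Complex.I_sq + Complex.I ^ 2 * hrr)

/-! ### Bounds for the fundamental solutions of a single Fourier mode -/

theorem SolvesODE.jetEval_eq_zero {m : ℕ} {p : ℂ[X]} {w : ℕ → ℝ → ℂ}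
    (hw : SolvesODE m (fun j => p.coeff j) w) (hp : p.natDegree ≤ m) (hpm : p.coeff m = 1) (t : ℝ) :
    jetEval (fun k => w k t) p = 0 := by
  have h := hw.equation 0 t
  rw [jetEval_eq_sum_range _ (Nat.lt_succ_of_le hp), Finset.sum_range_succ, hpm, one_mul]
  simp only [add_zero, zero_add] at h
  rw [h, add_neg_cancel]

theorem DiffOp.natDegree_csymbol_le {n D : ℕ} {P : DiffOp n} (hP : P.IsHomogeneous D)
    (ζ : Fin n → ℂ) : (P.csymbol ζ).natDegree ≤ D :=
  natDegree_le_iff_coeff_eq_zero.2 fun _ hk => coeff_csymbol_eq_zero hP _ hk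

/-- By homogeneity, a frequency `s ζ` is reduced to `ζ` if the `k`-th derivative is divided by
`s ^ k`. -/
theorem jetEval_csymbol_smul {n D : ℕ} {P : DiffOp n} (hP : P.IsHomogeneous D) (ζ : Fin n → ℂ)
    {s : ℂ} (hs : s ≠ 0) (w : ℕ → ℂ) :
    jetEval w (P.csymbol fun i => s * ζ i) =
      s ^ D * jetEval (fun k => s⁻¹ ^ k * w k) (P.csymbol ζ) := by
  rw [jetEval_eq_sum_range _ (Nat.lt_succ_of_le (DiffOp.natDegree_csymbol_le hP _)),
    jetEval_eq_sum_range _ (Nat.lt_succ_of_le (DiffOp.natDegree_csymbol_le hP _)), Finset.mul_sum]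
  refine Finset.sum_congr rfl fun k hk => ?_
  have hk' : k ≤ D := Nat.lt_succ_iff.1 (Finset.mem_range.1 hk)
  rw [DiffOp.coeff_csymbol_smul hP, ← Nat.sub_add_cancel hk', pow_add s, Nat.sub_add_cancel hk']
  have : s ^ k * s⁻¹ ^ k = 1 := by rw [← mul_pow, mul_inv_cancel₀ hs, one_pow]
  linear_combination -(s ^ (D - k) * (P.csymbol ζ).coeff k * w k) * this

/-- The lower bound for the rate of dissipation, for `K = 1` and for `K = 1 + r⁻²`. -/
theorem sq_min_le_rate {r ε : ℝ} (hr : 0 < r) (hε : ε = 0 ∨ ε = 1) :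
    min r 1 ^ 2 / 16 ≤ r ^ 2 * (1 + ε * r⁻¹ ^ 2) / (1 + r + r * (1 + ε * r⁻¹ ^ 2)) ^ 2 := by
  rcases hε with rfl | rfl
  · simp only [zero_mul, add_zero, mul_one]
    rw [div_le_div_iff₀ (by norm_num) (by positivity)]
    rcases le_total r 1 with h | h
    · rw [min_eq_left h]; gcongr; nlinarith
    · rw [min_eq_right h]; nlinarith
  · have e : r ^ 2 * (1 + 1 * r⁻¹ ^ 2) / (1 + r + r * (1 + 1 * r⁻¹ ^ 2)) ^ 2 =
        (r ^ 2 * (r ^ 2 + 1)) / (r + 2 * r ^ 2 + 1) ^ 2 := by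
      field_simp
      ring
    rw [e, div_le_div_iff₀ (by norm_num) (by positivity)]
    rcases le_total r 1 with h | h
    · rw [min_eq_left h, mul_assoc]
      gcongr
      have : (r + 2 * r ^ 2 + 1) ^ 2 ≤ 4 ^ 2 := by gcongr; nlinarith
      nlinarith
    · rw [min_eq_right h]
      have : (r + 2 * r ^ 2 + 1) ^ 2 ≤ (4 * r ^ 2) ^ 2 := by gcongr; nlinarith
      nlinarith

/-- For `r ≤ 1`, the weight of `r⁻¹ ^ k * w k` in the energy, `K = 1 + ε r⁻²` for `k < N`
and `1` for `k = N`, is comparable to the square of `r ^ k / r ^ (min k (N - ε) + ε)`. -/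
theorem weight_bounds {N ε k : ℕ} {r : ℝ} (hr : 0 < r) (hr1 : r ≤ 1) (hε : ε = 0 ∨ ε = 1)
    (hεN : ε ≤ N) (hk : k ≤ N) :
    (r ^ k) ^ 2 ≤ (if k < N then 1 + ε * r⁻¹ ^ 2 else 1) * (r ^ (min k (N - ε) + ε)) ^ 2 ∧
    (if k < N then 1 + ε * r⁻¹ ^ 2 else 1) * (r ^ (min k (N - ε) + ε)) ^ 2 ≤ 2 * (r ^ k) ^ 2 := by
  have hpos : 0 < (r ^ k) ^ 2 := by positivity
  rcases hε with rfl | rfl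
  · have : min k (N - 0) = k := by omega
    rw [this]
    simp only [Nat.cast_zero, zero_mul, add_zero, ite_self, one_mul]
    exact ⟨le_rfl, by linarith⟩
  · rcases lt_or_ge k N with h | h
    · have : min k (N - 1) = k := by omega
      rw [if_pos h, this]
      have e : (1 + ((1 : ℕ) : ℝ) * r⁻¹ ^ 2) * (r ^ (k + 1)) ^ 2 = (r ^ 2 + 1) * (r ^ k) ^ 2 := by
        field_simp
        push_cast
        ring
      rw [e]
      have h2 : r ^ 2 ≤ 1 := pow_le_one₀ hr.le hr1
      constructor <;> nlinarith [sq_nonneg r]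
    · have : min k (N - 1) + 1 = k := by omega
      rw [if_neg (by omega), this, one_mul]
      exact ⟨le_rfl, by linarith⟩

theorem pow_mul_inv_pow {r : ℝ} (hr : r ≠ 0) (k : ℕ) : r ^ k * r⁻¹ ^ k = 1 := by
  rw [← mul_pow, mul_inv_cancel₀ hr, one_pow]

/-- Bounds on the solutions of the ODE `Q(∂_t, i r ω) w = 0` for `Q = P_m + P_{m-1} + P_{m-2}`
(`ε = 1`) or `Q = P_m + P_{m-1}` (`ε = 0`, `P_{m-2} = 0`), `m = D + 2`, with unit initial data. -/
theorem exists_crude_bound {n D ε : ℕ} (hε : ε = 0 ∨ ε = 1) {P P₁ P₂ : DiffOp n} {c B : ℝ}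
    (hP : P.IsHomogeneous (D + 2)) (hP1 : P.timeCoeff (D + 2) = 1)
    (hP₁ : P₁.IsHomogeneous (D + 1)) (ht : P₁.timeCoeff (D + 1) = c) (hc : 0 < c)
    (hP₂ : P₂.IsHomogeneous D)
    (hroots : ∀ ω : EuclideanSpace ℝ (Fin n), ‖ω‖ = 1 →
      ∃ b : Fin (D + 1) → ℝ, (ω, b) ∈ rootSet P₁ c B)
    (hint : ∀ ω : EuclideanSpace ℝ (Fin n), ‖ω‖ = 1 →
      StrictlyInterlace (P₁.symbol ω) (P.symbol ω))
    (hη : ∃ θ Θ : ℝ, 0 < θ ∧ 0 < Θ ∧ ∀ p ∈ rootSet (N := D + 1) P₁ c B, ∃ η : Fin (D + 1) → ℝ,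
      (∀ i, ε * θ ≤ η i ∧ η i ≤ ε * Θ) ∧
      P₂.symbol p.1 = ∑ i, C (η i : ℂ) * nodalErase (fun i => (p.2 i : ℂ)) i) :
    ∃ A c₀ : ℝ, 0 < A ∧ 0 < c₀ ∧ ∀ (ω : EuclideanSpace ℝ (Fin n)) (r : ℝ) (w : ℕ → ℝ → ℂ) (j : ℕ),
      ‖ω‖ = 1 → 0 < r → j < D + 2 →
      SolvesODE (D + 2) (fun j => ((P + P₁ + P₂).csymbol fun i => Complex.I * r * ω i).coeff j) w →
      (∀ k < D + 2, w k 0 = if k = j then 1 else 0) → ∀ k < D + 2, ∀ t, 0 ≤ t →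
      (1 ≤ r → ‖w k t‖ ≤ A * (r ^ k * (r⁻¹ ^ j * Real.exp (-c₀ * t)))) ∧
      (r ≤ 1 → ‖w k t‖ ≤ A * (r ^ min k (D + 1 - ε) *
        (r⁻¹ ^ min j (D + 1 - ε) * Real.exp (-(c₀ * r ^ 2) * t)))) := by
  obtain ⟨B', g, θ, Θ, hg, hθ, hΘ, hdec⟩ := exists_decomposition (B := B) hP₁ ht hc hP hP1 hint
  obtain ⟨θ₂, Θ₂, hθ₂, hΘ₂, hdec₂⟩ := hη
  obtain ⟨A, c₀, hA, hc₀, hmode⟩ := exists_mode_decay (D + 1) (B := max 0 (max B B')) hc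
    (le_max_left _ _) hg (lt_min hθ hθ₂) (lt_max_of_lt_left hΘ : 0 < max Θ Θ₂)
  refine ⟨√(2 * A), c₀ / 32, by positivity, by positivity, ?_⟩
  intro ω r w j hω hr hj hw hw0
  obtain ⟨b, hb⟩ := hroots ω hω
  obtain ⟨β, δ, hβ, hbg, hδ, hPdec⟩ := hdec _ hb
  obtain ⟨η, hη, hP₂dec⟩ := hdec₂ _ hb
  have hP₁dec := symbol_eq_of_mem_rootSet hb
  dsimp only at hPdec hP₂dec hP₁dec hbg
  set s : ℂ := Complex.I * r with hs
  have hr' : (r : ℂ) ≠ 0 := by exact_mod_cast hr.ne'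
  have hs0 : s ≠ 0 := mul_ne_zero Complex.I_ne_zero hr'
  have hns : ‖s‖ = r := by rw [hs, norm_mul, Complex.norm_I, one_mul, Complex.norm_real,
    Real.norm_of_nonneg hr.le]
  set z : ℕ → ℝ → ℂ := fun k t => s⁻¹ ^ k * w k t with hz
  have hnz : ∀ k t, ‖z k t‖ = r⁻¹ ^ k * ‖w k t‖ := fun k t => by
    rw [hz, norm_mul, norm_pow, norm_inv, hns]
  have hjet : ∀ k t, HasDerivAt (z k) (s * z (k + 1) t) t := fun k t =>
    ((hw.isJet k t).const_mul (s⁻¹ ^ k)).congr_deriv (by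
      rw [hz]; dsimp only; rw [pow_succ]
      field_simp)
  -- the equation, divided by `(i r)^(D + 2)`
  have heq : ∀ t, jetEval (fun k => z k t) (P.symbol ω) = Complex.I * (r : ℂ)⁻¹ *
      (c * jetEval (fun k => z k t) (nodal fun i => (b i : ℂ))) +
      (r : ℂ)⁻¹ ^ 2 * jetEval (fun k => z k t) (P₂.symbol ω) := by
    intro t
    have h0 := hw.jetEval_eq_zero (p := (P + P₁ + P₂).csymbol fun i => s * ω i) ?_ ?_ t
    · rw [DiffOp.csymbol_add, DiffOp.csymbol_add, map_add, map_add, jetEval_csymbol_smul hP _ hs0,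
        jetEval_csymbol_smul hP₁ _ hs0, jetEval_csymbol_smul hP₂ _ hs0] at h0
      rw [← jetEval_C_mul, ← hP₁dec]
      simp only [DiffOp.symbol_eq_csymbol]
      have h1 : s ^ D * (s ^ 2 * jetEval (fun k => z k t) (P.csymbol fun i => (ω i : ℂ)) +
          s * jetEval (fun k => z k t) (P₁.csymbol fun i => (ω i : ℂ)) +
          jetEval (fun k => z k t) (P₂.csymbol fun i => (ω i : ℂ))) = 0 := by
        rw [← h0]; ring
      have h2 := (mul_eq_zero.1 h1).resolve_left (pow_ne_zero _ hs0)
      have hrr : (r : ℂ) * (r : ℂ)⁻¹ = 1 := mul_inv_cancel₀ hr'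
      generalize jetEval (fun k => z k t) (P.csymbol fun i => (ω i : ℂ)) = x at *
      generalize jetEval (fun k => z k t) (P₁.csymbol fun i => (ω i : ℂ)) = y at *
      generalize jetEval (fun k => z k t) (P₂.csymbol fun i => (ω i : ℂ)) = v at *
      rw [hs] at h2
      field_simp
      linear_combination -h2 + (r : ℂ) ^ 2 * x * Complex.I_sq
    · rw [DiffOp.csymbol_add, DiffOp.csymbol_add]
      refine natDegree_add_le_of_degree_le (natDegree_add_le_of_degree_le
        (DiffOp.natDegree_csymbol_le hP _) ((DiffOp.natDegree_csymbol_le hP₁ _).trans (by omega)))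
        ((DiffOp.natDegree_csymbol_le hP₂ _).trans (by omega))
    · rw [DiffOp.csymbol_add, DiffOp.csymbol_add, coeff_add, coeff_add,
        DiffOp.coeff_csymbol_self hP, DiffOp.coeff_csymbol_eq_zero hP₁ _ (by omega),
        DiffOp.coeff_csymbol_eq_zero hP₂ _ (by omega), hP1, add_zero, add_zero]
  set K : ℝ := 1 + ε * r⁻¹ ^ 2 with hK
  have hK1 : 1 ≤ K := by
    have : 0 ≤ ε * r⁻¹ ^ 2 := by positivity
    linarith
  have hE := hmode b δ η β K r (P.symbol ω) (P₂.symbol ω) (hβ.trans (by simp))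
    (fun i => (abs_le.2 ⟨hb.2.1.1 i, hb.2.1.2 i⟩).trans (by simp)) hbg (fun i => ?_) (fun i => ?_)
    hK1 hr hPdec hP₂dec z hjet heq
  rotate_left
  · calc min θ θ₂ * K = min θ θ₂ + r⁻¹ ^ 2 * (ε * min θ θ₂) := by rw [hK]; ring
      _ ≤ δ i + r⁻¹ ^ 2 * η i := by
        gcongr
        · exact (min_le_left _ _).trans (hδ i).1
        · exact le_trans (by gcongr; exact min_le_right _ _) (hη i).1
  · calc δ i + r⁻¹ ^ 2 * η i ≤ max Θ Θ₂ + r⁻¹ ^ 2 * (ε * max Θ Θ₂) := by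
          gcongr
          · exact (hδ i).2.trans (le_max_left _ _)
          · exact (hη i).2.trans (by gcongr; exact le_max_right _ _)
      _ = max Θ Θ₂ * K := by rw [hK]; ring
  -- the energy in terms of `w`
  set κ : ℕ → ℝ := fun k => if k < D + 1 then K else 1 with hκ
  have hκ1 : ∀ k, 1 ≤ κ k := fun k => by simp only [hκ]; split_ifs <;> simp [hK1]
  have hEsum : ∀ t, ‖z (D + 1) t‖ ^ 2 + K * ∑ k ∈ Finset.range (D + 1), ‖z k t‖ ^ 2 =
      ∑ k ∈ Finset.range (D + 2), κ k * ‖z k t‖ ^ 2 := by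
    intro t
    rw [Finset.sum_range_succ (fun k => κ k * ‖z k t‖ ^ 2), Finset.mul_sum, add_comm]
    congr 1
    · refine Finset.sum_congr rfl fun k hk => ?_
      simp only [hκ]
      rw [if_pos (Finset.mem_range.1 hk)]
    · simp [hκ]
  have hE0 : ∑ k ∈ Finset.range (D + 2), κ k * ‖z k 0‖ ^ 2 = κ j * (r⁻¹ ^ j) ^ 2 := by
    rw [Finset.sum_eq_single_of_mem j (Finset.mem_range.2 hj)]
    · rw [hnz, hw0 j hj, if_pos rfl, norm_one, mul_one]
    · intro k hk hkj
      rw [hnz, hw0 k (Finset.mem_range.1 hk), if_neg hkj]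
      simp
  have key : ∀ k < D + 2, ∀ t, 0 ≤ t → κ k * (r⁻¹ ^ k * ‖w k t‖) ^ 2 ≤
      A * Real.exp (-(c₀ / 16 * min r 1 ^ 2) * t) * (κ j * (r⁻¹ ^ j) ^ 2) := by
    intro k hk t ht
    have h1 := hE t ht
    rw [hEsum, hEsum, hE0] at h1
    rw [← hnz]
    refine ((Finset.single_le_sum (f := fun k => κ k * ‖z k t‖ ^ 2) (fun i _ => ?_)
      (Finset.mem_range.2 hk)).trans h1).trans ?_
    · exact mul_nonneg (zero_le_one.trans (hκ1 i)) (sq_nonneg _)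
    · have := hκ1 j
      have h2 := sq_min_le_rate (ε := ε) hr (by rcases hε with rfl | rfl <;> simp)
      have h3 : c₀ / 16 * min r 1 ^ 2 ≤ c₀ * (r ^ 2 * K / (1 + r + r * K) ^ 2) := by
        calc c₀ / 16 * min r 1 ^ 2 = c₀ * (min r 1 ^ 2 / 16) := by ring
          _ ≤ _ := by gcongr
      gcongr
  have hexp : ∀ x t : ℝ, Real.exp (-(c₀ / 16 * x) * t) = Real.exp (-(c₀ / 32 * x) * t) ^ 2 := by
    intro x t
    rw [← Real.exp_nat_mul]
    congr 1
    push_cast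
    ring
  intro k hk t ht
  have hkey := key k hk t ht
  have hrk := pow_mul_inv_pow hr.ne' k
  have hsqA : √(2 * A) ^ 2 = 2 * A := Real.sq_sqrt (by positivity)
  constructor
  · intro h1
    rw [min_eq_right h1, hexp, one_pow, mul_one] at hkey
    refine le_of_sq_le_sq ?_ (by positivity)
    have hκ2 : κ j ≤ 2 := by
      have h3 : ε * r⁻¹ ^ 2 ≤ 1 := by
        have h4 : r⁻¹ ^ 2 ≤ 1 := pow_le_one₀ (by positivity) (inv_le_one_of_one_le₀ h1)
        have h5 : (ε : ℝ) ≤ 1 := by rcases hε with rfl | rfl <;> simp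
        exact mul_le_one₀ h5 (by positivity) h4
      simp only [hκ]
      split_ifs <;> linarith
    calc ‖w k t‖ ^ 2 = (r ^ k) ^ 2 * (r⁻¹ ^ k * ‖w k t‖) ^ 2 := by
          rw [← mul_pow, ← mul_assoc, hrk, one_mul]
      _ ≤ (r ^ k) ^ 2 * (κ k * (r⁻¹ ^ k * ‖w k t‖) ^ 2) := by
          gcongr
          exact le_mul_of_one_le_left (by positivity) (hκ1 k)
      _ ≤ (r ^ k) ^ 2 * (A * Real.exp (-(c₀ / 32) * t) ^ 2 * (2 * (r⁻¹ ^ j) ^ 2)) :=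
          mul_le_mul_of_nonneg_left (hkey.trans (by gcongr)) (by positivity)
      _ = _ := by rw [mul_pow, hsqA]; ring
  · intro h1
    rw [min_eq_left h1, hexp] at hkey
    refine le_of_sq_le_sq ?_ (by positivity)
    have hεN : ε ≤ D + 1 := by omega
    have hwk := (weight_bounds hr h1 hε hεN (Nat.lt_succ_iff.1 hk)).1
    have hwj := (weight_bounds hr h1 hε hεN (Nat.lt_succ_iff.1 hj)).2
    change _ ≤ κ k * _ at hwk
    change κ j * _ ≤ _ at hwj
    set a := min k (D + 1 - ε)
    set b := min j (D + 1 - ε)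
    have hrb := pow_mul_inv_pow hr.ne' (b + ε)
    have hrj := pow_mul_inv_pow hr.ne' j
    have hrε := pow_mul_inv_pow hr.ne' ε
    have hj' : κ j * (r⁻¹ ^ j) ^ 2 ≤ 2 * (r⁻¹ ^ (b + ε)) ^ 2 := by
      calc κ j * (r⁻¹ ^ j) ^ 2 = κ j * (r ^ (b + ε)) ^ 2 * ((r⁻¹ ^ j) ^ 2 * (r⁻¹ ^ (b + ε)) ^ 2) := by
            linear_combination -(κ j * (r⁻¹ ^ j) ^ 2) * (r ^ (b + ε) * r⁻¹ ^ (b + ε) + 1) * hrb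
        _ ≤ 2 * (r ^ j) ^ 2 * ((r⁻¹ ^ j) ^ 2 * (r⁻¹ ^ (b + ε)) ^ 2) := by gcongr
        _ = _ := by
            linear_combination (2 * (r⁻¹ ^ (b + ε)) ^ 2) * (r ^ j * r⁻¹ ^ j + 1) * hrj
    calc ‖w k t‖ ^ 2 = (r ^ k) ^ 2 * (r⁻¹ ^ k * ‖w k t‖) ^ 2 := by
          rw [← mul_pow, ← mul_assoc, hrk, one_mul]
      _ ≤ κ k * (r ^ (a + ε)) ^ 2 * (r⁻¹ ^ k * ‖w k t‖) ^ 2 := by gcongr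
      _ = (r ^ (a + ε)) ^ 2 * (κ k * (r⁻¹ ^ k * ‖w k t‖) ^ 2) := by ring
      _ ≤ (r ^ (a + ε)) ^ 2 * (A * Real.exp (-(c₀ / 32 * r ^ 2) * t) ^ 2 *
          (2 * (r⁻¹ ^ (b + ε)) ^ 2)) :=
          mul_le_mul_of_nonneg_left (hkey.trans (by gcongr)) (by positivity)
      _ = _ := by
          rw [mul_pow, hsqA, pow_add r, pow_add r⁻¹]
          linear_combination (2 * A * Real.exp (-(c₀ / 32 * r ^ 2) * t) ^ 2 * (r ^ a) ^ 2 *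
            (r⁻¹ ^ b) ^ 2) * (r ^ ε * r⁻¹ ^ ε + 1) * hrε

/-! ### Fundamental solutions of the ordinary differential equation -/

/-- The companion operator of the equation `w^{(N+1)} + ∑_{j≤N} q_j w^{(j)} = 0`. -/
def companion (N : ℕ) (q : ℕ → ℂ) : (Fin (N + 1) → ℂ) →L[ℂ] (Fin (N + 1) → ℂ) :=
  ContinuousLinearMap.pi fun i => if h : (i : ℕ) < N then
    ContinuousLinearMap.proj ⟨i + 1, by omega⟩ else -∑ j : Fin (N + 1), q j • ContinuousLinearMap.proj j

theorem companion_apply_of_lt {N : ℕ} (q : ℕ → ℂ) (y : Fin (N + 1) → ℂ) {i : ℕ} (hi : i < N) :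
    companion N q y ⟨i, by omega⟩ = y ⟨i + 1, by omega⟩ := by
  simp [companion, hi]

theorem companion_apply_last {N : ℕ} (q : ℕ → ℂ) (y : Fin (N + 1) → ℂ) :
    companion N q y ⟨N, by omega⟩ = -∑ j : Fin (N + 1), q j * y j := by
  simp [companion]

theorem companion_pow_apply_zero {N : ℕ} (q : ℕ → ℂ) : ∀ (i : ℕ) (hi : i < N + 1)
    (y : Fin (N + 1) → ℂ), (companion N q ^ i) y 0 = y ⟨i, hi⟩
  | 0, _, y => rfl
  | i + 1, hi, y => by
    rw [pow_succ, mul_apply_eq_comp, companion_pow_apply_zero q i (by omega),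
      companion_apply_of_lt q y (by omega)]

theorem companion_pow_succ_apply_zero {N : ℕ} (q : ℕ → ℂ) (y : Fin (N + 1) → ℂ) :
    (companion N q ^ (N + 1)) y 0 =
      -∑ j ∈ Finset.range (N + 1), q j * (companion N q ^ j) y 0 := by
  rw [pow_succ, mul_apply_eq_comp, companion_pow_apply_zero q N (by omega),
    companion_apply_last, Finset.sum_range]
  congr 1
  exact Finset.sum_congr rfl fun j _ => by rw [companion_pow_apply_zero q j j.2]

/-- The `k`-th derivative of the solution of `w^{(N+1)} + ∑_{j≤N} q_j w^{(j)} = 0` with the initial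
data `y`. -/
def modeSol (N : ℕ) (q : ℕ → ℂ) (y : Fin (N + 1) → ℂ) (k : ℕ) (t : ℝ) : ℂ :=
  (companion N q ^ k) (NormedSpace.exp (t • companion N q) y) 0

theorem modeSol_solvesODE (N : ℕ) (q : ℕ → ℂ) (y : Fin (N + 1) → ℂ) :
    SolvesODE (N + 1) q (modeSol N q y) where
  isJet k t := by
    have h1 : HasDerivAt (fun s : ℝ => NormedSpace.exp (s • companion N q))
        (companion N q * NormedSpace.exp (t • companion N q)) t :=
      hasDerivAt_exp_smul_const' (companion N q) t
    have h2 := ((ContinuousLinearMap.apply ℂ (Fin (N + 1) → ℂ) y).restrictScalars ℝ).hasFDerivAt.comp_hasDerivAt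
      t h1
    have h3 := ((companion N q ^ k).restrictScalars ℝ).hasFDerivAt.comp_hasDerivAt t h2
    have h4 := hasDerivAt_pi.1 h3 0
    refine h4.congr_deriv ?_
    rw [modeSol, pow_succ]
    rfl
  equation l t := by
    simp only [modeSol]
    rw [add_comm (N + 1) l]
    have : ∀ j, companion N q ^ (l + j) = companion N q ^ j * companion N q ^ l := fun j => by
      rw [← pow_add, Nat.add_comm l j]
    simp only [this, mul_apply_eq_comp]
    exact companion_pow_succ_apply_zero q _

theorem modeSol_zero {N : ℕ} (q : ℕ → ℂ) (y : Fin (N + 1) → ℂ) {k : ℕ} (hk : k < N + 1) :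
    modeSol N q y k 0 = y ⟨k, hk⟩ := by
  have h0 : (0 : ℝ) • companion N q = 0 := by ext; simp
  rw [modeSol, h0, NormedSpace.exp_zero, one_apply_eq_self,
    companion_pow_apply_zero q k hk]

theorem modeSol_add (N : ℕ) (q : ℕ → ℂ) (y y' : Fin (N + 1) → ℂ) (k : ℕ) (t : ℝ) :
    modeSol N q (y + y') k t = modeSol N q y k t + modeSol N q y' k t := by
  simp [modeSol]

theorem modeSol_smul (N : ℕ) (q : ℕ → ℂ) (a : ℂ) (y : Fin (N + 1) → ℂ) (k : ℕ) (t : ℝ) :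
    modeSol N q (a • y) k t = a * modeSol N q y k t := by
  simp [modeSol]

theorem modeSol_succ (N : ℕ) (q : ℕ → ℂ) (y : Fin (N + 1) → ℂ) (k : ℕ) (t : ℝ) :
    modeSol N q y (k + 1) t = modeSol N q (companion N q y) k t := by
  have h : companion N q * NormedSpace.exp (t • companion N q) =
      NormedSpace.exp (t • companion N q) * companion N q :=
    (hasDerivAt_exp_smul_const' (companion N q) t).unique
      (hasDerivAt_exp_smul_const (companion N q) t)
  rw [modeSol, modeSol, pow_succ, mul_apply_eq_comp, ← mul_apply_eq_comp
    (companion N q), h]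
  rfl

theorem continuous_companion {X : Type*} [TopologicalSpace X] (N : ℕ) {q : X → ℕ → ℂ}
    (hq : ∀ j, Continuous fun x => q x j) : Continuous fun x => companion N (q x) := by
  rw [continuous_clm_apply]
  refine fun y => continuous_pi fun i => ?_
  by_cases hi : (i : ℕ) < N
  · simp only [companion, ContinuousLinearMap.coe_pi', hi, dite_true]
    exact continuous_const
  · simp only [companion, ContinuousLinearMap.coe_pi', hi, dite_false]
    simp only [neg_apply, sum_apply, smul_apply, smul_eq_mul]
    exact continuous_neg.comp (continuous_finsetSum _ fun j _ => (hq j).mul continuous_const)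

theorem continuous_modeSol {X : Type*} [TopologicalSpace X] (N : ℕ) {q : X → ℕ → ℂ}
    (hq : ∀ j, Continuous fun x => q x j) (y : Fin (N + 1) → ℂ) (k : ℕ) :
    Continuous fun p : X × ℝ => modeSol N (q p.1) y k p.2 := by
  have h1 : Continuous fun p : X × ℝ => companion N (q p.1) :=
    (continuous_companion N hq).comp continuous_fst
  have h2 : Continuous fun p : X × ℝ => NormedSpace.exp (p.2 • companion N (q p.1)) :=
    letI := NormedAlgebra.restrictScalars ℚ ℂ ((Fin (N + 1) → ℂ) →L[ℂ] (Fin (N + 1) → ℂ))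
    NormedSpace.exp_continuous.comp (continuous_snd.smul h1)
  exact (continuous_apply 0).comp ((h1.pow k).clm_apply (h2.clm_apply continuous_const))

/-- The `k`-th derivative of the `j`-th fundamental solution: the data are `w^{(i)}(0) = δ_{ij}`. -/
def fundSol (N : ℕ) (q : ℕ → ℂ) (j k : ℕ) (t : ℝ) : ℂ :=
  modeSol N q (fun i => if (i : ℕ) = j then 1 else 0) k t

theorem fundSol_solvesODE (N : ℕ) (q : ℕ → ℂ) (j : ℕ) : SolvesODE (N + 1) q (fundSol N q j) :=
  modeSol_solvesODE N q _

theorem fundSol_zero {N : ℕ} (q : ℕ → ℂ) (j : ℕ) {k : ℕ} (hk : k < N + 1) :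
    fundSol N q j k 0 = if k = j then 1 else 0 :=
  modeSol_zero q _ hk

/-- Differentiation of a fundamental solution, solved for the one of lower index: the initial data
`e_{j+1}` of the jet are mapped by the companion operator to `e_j - q_{j+1} e_N`. -/
theorem fundSol_pred {N : ℕ} (q : ℕ → ℂ) {j : ℕ} (hj : j < N) (k : ℕ) (t : ℝ) :
    fundSol N q j k t = fundSol N q (j + 1) (k + 1) t + q (j + 1) * fundSol N q N k t := by
  rw [fundSol, fundSol, fundSol, modeSol_succ, ← modeSol_smul, ← modeSol_add]
  congr 1
  ext ⟨i, hi⟩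
  rw [Pi.add_apply, Pi.smul_apply, smul_eq_mul]
  rcases Nat.lt_or_ge i N with h | h
  · rw [companion_apply_of_lt q _ h]
    simp [h.ne]
  · obtain rfl : i = N := by omega
    rw [companion_apply_last, Finset.sum_eq_single ⟨j + 1, by omega⟩]
    · simp [hj.ne']
    · intro b _ hb
      have : (b : ℕ) ≠ j + 1 := fun h => hb (Fin.ext h)
      simp [this]
    · simp

/-- All fundamental solutions in terms of the last one: `fundSol N q (N - i)` arises by applying the
truncated operator `∂_t^i + q_N ∂_t^{i-1} + ⋯ + q_{N+1-i}`. -/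
theorem fundSol_sub {N : ℕ} (q : ℕ → ℂ) : ∀ (i : ℕ) (_ : i ≤ N) (k : ℕ) (t : ℝ),
    fundSol N q (N - i) k t = fundSol N q N (k + i) t +
      ∑ l ∈ Finset.range i, q (N + 1 - i + l) * fundSol N q N (k + l) t
  | 0, _, k, t => by simp
  | i + 1, hi, k, t => by
    rw [fundSol_pred q (by omega), show N - (i + 1) + 1 = N - i by omega,
      fundSol_sub q i (by omega), Finset.sum_range_succ', add_assoc, add_assoc]
    congr 1
    · congr 1; ring
    · congr 1
      · refine Finset.sum_congr rfl fun l _ => ?_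
        congr 2
        · omega
        · ring
      · congr 2; omega

theorem continuous_fundSol {X : Type*} [TopologicalSpace X] (N : ℕ) {q : X → ℕ → ℂ}
    (hq : ∀ j, Continuous fun x => q x j) (j k : ℕ) :
    Continuous fun p : X × ℝ => fundSol N (q p.1) j k p.2 :=
  continuous_modeSol N hq _ k

/-! ### Frequency dependence of the fundamental solutions -/

/-- Homogeneity of the coefficients, and their rate of convergence as the frequency tends to `0`. -/
theorem exists_coeff_csymbol_bound {n d : ℕ} {P : DiffOp n} (hP : P.IsHomogeneous d) :
    ∃ A : ℝ, 0 ≤ A ∧ ∀ (ω : EuclideanSpace ℝ (Fin n)) (r : ℝ), ‖ω‖ = 1 → 0 ≤ r → ∀ k,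
      ‖(P.csymbol fun i => Complex.I * r * ω i).coeff k‖ ≤ A * r ^ (d - k) ∧
      (r ≤ 1 → ‖(P.csymbol fun i => Complex.I * r * ω i).coeff k - (P.csymbol 0).coeff k‖ ≤
        A * r) := by
  obtain ⟨A, hA, h⟩ := exists_coeff_bound P
  refine ⟨A, hA, fun ω r hω hr k => ?_⟩
  have h1 : ‖(P.csymbol fun i => Complex.I * r * ω i).coeff k‖ ≤ A * r ^ (d - k) := by
    rw [DiffOp.coeff_csymbol_smul hP, norm_mul, norm_pow, norm_mul, Complex.norm_I, one_mul,
      Complex.norm_real, Real.norm_of_nonneg hr, mul_comm]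
    gcongr
    exact h ω hω k
  refine ⟨h1, fun hr1 => ?_⟩
  rcases lt_trichotomy k d with hk | rfl | hk
  · have h0 : (P.csymbol 0).coeff k = 0 := by
      have := DiffOp.coeff_csymbol_smul hP (0 : Fin n → ℂ) 0 k
      rw [zero_pow (by omega), zero_mul] at this
      simpa [Pi.zero_def] using this
    rw [h0, sub_zero]
    refine h1.trans ?_
    gcongr
    simpa using pow_le_pow_of_le_one hr hr1 (by omega : 1 ≤ d - k)
  · rw [DiffOp.coeff_csymbol_self hP, DiffOp.coeff_csymbol_self hP, sub_self, norm_zero]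
    positivity
  · rw [DiffOp.coeff_csymbol_eq_zero hP _ hk, DiffOp.coeff_csymbol_eq_zero hP _ hk, sub_self,
      norm_zero]
    positivity

/-- Bounds on all derivatives of the fundamental solutions, for `m = D + 2`. At low frequencies
there are `M = m - 1 - ε` light modes, and the solutions with `j ≥ M` behave like the one with
`j = M - 1 = D - ε`.

The operator `P₂` has order `m - 2 = M` if `ε = 1`. If `ε = 0` the two homogeneity assumptions are
contradictory unless `P₂ = 0`, and this is the case in which the theorem is used. -/
theorem exists_fundSol_bound {n D ε : ℕ} (hε : ε = 0 ∨ ε = 1) (hεD : ε ≤ D) {P P₁ P₂ : DiffOp n}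
    {c B : ℝ}
    (hP : P.IsHomogeneous (D + 2)) (hP1 : P.timeCoeff (D + 2) = 1)
    (hP₁ : P₁.IsHomogeneous (D + 1)) (ht : P₁.timeCoeff (D + 1) = c) (hc : 0 < c)
    (hP₂ : P₂.IsHomogeneous D) (hP₂' : P₂.IsHomogeneous (D + 1 - ε))
    (hroots : ∀ ω : EuclideanSpace ℝ (Fin n), ‖ω‖ = 1 →
      ∃ b : Fin (D + 1) → ℝ, (ω, b) ∈ rootSet P₁ c B)
    (hint : ∀ ω : EuclideanSpace ℝ (Fin n), ‖ω‖ = 1 →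
      StrictlyInterlace (P₁.symbol ω) (P.symbol ω))
    (hη : ∃ θ Θ : ℝ, 0 < θ ∧ 0 < Θ ∧ ∀ p ∈ rootSet (N := D + 1) P₁ c B, ∃ η : Fin (D + 1) → ℝ,
      (∀ i, ε * θ ≤ η i ∧ η i ≤ ε * Θ) ∧
      P₂.symbol p.1 = ∑ i, C (η i : ℂ) * nodalErase (fun i => (p.2 i : ℂ)) i)
    (hstable : ∃ σ₀ : ℝ, 0 < σ₀ ∧ ∀ σ < σ₀,
      StableFilter (1 + ε) (fun i => ((P + P₁ + P₂).csymbol 0).coeff (D + 1 - ε + i)) σ) :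
    ∃ (A : ℕ → ℝ) (σ : ℝ), (∀ k, 0 ≤ A k) ∧ 0 < σ ∧
      ∀ (ω : EuclideanSpace ℝ (Fin n)) (r : ℝ) (j k : ℕ) (t : ℝ),
      ‖ω‖ = 1 → 0 < r → j < D + 2 → 0 ≤ t →
      (1 ≤ r → ‖fundSol (D + 1) (fun j => ((P + P₁ + P₂).csymbol fun i =>
          Complex.I * r * ω i).coeff j) j k t‖ ≤ A k * (r ^ k * (r⁻¹ ^ j * Real.exp (-σ * t)))) ∧
      (r ≤ 1 → ‖fundSol (D + 1) (fun j => ((P + P₁ + P₂).csymbol fun i =>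
          Complex.I * r * ω i).coeff j) j k t‖ ≤
        A k * (r ^ k * r⁻¹ ^ min j (D - ε) * Real.exp (-(σ * r ^ 2) * t) + Real.exp (-σ * t))) := by
  obtain ⟨A₀, c₀, hA₀, hc₀, hcrude⟩ :=
    exists_crude_bound hε hP hP1 hP₁ ht hc hP₂ hroots hint hη
  obtain ⟨a, ha, hab⟩ := exists_coeff_csymbol_bound hP
  obtain ⟨a₁, ha₁, hab₁⟩ := exists_coeff_csymbol_bound hP₁
  obtain ⟨a₂, ha₂, hab₂⟩ := exists_coeff_csymbol_bound hP₂'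
  obtain ⟨σ₀, hσ₀, hst⟩ := hstable
  set Q := P + P₁ + P₂ with hQ
  set M := D + 1 - ε with hM
  set H : ℕ → ℂ := fun i => (Q.csymbol 0).coeff (M + i) with hH
  set σ := min (σ₀ / 2) c₀ with hσ
  have hσ0 : 0 < σ := by positivity
  have hstσ := hst σ ((min_le_left _ _).trans_lt (by linarith))
  have hQc : ∀ ζ k, (Q.csymbol ζ).coeff k =
      (P.csymbol ζ).coeff k + (P₁.csymbol ζ).coeff k + (P₂.csymbol ζ).coeff k := fun ζ k => by
    rw [hQ, DiffOp.csymbol_add, DiffOp.csymbol_add, coeff_add, coeff_add]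
  set α : ℝ := a + a₁ + a₂ with hα
  have hα0 : 0 ≤ α := by positivity
  have hHh : H (1 + ε) = 1 := by
    simp only [hH]
    rw [show M + (1 + ε) = D + 2 by omega, hQc, DiffOp.coeff_csymbol_self hP,
      DiffOp.coeff_csymbol_eq_zero hP₁ _ (by omega), DiffOp.coeff_csymbol_eq_zero hP₂' _ (by omega),
      hP1, add_zero, add_zero]
  -- the coefficients have the size `r^(m - j)` at high and `r^(M - j)` at low frequencies
  have hqhigh : ∀ (ω : EuclideanSpace ℝ (Fin n)) (r : ℝ), ‖ω‖ = 1 → 1 ≤ r → ∀ j < D + 1 + 1,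
      ‖(Q.csymbol fun i => Complex.I * r * ω i).coeff j‖ ≤ α * r ^ (D + 1 + 1 - j) := by
    intro ω r hω hr j hj
    have hr0 : 0 ≤ r := zero_le_one.trans hr
    rw [hQc]
    refine norm_add₃_le.trans ?_
    rw [hα, add_mul, add_mul]
    gcongr ?_ + ?_ + ?_
    · exact (hab ω r hω hr0 j).1
    · refine (hab₁ ω r hω hr0 j).1.trans ?_
      gcongr 2
      omega
    · refine (hab₂ ω r hω hr0 j).1.trans ?_
      gcongr 2
      omega
  have hqlow : ∀ (ω : EuclideanSpace ℝ (Fin n)) (r : ℝ), ‖ω‖ = 1 → 0 ≤ r → r ≤ 1 → ∀ j,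
      ‖(Q.csymbol fun i => Complex.I * r * ω i).coeff j‖ ≤ α * r ^ (M - j) := by
    intro ω r hω hr0 hr j
    rw [hQc]
    refine norm_add₃_le.trans ?_
    rw [hα, add_mul, add_mul]
    gcongr ?_ + ?_ + ?_
    · refine (hab ω r hω hr0 j).1.trans (mul_le_mul_of_nonneg_left ?_ ha)
      exact pow_le_pow_of_le_one hr0 hr (by omega)
    · refine (hab₁ ω r hω hr0 j).1.trans (mul_le_mul_of_nonneg_left ?_ ha₁)
      exact pow_le_pow_of_le_one hr0 hr (by omega)
    · exact (hab₂ ω r hω hr0 j).1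
  have hqH : ∀ (ω : EuclideanSpace ℝ (Fin n)) (r : ℝ), ‖ω‖ = 1 → 0 ≤ r → r ≤ 1 → ∀ i,
      ‖(Q.csymbol fun i => Complex.I * r * ω i).coeff (M + i) - H i‖ ≤ α * r := by
    intro ω r hω hr0 hr i
    simp only [hH, hQc]
    have e : ∀ x y z x' y' z' : ℂ, x + y + z - (x' + y' + z') = (x - x') + (y - y') + (z - z') :=
      fun _ _ _ _ _ _ => by ring
    rw [e]
    refine norm_add₃_le.trans ?_
    rw [hα, add_mul, add_mul]
    gcongr ?_ + ?_ + ?_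
    · exact (hab ω r hω hr0 _).2 hr
    · exact (hab₁ ω r hω hr0 _).2 hr
    · exact (hab₂ ω r hω hr0 _).2 hr
  -- the bootstrap at low frequencies, which is not yet sharp for the solutions with `j ≥ M`
  have hmM : D + 2 - M = 1 + ε := by omega
  choose Cl hCl0 hCl using fun N => exists_low_bound (m := D + 2) (M := M) (by omega) (H := H)
    (by rw [hmM]; exact hHh) hα0 (by rw [hmM]; exact hstσ) hA₀.le N
  have hlow : ∀ (ω : EuclideanSpace ℝ (Fin n)) (r : ℝ), ‖ω‖ = 1 → 0 < r → r ≤ 1 → ∀ j < D + 2,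
      ∀ k t, 0 ≤ t → ‖fundSol (D + 1) (fun j => (Q.csymbol fun i =>
        Complex.I * r * ω i).coeff j) j k t‖ ≤
        Cl k k * (r ^ k * r⁻¹ ^ min j M * Real.exp (-(σ * r ^ 2) * t) + Real.exp (-σ * t)) := by
    intro ω r hω hr hr1 j hj k t ht
    have hr2 : r ^ 2 ≤ 1 := pow_le_one₀ hr.le hr1
    have h := hCl k (fun j => (Q.csymbol fun i => Complex.I * r * ω i).coeff j) r
      (r⁻¹ ^ min j M) (σ * r ^ 2)
      (fundSol (D + 1) (fun j => (Q.csymbol fun i => Complex.I * r * ω i).coeff j) j)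
      hr.le hr1 (by positivity) ?_ (by nlinarith) (fun j _ => hqlow ω r hω hr.le hr1 j)
      (fun i _ => hqH ω r hω hr.le hr1 i) (fundSol_solvesODE _ _ _) ?_ k t ht
    · rw [min_eq_left (by omega : k ≤ M + k)] at h
      refine h.trans_eq ?_
      ring
    · calc r⁻¹ ^ min j M * r ^ M = r⁻¹ ^ min j M * r ^ min j M * r ^ (M - min j M) := by
            rw [mul_assoc, ← pow_add, Nat.add_sub_cancel' (min_le_right _ _)]
        _ ≤ 1 := by
          rw [mul_comm (r⁻¹ ^ _), pow_mul_inv_pow hr.ne', one_mul]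
          exact pow_le_one₀ hr.le hr1
    · intro k hk t ht
      refine ((hcrude ω r _ j hω hr hj (fundSol_solvesODE _ _ _)
        (fun k hk => fundSol_zero _ _ hk) k hk t ht).2 hr1).trans ?_
      refine mul_le_mul_of_nonneg_left (le_add_of_le_of_nonneg ?_ (Real.exp_nonneg _)) hA₀.le
      have : σ ≤ c₀ := min_le_right _ _
      gcongr
  -- the additional gain for the last solution requires bounds on all of its derivatives at `t = 0`
  set Ct : ℕ → ℝ := fun k => max (Cl k k) (1 * (1 + (D + 2 : ℕ) * α) ^ k) with hCt
  have hCt0 : ∀ k, 0 ≤ Ct k := fun k => le_max_of_le_left (hCl0 k k)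
  obtain ⟨Cg, hCg0, hCg⟩ := exists_low_gain hHh hα0 hstσ hCt0
  have hgain : ∀ (ω : EuclideanSpace ℝ (Fin n)) (r : ℝ), ‖ω‖ = 1 → 0 < r → r ≤ 1 →
      ∀ k t, 0 ≤ t → ‖fundSol (D + 1) (fun j => (Q.csymbol fun i =>
        Complex.I * r * ω i).coeff j) (D + 1) k t‖ ≤
        Cg k * (r ^ k * r⁻¹ ^ (D - ε) * Real.exp (-(σ * r ^ 2) * t) + Real.exp (-σ * t)) := by
    intro ω r hω hr hr1 k t ht
    have hr2 : r ^ 2 ≤ 1 := pow_le_one₀ hr.le hr1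
    have hgr : ∀ k, r ^ (k + 1) * r⁻¹ ^ M = r ^ k * r⁻¹ ^ (D - ε) := fun k => by
      rw [show M = D - ε + 1 by omega, pow_succ, pow_succ]
      have : r * r⁻¹ = 1 := mul_inv_cancel₀ hr.ne'
      linear_combination r ^ k * r⁻¹ ^ (D - ε) * this
    have h := hCg (fun i => (Q.csymbol fun i => Complex.I * r * ω i).coeff (M + i)) r (r⁻¹ ^ M)
      (σ * r ^ 2)
      (fundSol (D + 1) (fun j => (Q.csymbol fun i => Complex.I * r * ω i).coeff j) (D + 1))
      (fundSol (D + 1) (fun j => (Q.csymbol fun i => Complex.I * r * ω i).coeff j) (D - ε))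
      hr.le hr1 (by positivity) (by nlinarith) (fun i _ => hqH ω r hω hr.le hr1 i)
      (fundSol_solvesODE _ _ _).isJet ?_ ?_ ?_ ?_ k t ht
    · rwa [hgr] at h
    · intro k t
      rw [show D - ε = D + 1 - (1 + ε) by omega, fundSol_sub _ _ (by omega)]
      congr 1
      refine Finset.sum_congr rfl fun i _ => ?_
      congr 2
      omega
    · intro k
      have := (fundSol_solvesODE (D + 1) (fun j => (Q.csymbol fun i =>
        Complex.I * r * ω i).coeff j) (D + 1)).norm_le_low (t := 0) (G := 0) (G' := 1) (C := 1)
        hα0 zero_le_one hr.le hr1 le_rfl zero_le_one (fun j _ => hqlow ω r hω hr.le hr1 j)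
        (fun k hk => by
          rw [fundSol_zero _ _ hk]
          split_ifs <;> simp) k
      refine this.trans ?_
      rw [mul_zero, zero_add, mul_one]
      exact le_max_right _ _
    · intro k t ht
      refine (hlow ω r hω hr hr1 (D + 1) (by omega) k t ht).trans ?_
      rw [min_eq_right (by omega)]
      gcongr
      exact le_max_left _ _
    · intro k t ht
      refine (hlow ω r hω hr hr1 (D - ε) (by omega) k t ht).trans ?_
      rw [min_eq_left (by omega), hgr]
      gcongr
      exact le_max_left _ _
  set Cm : ℕ → ℝ := fun k => Cg (k + 1) + α * Cg k with hCm
  have hCm0 : ∀ k, 0 ≤ Cm k := fun k => by have := hCg0 k; have := hCg0 (k + 1); positivity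
  refine ⟨fun k => max (A₀ * (1 + (D + 2 : ℕ) * α) ^ k) (max (Cl k k) (max (Cg k) (Cm k))), σ,
    fun k => le_max_of_le_left (by positivity), hσ0, ?_⟩
  intro ω r j k t hω hr hj ht
  constructor
  · intro hr1
    have h := (fundSol_solvesODE (D + 1) (fun j => (Q.csymbol fun i =>
        Complex.I * r * ω i).coeff j) j).norm_le_high (t := t) (G := r⁻¹ ^ j * Real.exp (-c₀ * t))
        hα0 hA₀.le hr.le (by positivity) (hqhigh ω r hω hr1)
        (fun k hk => (hcrude ω r _ j hω hr hj (fundSol_solvesODE _ _ _)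
          (fun k hk => fundSol_zero _ _ hk) k hk t ht).1 hr1) k
    refine h.trans ?_
    have : σ ≤ c₀ := min_le_right _ _
    gcongr
    exact le_max_left _ _
  · intro hr1
    rcases le_or_gt j (D - ε) with h1 | h1
    · refine (hlow ω r hω hr hr1 j hj k t ht).trans ?_
      rw [min_eq_left (by omega), min_eq_left h1]
      gcongr
      exact (le_max_left _ _).trans (le_max_right _ _)
    · rw [min_eq_right h1.le]
      rcases eq_or_lt_of_le (Nat.lt_succ_iff.1 hj) with rfl | h2
      · refine (hgain ω r hω hr hr1 k t ht).trans ?_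
        gcongr
        exact (le_max_left _ _).trans ((le_max_right _ _).trans (le_max_right _ _))
      · have h3 : j = D + 1 - 1 := by omega
        have hcm : Cm k ≤ max (A₀ * (1 + (D + 2 : ℕ) * α) ^ k)
            (max (Cl k k) (max (Cg k) (Cm k))) :=
          (le_max_right _ _).trans ((le_max_right _ _).trans (le_max_right _ _))
        refine le_trans ?_ (mul_le_mul_of_nonneg_right hcm (by positivity))
        rw [h3, fundSol_sub _ 1 (by omega)]
        simp only [Finset.sum_range_one, add_zero]
        refine (norm_add_le _ _).trans ?_
        rw [norm_mul, hCm, add_mul, mul_assoc α]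
        refine add_le_add ((hgain ω r hω hr hr1 (k + 1) t ht).trans ?_)
          (mul_le_mul ?_ (hgain ω r hω hr hr1 k t ht) (norm_nonneg _) hα0)
        · have := hCg0 (k + 1)
          have : r ^ (k + 1) ≤ r ^ k := pow_le_pow_of_le_one hr.le hr1 (by omega)
          gcongr
        · refine (hqlow ω r hω hr.le hr1 _).trans ?_
          exact mul_le_of_le_one_right hα0 (pow_le_one₀ hr.le hr1)

/-! ### The Fourier transform on `L²` -/

theorem ae_eq_of_forall_schwartz {n : ℕ} {f g : EuclideanSpace ℝ (Fin n) → ℂ}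
    (hf : LocallyIntegrable f) (hg : LocallyIntegrable g)
    (h : ∀ φ : 𝓢(EuclideanSpace ℝ (Fin n), ℂ), ∫ x, φ x * f x = ∫ x, φ x * g x) : f =ᵐ[volume] g := by
  refine ae_eq_of_integral_contDiff_smul_eq hf hg fun χ hχ hχc => ?_
  have h1 : HasCompactSupport (Complex.ofRealCLM ∘ χ) := hχc.comp_left rfl
  have h2 : ContDiff ℝ ((⊤ : ℕ∞) : WithTop ℕ∞) (Complex.ofRealCLM ∘ χ) := by fun_prop
  simpa using h (h1.toSchwartzMap h2)

theorem L2.locallyIntegrable {n : ℕ} (f : L2 n) : LocallyIntegrable f :=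
  (Lp.memLp f).locallyIntegrable one_le_two

theorem L2.coe_apply {n : ℕ} (f : L2 n) (φ : 𝓢(EuclideanSpace ℝ (Fin n), ℂ)) :
    (f : 𝓢'(EuclideanSpace ℝ (Fin n), ℂ)) φ = ∫ ξ, φ ξ * f ξ :=
  Lp.toTemperedDistribution_apply f φ

theorem L2.coe_apply_fourier {n : ℕ} (f : L2 n) (φ : 𝓢(EuclideanSpace ℝ (Fin n), ℂ)) :
    (f : 𝓢'(EuclideanSpace ℝ (Fin n), ℂ)) (𝓕 φ) = ∫ ξ, φ ξ * (𝓕 f : L2 n) ξ := by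
  rw [← TemperedDistribution.fourier_apply, Lp.fourier_toTemperedDistribution_eq, L2.coe_apply]

/-- The wave vector `2πiξ`: the Fourier symbol of `∂_x`. -/
def waveVec {n : ℕ} (ξ : EuclideanSpace ℝ (Fin n)) (i : Fin n) : ℂ :=
  2 * Real.pi * Complex.I * (ξ i : ℂ)

theorem hasTemperateGrowth_waveVec {n : ℕ} (i : Fin n) :
    (fun ξ : EuclideanSpace ℝ (Fin n) => waveVec ξ i).HasTemperateGrowth := by
  have h : (fun ξ : EuclideanSpace ℝ (Fin n) => waveVec ξ i) =
      fun ξ => (2 * Real.pi * Complex.I) * Complex.ofRealCLM (inner ℝ (EuclideanSpace.single i 1) ξ) := by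
    ext ξ
    simp [waveVec, EuclideanSpace.inner_single_left]
  rw [h]
  fun_prop

/-- The relation `𝓕 S = g 𝓕 T` for a function `g` of temperate growth. It is stated with test
functions of the form `𝓕 φ`, so that for `T ∈ L²` the right hand side becomes an integral over `𝓕 T`. -/
def IsFourierMul {n : ℕ} (g : EuclideanSpace ℝ (Fin n) → ℂ)
    (T S : 𝓢'(EuclideanSpace ℝ (Fin n), ℂ)) : Prop :=
  g.HasTemperateGrowth ∧ ∀ φ, S (𝓕 φ) = T (𝓕 (SchwartzMap.smulLeftCLM ℂ g φ))

theorem isFourierMul_one {n : ℕ} (T : 𝓢'(EuclideanSpace ℝ (Fin n), ℂ)) :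
    IsFourierMul (fun _ => 1) T T := by
  refine ⟨by fun_prop, fun φ => ?_⟩
  congr 2
  ext ξ
  rw [SchwartzMap.smulLeftCLM_apply_apply (by fun_prop), one_smul]

theorem IsFourierMul.lineDeriv {n : ℕ} {g : EuclideanSpace ℝ (Fin n) → ℂ}
    {T S : 𝓢'(EuclideanSpace ℝ (Fin n), ℂ)} (h : IsFourierMul g T S) (i : Fin n) :
    IsFourierMul (fun ξ => waveVec ξ i * g ξ) T (∂_{EuclideanSpace.single i (1 : ℝ)} S) := by
  have hw := hasTemperateGrowth_waveVec i
  have hg := h.1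
  have hm : (fun ξ => waveVec ξ i * g ξ).HasTemperateGrowth := hw.mul hg
  refine ⟨hm, fun φ => ?_⟩
  have h1 : (∂_{EuclideanSpace.single i (1 : ℝ)} S) (𝓕 φ) =
      S (𝓕 (SchwartzMap.smulLeftCLM ℂ (fun ξ => waveVec ξ i) φ)) := by
    rw [TemperedDistribution.lineDerivOp_apply_apply, SchwartzMap.lineDerivOp_fourier_eq]
    have : ((inner ℝ · (EuclideanSpace.single i (1 : ℝ))) :
      EuclideanSpace ℝ (Fin n) → ℝ).HasTemperateGrowth := by fun_prop
    rw [← FourierTransform.fourier_neg]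
    congr 2
    ext ξ
    rw [SchwartzMap.smulLeftCLM_apply_apply hw]
    rw [neg_smul, neg_neg, smul_apply, SchwartzMap.smulLeftCLM_apply_apply this]
    simp [waveVec, EuclideanSpace.inner_single_right, mul_assoc]
  rw [h1, h.2]
  congr 2
  ext ξ
  rw [SchwartzMap.smulLeftCLM_apply_apply hg, SchwartzMap.smulLeftCLM_apply_apply hw,
    SchwartzMap.smulLeftCLM_apply_apply hm]
  simp only [smul_eq_mul]
  ring

theorem IsFourierMul.iterate {n : ℕ} {g : EuclideanSpace ℝ (Fin n) → ℂ}
    {T S : 𝓢'(EuclideanSpace ℝ (Fin n), ℂ)} (h : IsFourierMul g T S) (i : Fin n) (k : ℕ) :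
    IsFourierMul (fun ξ => waveVec ξ i ^ k * g ξ) T
      ((fun R : 𝓢'(EuclideanSpace ℝ (Fin n), ℂ) => ∂_{EuclideanSpace.single i (1 : ℝ)} R)^[k] S) := by
  induction k with
  | zero => simpa using h
  | succ k ih =>
    rw [Function.iterate_succ_apply']
    convert ih.lineDeriv i using 2
    ring

theorem isFourierMul_spaceDeriv {n : ℕ} (α : Fin n → ℕ) (T : 𝓢'(EuclideanSpace ℝ (Fin n), ℂ)) :
    IsFourierMul (fun ξ => ∏ i, waveVec ξ i ^ α i) T (spaceDeriv α T) := by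
  have h : ∀ l : List (Fin n), IsFourierMul (fun ξ => (l.map fun i => waveVec ξ i ^ α i).prod) T
      (l.foldr (fun i S => (fun R : 𝓢'(EuclideanSpace ℝ (Fin n), ℂ) =>
        ∂_{EuclideanSpace.single i (1 : ℝ)} R)^[α i] S) T) := by
    intro l
    induction l with
    | nil => simpa using isFourierMul_one T
    | cons i l ih => simpa using ih.iterate i (α i)
  have h1 := h (List.finRange n)
  simp only [← List.ofFn_eq_map, List.prod_ofFn] at h1
  exact h1

theorem spaceDeriv_coe_apply_fourier {n : ℕ} (α : Fin n → ℕ) (f : L2 n)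
    (φ : 𝓢(EuclideanSpace ℝ (Fin n), ℂ)) :
    spaceDeriv α (f : 𝓢'(EuclideanSpace ℝ (Fin n), ℂ)) (𝓕 φ) =
      ∫ ξ, (∏ i, waveVec ξ i ^ α i) * φ ξ * (𝓕 f : L2 n) ξ := by
  obtain ⟨h1, h2⟩ := isFourierMul_spaceDeriv α (f : 𝓢'(EuclideanSpace ℝ (Fin n), ℂ))
  rw [h2, L2.coe_apply_fourier]
  simp only [SchwartzMap.smulLeftCLM_apply_apply h1, smul_eq_mul]

/-- Mathlib describes `MemSobolev` by tempered distributions; here the distribution is identified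
with a function. -/
theorem memLp_fourier_of_memSobolev {n : ℕ} {s : ℝ} {f : L2 n}
    (h : TemperedDistribution.MemSobolev s 2 (f : 𝓢'(EuclideanSpace ℝ (Fin n), ℂ))) :
    MemLp (fun ξ => (((1 + ‖ξ‖ ^ 2) ^ (s / 2) : ℝ) : ℂ) * (𝓕 f : L2 n) ξ) 2 := by
  obtain ⟨f', hf'⟩ := TemperedDistribution.memSobolev_iff_exists_smulLeftCLM_fourier.1 h
  have hw : (fun ξ : EuclideanSpace ℝ (Fin n) =>
      (((1 + ‖ξ‖ ^ 2) ^ (s / 2) : ℝ) : ℂ)).HasTemperateGrowth := by fun_prop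
  have hcont : Continuous fun ξ : EuclideanSpace ℝ (Fin n) => (((1 + ‖ξ‖ ^ 2) ^ (s / 2) : ℝ) : ℂ) :=
    hw.1.continuous
  refine (memLp_congr_ae ?_).1 (Lp.memLp f')
  refine ae_eq_of_forall_schwartz (L2.locallyIntegrable f')
    ((L2.locallyIntegrable _).continuous_smul hcont) fun φ => ?_
  rw [← L2.coe_apply, ← hf', TemperedDistribution.smulLeftCLM_apply_apply,
    Lp.fourier_toTemperedDistribution_eq, L2.coe_apply]
  refine integral_congr_ae (Filter.Eventually.of_forall fun ξ => ?_)
  simp only [SchwartzMap.smulLeftCLM_apply_apply hw, smul_eq_mul]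
  ring

/-- On `L¹ ∩ L²`, the Fourier transform of Plancherel is given by the Fourier integral. -/
theorem fourier_ae_eq_of_integrable {n : ℕ} (f : L2 n) (hf : Integrable f) :
    (𝓕 f : L2 n) =ᵐ[volume] 𝓕 (f : EuclideanSpace ℝ (Fin n) → ℂ) := by
  have hcont : Continuous (𝓕 (f : EuclideanSpace ℝ (Fin n) → ℂ)) :=
    VectorFourier.fourierIntegral_continuous Real.continuous_fourierChar continuous_inner hf
  refine ae_eq_of_forall_schwartz (L2.locallyIntegrable _) hcont.locallyIntegrable fun φ => ?_
  rw [← L2.coe_apply_fourier, L2.coe_apply]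
  have := VectorFourier.integral_fourierIntegral_smul_eq_flip (μ := volume) (ν := volume)
    (L := innerₗ (EuclideanSpace ℝ (Fin n))) Real.continuous_fourierChar continuous_inner
    φ.integrable hf
  rw [flip_innerₗ] at this
  exact this

theorem enorm_fourier_le_ae {n : ℕ} (f : L2 n) (hf : Integrable f) :
    ∀ᵐ ξ, ‖(𝓕 f : L2 n) ξ‖ₑ ≤ eLpNorm f 1 volume := by
  filter_upwards [fourier_ae_eq_of_integrable f hf] with ξ hξ
  rw [hξ, eLpNorm_one_eq_lintegral_enorm]
  have h1 : ‖𝓕 (f : EuclideanSpace ℝ (Fin n) → ℂ) ξ‖ ≤ ∫ x, ‖f x‖ :=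
    VectorFourier.norm_fourierIntegral_le_integral_norm _ _ _ _ _
  rw [integral_norm_eq_lintegral_enorm hf.1] at h1
  rw [← ofReal_norm]
  exact ENNReal.ofReal_le_of_le_toReal h1

/-! ### Smooth curves given by a chain of derivatives -/

/-- A sequence of curves, each the derivative of the previous one, consists of the iterated
derivatives of the first one. -/
theorem iteratedDerivWithin_of_chain {F : Type*} [NormedAddCommGroup F] [NormedSpace ℝ F]
    {G : ℕ → ℝ → F} {N : ℕ}
    (hd : ∀ k < N, ∀ t ∈ Ici (0 : ℝ), HasDerivWithinAt (G k) (G (k + 1) t) (Ici 0) t) {k : ℕ}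
    (hk : k ≤ N) : EqOn (iteratedDerivWithin k (G 0) (Ici 0)) (G k) (Ici 0) := by
  induction k with
  | zero => intro t _; rw [iteratedDerivWithin_zero]
  | succ k ih =>
    intro t ht
    rw [iteratedDerivWithin_succ]
    have := ih (by omega)
    rw [derivWithin_congr this (this ht)]
    exact (hd k (by omega) t ht).derivWithin (uniqueDiffOn_Ici 0 t ht)

theorem contDiffOn_of_chain {F : Type*} [NormedAddCommGroup F] [NormedSpace ℝ F]
    {G : ℕ → ℝ → F} {N : ℕ}
    (hd : ∀ k < N, ∀ t ∈ Ici (0 : ℝ), HasDerivWithinAt (G k) (G (k + 1) t) (Ici 0) t)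
    (hc : ContinuousOn (G N) (Ici 0)) : ContDiffOn ℝ (N : ℕ∞) (G 0) (Ici 0) := by
  refine contDiffOn_of_continuousOn_differentiableOn_deriv (fun k hk => ?_) fun k hk => ?_
  · have hk' : k ≤ N := by exact_mod_cast hk
    refine ContinuousOn.congr ?_ (iteratedDerivWithin_of_chain hd hk')
    rcases eq_or_lt_of_le hk' with rfl | h
    · exact hc
    · exact fun t ht => (hd k h t ht).continuousWithinAt
  · have hk' : k < N := by exact_mod_cast hk
    exact DifferentiableOn.congr (fun t ht => (hd k hk' t ht).differentiableWithinAt)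
      (iteratedDerivWithin_of_chain hd hk'.le)

theorem hasDerivWithinAt_iteratedDerivWithin {F : Type*} [NormedAddCommGroup F] [NormedSpace ℝ F]
    {u : ℝ → F} {N : ℕ} (hu : ContDiffOn ℝ (N : ℕ∞) u (Ici 0)) {k : ℕ} (hk : k < N) {t : ℝ}
    (ht : 0 ≤ t) : HasDerivWithinAt (iteratedDerivWithin k u (Ici 0))
      (iteratedDerivWithin (k + 1) u (Ici 0) t) (Ici 0) t := by
  rw [iteratedDerivWithin_succ]
  exact (hu.differentiableOn_iteratedDerivWithin (by exact_mod_cast hk) (uniqueDiffOn_Ici 0) t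
    ht).hasDerivWithinAt

/-! ### Curves in `L²` given by pointwise formulas -/

/-- The class in `L²` of a function, and `0` if the function is not square integrable. -/
def toL2 {n : ℕ} (f : EuclideanSpace ℝ (Fin n) → ℂ) : L2 n :=
  open Classical in if h : MemLp f 2 volume then h.toLp f else 0

theorem coeFn_toL2 {n : ℕ} {f : EuclideanSpace ℝ (Fin n) → ℂ} (h : MemLp f 2) :
    toL2 f =ᵐ[volume] f := by
  rw [toL2, dif_pos h]
  exact h.coeFn_toLp

theorem toL2_eq_of_ae {n : ℕ} {f : EuclideanSpace ℝ (Fin n) → ℂ} {g : L2 n}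
    (h : f =ᵐ[volume] g) : toL2 f = g :=
  Lp.ext ((coeFn_toL2 ((memLp_congr_ae h).2 (Lp.memLp g))).trans h)

theorem smul_sub_toL2 {n : ℕ} {f g : EuclideanSpace ℝ (Fin n) → ℂ} (hf : MemLp f 2)
    (hg : MemLp g 2) (a : ℝ) :
    a • (toL2 f - toL2 g) = toL2 fun ξ => a • (f ξ - g ξ) := by
  symm
  refine toL2_eq_of_ae ?_
  filter_upwards [coeFn_toL2 hf, coeFn_toL2 hg, Lp.coeFn_smul a (toL2 f - toL2 g),
    Lp.coeFn_sub (toL2 f) (toL2 g)] with ξ h1 h2 h3 h4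
  rw [h3, Pi.smul_apply, h4, Pi.sub_apply, h1, h2]

theorem norm_toL2_sub {n : ℕ} {f g : EuclideanSpace ℝ (Fin n) → ℂ} (hf : MemLp f 2)
    (hg : MemLp g 2) : ‖toL2 f - toL2 g‖ₑ = eLpNorm (fun ξ => f ξ - g ξ) 2 := by
  rw [Lp.enorm_def]
  refine eLpNorm_congr_ae ?_
  filter_upwards [coeFn_toL2 hf, coeFn_toL2 hg, Lp.coeFn_sub (toL2 f) (toL2 g)] with ξ h1 h2 h4
  rw [h4, Pi.sub_apply, h1, h2]

/-- Dominated convergence in `L²`. -/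
theorem tendsto_toL2 {n : ℕ} {ι : Type*} {l : Filter ι} [l.IsCountablyGenerated]
    {F : ι → EuclideanSpace ℝ (Fin n) → ℂ} {f : EuclideanSpace ℝ (Fin n) → ℂ}
    {b : EuclideanSpace ℝ (Fin n) → ℝ} (hF : ∀ᶠ i in l, MemLp (F i) 2) (hf : MemLp f 2)
    (hb : MemLp b 2) (hFb : ∀ᶠ i in l, ∀ ξ, ‖F i ξ‖ ≤ b ξ) (hfb : ∀ ξ, ‖f ξ‖ ≤ b ξ)
    (hlim : ∀ ξ, Filter.Tendsto (fun i => F i ξ) l (nhds (f ξ))) :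
    Filter.Tendsto (fun i => toL2 (F i)) l (nhds (toL2 f)) := by
  rw [tendsto_iff_edist_tendsto_0]
  have h1 : Filter.Tendsto (fun i => ∫⁻ ξ, ‖F i ξ - f ξ‖ₑ ^ (2 : ℝ)) l
      (nhds (∫⁻ _ξ : EuclideanSpace ℝ (Fin n), 0)) := by
    refine tendsto_lintegral_filter_of_dominated_convergence'
      (fun ξ => ENNReal.ofReal (2 * b ξ) ^ (2 : ℝ)) ?_ ?_ ?_ ?_
    · filter_upwards [hF] with i hi
      exact (hi.1.sub hf.1).enorm.pow_const _
    · filter_upwards [hFb] with i hi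
      refine Filter.Eventually.of_forall fun ξ => ?_
      gcongr
      rw [← ofReal_norm]
      refine ENNReal.ofReal_le_ofReal ((norm_sub_le _ _).trans ?_)
      linarith [hi ξ, hfb ξ]
    · have h2 := (hb.const_mul 2).2
      rw [eLpNorm_lt_top_iff_lintegral_rpow_enorm_lt_top (by norm_num) (by norm_num)] at h2
      refine ne_of_lt (lt_of_le_of_lt (lintegral_mono fun ξ => ?_) h2)
      rw [ENNReal.toReal_ofNat]
      gcongr
      exact Real.ofReal_le_enorm _
    · refine Filter.Eventually.of_forall fun ξ => ?_
      have h3 := ((hlim ξ).sub_const (f ξ)).enorm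
      rw [sub_self, enorm_zero] at h3
      have h4 := h3.ennrpow_const 2
      rwa [ENNReal.zero_rpow_of_pos two_pos] at h4
  rw [lintegral_zero] at h1
  have h5 := h1.ennrpow_const (1 / 2)
  rw [ENNReal.zero_rpow_of_pos (by norm_num)] at h5
  refine h5.congr' ?_
  filter_upwards [hF] with i hi
  rw [edist_eq_enorm_sub, norm_toL2_sub hi hf,
    eLpNorm_eq_lintegral_rpow_enorm_toReal (by norm_num) (by norm_num), ENNReal.toReal_ofNat]

theorem hasDerivWithinAt_toL2 {n : ℕ} {g g' : ℝ → EuclideanSpace ℝ (Fin n) → ℂ}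
    {b : EuclideanSpace ℝ (Fin n) → ℝ} {t : ℝ} (ht : 0 ≤ t) (hg : ∀ s, 0 ≤ s → MemLp (g s) 2)
    (hg' : MemLp (g' t) 2) (hb : MemLp b 2)
    (hd : ∀ ξ s, HasDerivAt (fun s => g s ξ) (g' s ξ) s)
    (hbound : ∀ ξ s, 0 ≤ s → s ≤ t + 1 → ‖g' s ξ‖ ≤ b ξ) :
    HasDerivWithinAt (fun s => toL2 (g s)) (toL2 (g' t)) (Ici 0) t := by
  rw [hasDerivWithinAt_iff_tendsto_slope]
  have hmem : ∀ᶠ s in nhdsWithin t (Ici 0 \ {t}), s ∈ Icc 0 (t + 1) ∧ s ≠ t := by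
    filter_upwards [self_mem_nhdsWithin, mem_nhdsWithin_of_mem_nhds
      (Iio_mem_nhds (by linarith : t < t + 1))] with s h1 h2
    exact ⟨⟨h1.1, le_of_lt h2⟩, fun h => h1.2 h⟩
  refine (tendsto_toL2 (F := fun s ξ => (s - t)⁻¹ • (g s ξ - g t ξ)) (b := b) ?_ hg' hb ?_ ?_
    ?_).congr' ?_
  · filter_upwards [hmem] with s hs
    exact ((hg s hs.1.1).sub (hg t ht)).const_smul ((s - t)⁻¹ : ℝ)
  · filter_upwards [hmem] with s hs
    intro ξ
    have h1 := Convex.norm_image_sub_le_of_norm_hasDerivWithin_le (f := fun s => g s ξ)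
      (f' := fun s => g' s ξ) (C := b ξ) (s := Icc 0 (t + 1))
      (fun x _ => (hd ξ x).hasDerivWithinAt) (fun x hx => hbound ξ x hx.1 hx.2) (convex_Icc _ _)
      (x := t) (y := s) ⟨ht, by linarith⟩ hs.1
    have h2 : 0 < ‖s - t‖ := norm_pos_iff.2 (sub_ne_zero.2 hs.2)
    rw [norm_smul, norm_inv, inv_mul_le_iff₀ h2]
    linarith
  · exact fun ξ => hbound ξ t ht (by linarith)
  · intro ξ
    have := hasDerivAt_iff_tendsto_slope.1 (hd ξ t)
    exact this.mono_left (nhdsWithin_mono _ fun s hs => hs.2)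
  · filter_upwards [hmem] with s hs
    rw [slope_def_module, smul_sub_toL2 (hg s hs.1.1) (hg t ht)]

theorem continuousOn_toL2 {n : ℕ} {g : ℝ → EuclideanSpace ℝ (Fin n) → ℂ}
    {b : ℝ → EuclideanSpace ℝ (Fin n) → ℝ} (hg : ∀ s, 0 ≤ s → MemLp (g s) 2)
    (hb : ∀ T, MemLp (b T) 2) (hc : ∀ ξ, Continuous fun s => g s ξ)
    (hbound : ∀ T ξ s, 0 ≤ s → s ≤ T → ‖g s ξ‖ ≤ b T ξ) :
    ContinuousOn (fun s => toL2 (g s)) (Ici 0) := by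
  intro t ht
  refine tendsto_toL2 (b := b (t + 1)) ?_ (hg t ht) (hb _) ?_ ?_ ?_
  · filter_upwards [self_mem_nhdsWithin] with s hs using hg s hs
  · filter_upwards [self_mem_nhdsWithin, mem_nhdsWithin_of_mem_nhds
      (Iio_mem_nhds (by linarith : t < t + 1))] with s h1 h2
    exact fun ξ => hbound _ ξ s h1 (le_of_lt h2)
  · exact fun ξ => hbound _ ξ t ht (by linarith)
  · exact fun ξ => ((hc ξ).tendsto t).mono_left nhdsWithin_le_nhds

/-! ### Weights -/

theorem rpow_le_mul_rpow {y z c : ℝ} (hy : 0 < y) (hc : 1 ≤ c) (h1 : y ≤ c * z) (h2 : z ≤ c * y)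
    (p : ℝ) : y ^ p ≤ c ^ |p| * z ^ p := by
  have hc0 : 0 < c := by linarith
  have hz : 0 < z := pos_of_mul_pos_right (hy.trans_le h1) hc0.le
  rcases le_total 0 p with hp | hp
  · rw [abs_of_nonneg hp, ← Real.mul_rpow hc0.le hz.le]
    exact Real.rpow_le_rpow hy.le h1 hp
  · rw [abs_of_nonpos hp, Real.rpow_neg hc0.le, ← Real.inv_rpow hc0.le,
      ← Real.mul_rpow (by positivity) hz.le]
    refine Real.rpow_le_rpow_of_nonpos (by positivity) ?_ hp
    rw [inv_mul_le_iff₀ hc0]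
    exact h2

/-- The length `|2πξ|` of the wave vector. -/
def rad {n : ℕ} (ξ : EuclideanSpace ℝ (Fin n)) : ℝ := 2 * Real.pi * ‖ξ‖

theorem rad_nonneg {n : ℕ} (ξ : EuclideanSpace ℝ (Fin n)) : 0 ≤ rad ξ := by
  unfold rad; positivity

theorem continuous_rad {n : ℕ} : Continuous (rad : EuclideanSpace ℝ (Fin n) → ℝ) := by
  unfold rad; fun_prop

/-- The weight `(1 + |2πξ|²)^{s/2}`. -/
def bracket {n : ℕ} (s : ℝ) (ξ : EuclideanSpace ℝ (Fin n)) : ℝ := (1 + rad ξ ^ 2) ^ (s / 2)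

theorem bracket_pos {n : ℕ} (s : ℝ) (ξ : EuclideanSpace ℝ (Fin n)) : 0 < bracket s ξ := by
  unfold bracket; positivity

theorem bracket_mono {n : ℕ} {s s' : ℝ} (h : s ≤ s') (ξ : EuclideanSpace ℝ (Fin n)) :
    bracket s ξ ≤ bracket s' ξ := by
  unfold bracket
  refine Real.rpow_le_rpow_of_exponent_le ?_ (by linarith)
  nlinarith [sq_nonneg (rad ξ)]

theorem bracket_add {n : ℕ} (s s' : ℝ) (ξ : EuclideanSpace ℝ (Fin n)) :
    bracket (s + s') ξ = bracket s ξ * bracket s' ξ := by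
  unfold bracket
  rw [add_div, Real.rpow_add (by positivity)]

theorem bracket_zero {n : ℕ} (ξ : EuclideanSpace ℝ (Fin n)) : bracket 0 ξ = 1 := by
  simp [bracket]

theorem continuous_bracket {n : ℕ} (s : ℝ) :
    Continuous (bracket s : EuclideanSpace ℝ (Fin n) → ℝ) := by
  unfold bracket
  refine Continuous.rpow_const (by have := continuous_rad (n := n); fun_prop) fun ξ => Or.inl ?_
  positivity

theorem rpow_rad_le_bracket {n : ℕ} {ξ : EuclideanSpace ℝ (Fin n)} (h : 1 ≤ rad ξ) (x : ℝ) :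
    rad ξ ^ x ≤ 2 ^ |x / 2| * bracket x ξ := by
  have h1 : (rad ξ) ^ x = (rad ξ ^ 2) ^ (x / 2) := by
    rw [← Real.rpow_natCast, ← Real.rpow_mul (rad_nonneg ξ)]
    congr 1; push_cast; ring
  rw [h1]
  exact rpow_le_mul_rpow (by positivity) one_le_two (by nlinarith) (by nlinarith) _

theorem one_le_bracket {n : ℕ} {ξ : EuclideanSpace ℝ (Fin n)} (h : rad ξ ≤ 1) (x : ℝ) :
    1 ≤ 2 ^ |x / 2| * bracket x ξ := by
  have h0 := rad_nonneg ξ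
  have := rpow_le_mul_rpow (y := 1) (z := 1 + rad ξ ^ 2) (c := 2) one_pos one_le_two
    (by nlinarith) (by nlinarith) (x / 2)
  rwa [Real.one_rpow] at this

/-- The Sobolev weights for the two normalizations of the frequency are equivalent. -/
theorem bracket_le_mul {n : ℕ} (ξ : EuclideanSpace ℝ (Fin n)) (x : ℝ) :
    bracket x ξ ≤ 64 ^ |x / 2| * (1 + ‖ξ‖ ^ 2) ^ (x / 2) := by
  have h1 := Real.pi_gt_three
  have h2 := Real.pi_lt_four
  have h3 : rad ξ ^ 2 = 4 * Real.pi ^ 2 * ‖ξ‖ ^ 2 := by unfold rad; ring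
  have h4 := sq_nonneg ‖ξ‖
  have h5 : Real.pi ^ 2 ≤ 16 := by nlinarith
  have h6 : 9 ≤ Real.pi ^ 2 := by nlinarith
  refine rpow_le_mul_rpow (by positivity) (by norm_num) ?_ ?_ _
  · rw [h3]; nlinarith
  · rw [h3]; nlinarith

theorem sobolevNorm_eq {n : ℕ} (s : ℝ) (f : L2 n) :
    sobolevNorm s f = eLpNorm (fun ξ => (bracket s ξ : ℂ) * (𝓕 f : L2 n) ξ) 2 volume := rfl

theorem memLp_bracket_mul_fourier {n : ℕ} {s : ℝ} {f : L2 n}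
    (h : TemperedDistribution.MemSobolev s 2 (f : 𝓢'(EuclideanSpace ℝ (Fin n), ℂ))) :
    MemLp (fun ξ => (bracket s ξ : ℂ) * (𝓕 f : L2 n) ξ) 2 := by
  refine ((memLp_fourier_of_memSobolev h).const_mul ((64 ^ |s / 2| : ℝ) : ℂ)).of_le ?_ ?_
  · exact (Complex.continuous_ofReal.comp (continuous_bracket s)).aestronglyMeasurable.mul
      (Lp.aestronglyMeasurable _)
  · refine Filter.Eventually.of_forall fun ξ => ?_
    rw [norm_mul, norm_mul, norm_mul, ← mul_assoc, Complex.norm_real, Complex.norm_real,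
      Complex.norm_real, Real.norm_of_nonneg (bracket_pos s ξ).le, Real.norm_of_nonneg
      (by positivity), Real.norm_of_nonneg (by positivity)]
    gcongr
    exact bracket_le_mul ξ s

/-! ### The evolution on the Fourier side -/

/-- The `k`-th time derivative of the `j`-th fundamental solution of `Q(∂_t, 2πiξ) w = 0`. -/
def kern {n : ℕ} (Q : DiffOp n) (N j k : ℕ) (t : ℝ) (ξ : EuclideanSpace ℝ (Fin n)) : ℂ :=
  fundSol N (fun l => (Q.csymbol (waveVec ξ)).coeff l) j k t

theorem continuous_waveVec {n : ℕ} :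
    Continuous (waveVec : EuclideanSpace ℝ (Fin n) → Fin n → ℂ) := by
  unfold waveVec; fun_prop

theorem continuous_kern_uncurry {n : ℕ} (Q : DiffOp n) (N j k : ℕ) :
    Continuous fun p : EuclideanSpace ℝ (Fin n) × ℝ => kern Q N j k p.2 p.1 :=
  continuous_fundSol N (q := fun (ξ : EuclideanSpace ℝ (Fin n)) l => (Q.csymbol (waveVec ξ)).coeff l)
    (fun l => (continuous_coeff_csymbol Q l).comp continuous_waveVec) j k

theorem continuous_kern {n : ℕ} (Q : DiffOp n) (N j k : ℕ) (t : ℝ) :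
    Continuous (kern Q N j k t) :=
  (continuous_kern_uncurry Q N j k).comp (f := fun ξ => (ξ, t)) (by fun_prop)

/-- Bounds for the fundamental solutions: at high frequencies they are those of a strictly
hyperbolic equation, with exponential decay in time; at low frequencies the decay is that of the
heat kernel. -/
structure KernelBound {n : ℕ} (Q : DiffOp n) (N L : ℕ) (A : ℕ → ℝ) (σ : ℝ) : Prop where
  nonneg : ∀ k, 0 ≤ A k
  pos : 0 < σ
  high : ∀ ξ j k t, ξ ≠ 0 → j < N + 1 → 0 ≤ t → 1 ≤ rad ξ →
    ‖kern Q N j k t ξ‖ ≤ A k * (rad ξ ^ k * ((rad ξ)⁻¹ ^ j * Real.exp (-σ * t)))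
  low : ∀ ξ j k t, ξ ≠ 0 → j < N + 1 → 0 ≤ t → rad ξ ≤ 1 →
    ‖kern Q N j k t ξ‖ ≤ A k * (rad ξ ^ k * (rad ξ)⁻¹ ^ min j L *
      Real.exp (-(σ * rad ξ ^ 2) * t) + Real.exp (-σ * t))

theorem KernelBound.high_rpow {n : ℕ} {Q : DiffOp n} {N L : ℕ} {A : ℕ → ℝ} {σ : ℝ}
    (h : KernelBound Q N L A σ) {ξ : EuclideanSpace ℝ (Fin n)} {j k : ℕ} {t : ℝ} (hj : j < N + 1)
    (ht : 0 ≤ t) (hr : 1 ≤ rad ξ) :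
    ‖kern Q N j k t ξ‖ ≤ A k * (rad ξ ^ ((k : ℝ) - j) * Real.exp (-σ * t)) := by
  have hr0 : 0 < rad ξ := by linarith
  have hξ : ξ ≠ 0 := by
    rintro rfl
    simp [rad] at hr0
  refine (h.high ξ j k t hξ hj ht hr).trans_eq ?_
  rw [Real.rpow_sub hr0, Real.rpow_natCast, Real.rpow_natCast, inv_pow]
  ring

/-- On bounded time intervals, the bounds hold uniformly up to the frequency `0`, where the kernels
are continuous. -/
theorem KernelBound.exists_growth {n : ℕ} {Q : DiffOp n} {N L : ℕ} {A : ℕ → ℝ} {σ : ℝ}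
    (h : KernelBound Q N L A σ) (k : ℕ) (T : ℝ) : ∃ B : ℝ, 0 ≤ B ∧ ∀ j < N + 1, ∀ t, 0 ≤ t → t ≤ T →
      ∀ ξ, ‖kern Q N j k t ξ‖ ≤ B * bracket ((k : ℝ) - j) ξ := by
  have hcomp : IsCompact ((Metric.closedBall (0 : EuclideanSpace ℝ (Fin n)) 1) ×ˢ Icc 0 T) :=
    (isCompact_closedBall _ _).prod isCompact_Icc
  have h1 : ∀ j, ∃ B, ∀ p ∈ (Metric.closedBall (0 : EuclideanSpace ℝ (Fin n)) 1) ×ˢ Icc 0 T,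
      ‖kern Q N j k p.2 p.1‖ ≤ B := fun j =>
    hcomp.exists_bound_of_continuousOn (continuous_kern_uncurry Q N j k).continuousOn
  choose B hB using h1
  have hA := h.nonneg k
  refine ⟨∑ j ∈ Finset.range (N + 1), (max 0 (B j) + A k) * 2 ^ |((k : ℝ) - j) / 2|,
    by positivity, ?_⟩
  intro j hj t ht hT ξ
  have key : ‖kern Q N j k t ξ‖ ≤
      (max 0 (B j) + A k) * 2 ^ |((k : ℝ) - j) / 2| * bracket ((k : ℝ) - j) ξ := by
    have hb := bracket_pos ((k : ℝ) - j) ξ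
    have hm : 0 ≤ max 0 (B j) := le_max_left _ _
    rcases le_total 1 (rad ξ) with hr | hr
    · calc ‖kern Q N j k t ξ‖ ≤ A k * (rad ξ ^ ((k : ℝ) - j) * Real.exp (-σ * t)) :=
            h.high_rpow hj ht hr
        _ ≤ A k * (2 ^ |((k : ℝ) - j) / 2| * bracket ((k : ℝ) - j) ξ * 1) := by
            gcongr
            · exact rpow_rad_le_bracket hr _
            · rw [Real.exp_le_one_iff]
              have := h.pos
              nlinarith
        _ ≤ (max 0 (B j) + A k) * (2 ^ |((k : ℝ) - j) / 2| * bracket ((k : ℝ) - j) ξ * 1) := by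
            gcongr
            linarith
        _ = _ := by ring
    · have hξ : ξ ∈ Metric.closedBall (0 : EuclideanSpace ℝ (Fin n)) 1 := by
        rw [mem_closedBall_zero_iff]
        have := Real.pi_gt_three
        have h3 : rad ξ = 2 * Real.pi * ‖ξ‖ := rfl
        nlinarith [norm_nonneg ξ]
      calc ‖kern Q N j k t ξ‖ ≤ B j := hB j (ξ, t) ⟨hξ, ht, hT⟩
        _ ≤ max 0 (B j) + A k := by linarith [le_max_right 0 (B j)]
        _ ≤ (max 0 (B j) + A k) * (2 ^ |((k : ℝ) - j) / 2| * bracket ((k : ℝ) - j) ξ) :=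
            le_mul_of_one_le_right (by positivity) (one_le_bracket hr _)
        _ = _ := by ring
  refine key.trans ?_
  have hb := bracket_pos ((k : ℝ) - j) ξ
  gcongr
  exact Finset.single_le_sum
    (f := fun j : ℕ => (max 0 (B j) + A k) * (2 : ℝ) ^ |((k : ℝ) - j) / 2|)
    (fun i _ => by positivity) (Finset.mem_range.2 hj)

/-- The `k`-th time derivative of the solution with the (Fourier transformed) data `a`. -/
def evol {n : ℕ} (Q : DiffOp n) (N : ℕ) (a : ℕ → EuclideanSpace ℝ (Fin n) → ℂ) (k : ℕ) (t : ℝ)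
    (ξ : EuclideanSpace ℝ (Fin n)) : ℂ :=
  ∑ j ∈ Finset.range (N + 1), kern Q N j k t ξ * a j ξ

theorem hasDerivAt_evol {n : ℕ} (Q : DiffOp n) (N : ℕ) (a : ℕ → EuclideanSpace ℝ (Fin n) → ℂ)
    (k : ℕ) (t : ℝ) (ξ : EuclideanSpace ℝ (Fin n)) :
    HasDerivAt (fun s => evol Q N a k s ξ) (evol Q N a (k + 1) t ξ) t :=
  HasDerivAt.fun_sum fun j _ => ((fundSol_solvesODE N _ j).isJet k t).mul_const (a j ξ)

theorem evol_zero {n : ℕ} (Q : DiffOp n) {N : ℕ} (a : ℕ → EuclideanSpace ℝ (Fin n) → ℂ) {k : ℕ}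
    (hk : k < N + 1) : evol Q N a k 0 = a k := by
  ext ξ
  rw [evol, Finset.sum_eq_single_of_mem k (Finset.mem_range.2 hk)]
  · rw [kern, fundSol_zero _ _ hk, if_pos rfl, one_mul]
  · intro j _ hj
    rw [kern, fundSol_zero _ _ hk, if_neg hj.symm, zero_mul]

/-- The evolution solves the equation for each frequency. -/
theorem jetEval_evol {n : ℕ} (Q : DiffOp n) (N : ℕ) (a : ℕ → EuclideanSpace ℝ (Fin n) → ℂ) (t : ℝ)
    (ξ : EuclideanSpace ℝ (Fin n)) (hdeg : (Q.csymbol (waveVec ξ)).natDegree ≤ N + 1)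
    (hcoeff : (Q.csymbol (waveVec ξ)).coeff (N + 1) = 1) :
    ∑ d ∈ Q.support, MvPolynomial.coeff d Q * (∏ i, waveVec ξ i ^ d (some i)) *
      evol Q N a (d none) t ξ = 0 := by
  have h : ∀ j, ∑ d ∈ Q.support, MvPolynomial.coeff d Q * (∏ i, waveVec ξ i ^ d (some i)) *
      kern Q N j (d none) t ξ = 0 := by
    intro j
    have := (fundSol_solvesODE N (fun l => (Q.csymbol (waveVec ξ)).coeff l) j).jetEval_eq_zero
      hdeg hcoeff t
    rw [DiffOp.csymbol_eq_sum, map_sum] at this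
    rw [← this]
    refine Finset.sum_congr rfl fun d _ => ?_
    rw [jetEval_C_mul, jetEval_X_pow, kern, DiffOp.csymbol_eq_sum]
  simp only [evol, Finset.mul_sum]
  rw [Finset.sum_comm]
  refine Finset.sum_eq_zero fun j _ => ?_
  simp only [← mul_assoc]
  rw [← Finset.sum_mul, h, zero_mul]

/-- Data of order `κ`: `(1 + |2πξ|²)^{(κ-j)/2} a_j ∈ L²` for `j ≤ N`. -/
def IsDataOfOrder {n : ℕ} (N : ℕ) (κ : ℝ) (a : ℕ → EuclideanSpace ℝ (Fin n) → ℂ) : Prop :=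
  ∀ j < N + 1, AEStronglyMeasurable (a j) volume ∧
    MemLp (fun ξ => (bracket (κ - j) ξ : ℂ) * a j ξ) 2

/-- Weights shift the order of the data, so that more derivatives of the evolution are in `L²`. -/
theorem IsDataOfOrder.weight {n N : ℕ} {κ : ℝ} {a : ℕ → EuclideanSpace ℝ (Fin n) → ℂ}
    (h : IsDataOfOrder N κ a) (μ : ℝ) :
    IsDataOfOrder N (κ + μ) fun j ξ => (bracket (-μ) ξ : ℂ) * a j ξ := by
  refine fun j hj => ⟨(Complex.continuous_ofReal.comp
    (continuous_bracket _)).aestronglyMeasurable.mul (h j hj).1, ?_⟩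
  convert (h j hj).2 using 2 with ξ
  rw [← mul_assoc, ← Complex.ofReal_mul, ← bracket_add]
  congr 3
  ring

/-- A square integrable majorant of the evolution. -/
def majorant {n : ℕ} (N : ℕ) (κ B : ℝ) (a : ℕ → EuclideanSpace ℝ (Fin n) → ℂ)
    (ξ : EuclideanSpace ℝ (Fin n)) : ℝ :=
  ∑ j ∈ Finset.range (N + 1), B * ‖(bracket (κ - j) ξ : ℂ) * a j ξ‖

theorem IsDataOfOrder.memLp_majorant {n N : ℕ} {κ : ℝ} {a : ℕ → EuclideanSpace ℝ (Fin n) → ℂ}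
    (h : IsDataOfOrder N κ a) (B : ℝ) : MemLp (majorant N κ B a) 2 :=
  memLp_finsetSum _ fun j hj => ((h j (Finset.mem_range.1 hj)).2.norm).const_mul B

theorem norm_evol_le {n N k : ℕ} {Q : DiffOp n} {κ B t : ℝ} (hB : 0 ≤ B) (hk : (k : ℝ) ≤ κ)
    {ξ : EuclideanSpace ℝ (Fin n)}
    (hK : ∀ j < N + 1, ‖kern Q N j k t ξ‖ ≤ B * bracket ((k : ℝ) - j) ξ)
    (a : ℕ → EuclideanSpace ℝ (Fin n) → ℂ) : ‖evol Q N a k t ξ‖ ≤ majorant N κ B a ξ := by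
  refine norm_sum_le_of_le _ fun j hj => ?_
  rw [norm_mul, norm_mul, Complex.norm_real, Real.norm_of_nonneg (bracket_pos _ _).le, ← mul_assoc]
  refine mul_le_mul_of_nonneg_right ((hK j (Finset.mem_range.1 hj)).trans ?_) (norm_nonneg _)
  exact mul_le_mul_of_nonneg_left (bracket_mono (by linarith) _) hB

theorem aestronglyMeasurable_evol {n N : ℕ} {κ : ℝ} {a : ℕ → EuclideanSpace ℝ (Fin n) → ℂ}
    (h : IsDataOfOrder N κ a) (Q : DiffOp n) (k : ℕ) (t : ℝ) :
    AEStronglyMeasurable (evol Q N a k t) volume :=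
  Finset.aestronglyMeasurable_fun_sum _ fun j hj =>
    (continuous_kern Q N j k t).aestronglyMeasurable.mul (h j (Finset.mem_range.1 hj)).1

section Evolution

variable {n : ℕ} {Q : DiffOp n} {N L : ℕ} {A : ℕ → ℝ} {σ κ : ℝ}
  {a : ℕ → EuclideanSpace ℝ (Fin n) → ℂ}

theorem KernelBound.memLp_evol (hK : KernelBound Q N L A σ) (h : IsDataOfOrder N κ a) {k : ℕ}
    (hk : (k : ℝ) ≤ κ) {t : ℝ} (ht : 0 ≤ t) : MemLp (evol Q N a k t) 2 := by
  obtain ⟨B, hB, hKB⟩ := hK.exists_growth k t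
  refine (h.memLp_majorant B).mono (aestronglyMeasurable_evol h Q k t)
    (Filter.Eventually.of_forall fun ξ => ?_)
  exact (norm_evol_le hB hk (fun j hj => hKB j hj t ht le_rfl ξ) a).trans (Real.le_norm_self _)

theorem KernelBound.hasDerivWithinAt_evol (hK : KernelBound Q N L A σ) (h : IsDataOfOrder N κ a)
    {k : ℕ} (hk : ((k + 1 : ℕ) : ℝ) ≤ κ) {t : ℝ} (ht : 0 ≤ t) :
    HasDerivWithinAt (fun s => toL2 (evol Q N a k s)) (toL2 (evol Q N a (k + 1) t)) (Ici 0) t := by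
  obtain ⟨B, hB, hKB⟩ := hK.exists_growth (k + 1) (t + 1)
  refine hasDerivWithinAt_toL2 (g' := evol Q N a (k + 1)) ht (fun s hs => hK.memLp_evol h ?_ hs)
    (hK.memLp_evol h hk ht) (h.memLp_majorant B) (fun ξ s => hasDerivAt_evol Q N a k s ξ)
    fun ξ s hs hst => norm_evol_le hB hk (fun j hj => hKB j hj s hs hst ξ) a
  push_cast at hk
  linarith

theorem KernelBound.continuousOn_evol (hK : KernelBound Q N L A σ) (h : IsDataOfOrder N κ a)
    {k : ℕ} (hk : (k : ℝ) ≤ κ) : ContinuousOn (fun s => toL2 (evol Q N a k s)) (Ici 0) := by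
  choose B hB hKB using hK.exists_growth k
  exact continuousOn_toL2 (fun s hs => hK.memLp_evol h hk hs) (fun T => h.memLp_majorant (B T))
    (fun ξ => continuous_iff_continuousAt.2 fun s => (hasDerivAt_evol Q N a k s ξ).continuousAt)
    fun T ξ s hs hT => norm_evol_le (hB T) hk (fun j hj => hKB T j hj s hs hT ξ) a

end Evolution

/-- The pairing of `f ∈ L²` with a Schwartz function. -/
def pairing {n : ℕ} (φ : 𝓢(EuclideanSpace ℝ (Fin n), ℂ)) : L2 n →L[ℂ] ℂ :=
  (PointwiseConvergenceCLM.evalCLM (RingHom.id ℂ) ℂ φ) ∘L (Lp.toTemperedDistributionCLM ℂ volume 2)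

theorem pairing_apply {n : ℕ} (φ : 𝓢(EuclideanSpace ℝ (Fin n), ℂ)) (f : L2 n) :
    pairing φ f = ∫ ξ, φ ξ * f ξ := L2.coe_apply f φ

theorem pairing_toL2 {n : ℕ} (φ : 𝓢(EuclideanSpace ℝ (Fin n), ℂ))
    {f : EuclideanSpace ℝ (Fin n) → ℂ} (hf : MemLp f 2) :
    pairing φ (toL2 f) = ∫ ξ, φ ξ * f ξ := by
  rw [pairing_apply]
  refine integral_congr_ae ?_
  filter_upwards [coeFn_toL2 hf] with ξ h
  rw [h]

theorem hasTemperateGrowth_bracket {n : ℕ} (M : ℕ) :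
    (fun ξ : EuclideanSpace ℝ (Fin n) => (bracket (2 * M : ℕ) ξ : ℂ)).HasTemperateGrowth := by
  have : (fun ξ : EuclideanSpace ℝ (Fin n) => (bracket (2 * M : ℕ) ξ : ℂ)) =
      fun ξ => ((((1 + (2 * Real.pi) ^ 2 * ‖ξ‖ ^ 2) ^ M : ℝ)) : ℂ) := by
    ext ξ
    rw [bracket, show (((2 * M : ℕ) : ℝ) / 2) = (M : ℕ) by push_cast; ring, Real.rpow_natCast, rad,
      mul_pow]
  rw [this]
  fun_prop

section Evolution

variable {n : ℕ} {Q : DiffOp n} {N L : ℕ} {A : ℕ → ℝ} {σ κ : ℝ}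
  {a : ℕ → EuclideanSpace ℝ (Fin n) → ℂ}

theorem evol_weight (Q : DiffOp n) (N k : ℕ) (t μ : ℝ) (ξ : EuclideanSpace ℝ (Fin n)) :
    (bracket μ ξ : ℂ) * evol Q N (fun j ξ => (bracket (-μ) ξ : ℂ) * a j ξ) k t ξ =
      evol Q N a k t ξ := by
  have h : (bracket μ ξ : ℂ) * (bracket (-μ) ξ : ℂ) = 1 := by
    rw [← Complex.ofReal_mul, ← bracket_add, add_neg_cancel, bracket_zero, Complex.ofReal_one]
  rw [evol, evol, Finset.mul_sum]
  refine Finset.sum_congr rfl fun j _ => ?_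
  linear_combination (kern Q N j k t ξ * a j ξ) * h

/-- The pairing of the evolution with a Schwartz function is smooth, and the pairings of the
derivatives make sense as integrals. -/
theorem KernelBound.pairing_evol (hK : KernelBound Q N L A σ) (h : IsDataOfOrder N κ a)
    (φ : 𝓢(EuclideanSpace ℝ (Fin n), ℂ)) (k : ℕ) {t : ℝ} (ht : 0 ≤ t) :
    Integrable (fun ξ => φ ξ * evol Q N a k t ξ) ∧
    HasDerivWithinAt (fun s => ∫ ξ, φ ξ * evol Q N a k s ξ) (∫ ξ, φ ξ * evol Q N a (k + 1) t ξ)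
      (Ici 0) t := by
  obtain ⟨M, hM⟩ := exists_nat_ge ((k : ℝ) + 1 - κ)
  have hM2 : ((k + 1 : ℕ) : ℝ) ≤ κ + (2 * M : ℕ) := by
    push_cast
    have : (0 : ℝ) ≤ M := Nat.cast_nonneg M
    linarith
  have hM1 : (k : ℝ) ≤ κ + (2 * M : ℕ) := by push_cast at hM2 ⊢; linarith
  have hw := h.weight ((2 * M : ℕ) : ℝ)
  set φ' := SchwartzMap.smulLeftCLM ℂ (fun ξ : EuclideanSpace ℝ (Fin n) =>
    (bracket (2 * M : ℕ) ξ : ℂ)) φ with hφ'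
  have hφ'ξ : ∀ ξ, φ' ξ = (bracket (2 * M : ℕ) ξ : ℂ) * φ ξ := fun ξ =>
    SchwartzMap.smulLeftCLM_apply_apply (hasTemperateGrowth_bracket M) φ ξ
  have hpt : ∀ k t ξ, φ ξ * evol Q N a k t ξ = φ' ξ *
      evol Q N (fun j ξ => (bracket (-(2 * M : ℕ)) ξ : ℂ) * a j ξ) k t ξ := fun k t ξ => by
    rw [hφ'ξ, ← evol_weight Q N k t (2 * M : ℕ) ξ]
    ring
  simp only [hpt]
  refine ⟨?_, ?_⟩
  · exact (φ'.memLp 2 volume).integrable_mul (hK.memLp_evol hw hM1 ht)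
  · have h1 := ((pairing φ').restrictScalars ℝ).hasFDerivAt.comp_hasDerivWithinAt t
      (hK.hasDerivWithinAt_evol hw hM2 ht)
    refine (h1.congr (fun s hs => ?_) ?_).congr_deriv ?_
    · exact (pairing_toL2 φ' (hK.memLp_evol hw hM1 hs)).symm
    · exact (pairing_toL2 φ' (hK.memLp_evol hw hM1 ht)).symm
    · exact pairing_toL2 φ' (hK.memLp_evol hw hM2 ht)

end Evolution

/-! ### Existence for the Cauchy problem -/

/-- The solution of the Cauchy problem, given by the Fourier multipliers `kern`. -/
def solution {n : ℕ} (Q : DiffOp n) (N : ℕ) (u₀ : ℕ → L2 n) (t : ℝ) : L2 n :=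
  𝓕⁻ (toL2 (evol Q N (fun j => (𝓕 (u₀ j) : L2 n)) 0 t))

theorem isDataOfOrder_of_admissibleData {n N : ℕ} {s₀ q : ℝ} {u₀ : ℕ → L2 n}
    (h : AdmissibleData (N + 1) s₀ q u₀) :
    IsDataOfOrder N s₀ fun j => (𝓕 (u₀ j) : L2 n) := fun j hj =>
  ⟨Lp.aestronglyMeasurable _, memLp_bracket_mul_fourier (h j hj).1⟩

section Existence

variable {n : ℕ} {Q : DiffOp n} {N L : ℕ} {A : ℕ → ℝ} {σ κ : ℝ} {u₀ : ℕ → L2 n}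

/-- Derivatives in time are computed for each frequency. -/
theorem KernelBound.solution_chain (hK : KernelBound Q N L A σ)
    (h : IsDataOfOrder N κ fun j => (𝓕 (u₀ j) : L2 n)) {k : ℕ} (hk : (k : ℝ) ≤ κ) :
    ContDiffOn ℝ (k : ℕ∞) (solution Q N u₀) (Ici 0) ∧ ∀ t, 0 ≤ t →
      timeDeriv k (solution Q N u₀) t =
        𝓕⁻ (toL2 (evol Q N (fun j => (𝓕 (u₀ j) : L2 n)) k t)) := by
  set G : ℕ → ℝ → L2 n := fun k t => 𝓕⁻ (toL2 (evol Q N (fun j => (𝓕 (u₀ j) : L2 n)) k t)) with hG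
  have hd : ∀ l < k, ∀ t ∈ Ici (0 : ℝ), HasDerivWithinAt (G l) (G (l + 1) t) (Ici 0) t := by
    intro l hl t ht
    refine ((FourierTransform.fourierInvCLM ℂ (L2 n)).restrictScalars
      ℝ).hasFDerivAt.comp_hasDerivWithinAt t (hK.hasDerivWithinAt_evol h ?_ ht)
    refine le_trans ?_ hk
    exact_mod_cast hl
  have hc : ContinuousOn (G k) (Ici 0) :=
    (FourierTransform.fourierInvCLM ℂ (L2 n)).continuous.comp_continuousOn (hK.continuousOn_evol h hk)
  exact ⟨contDiffOn_of_chain hd hc, fun t ht => iteratedDerivWithin_of_chain hd le_rfl ht⟩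

theorem KernelBound.spaceDeriv_solution (hK : KernelBound Q N L A σ)
    (h : IsDataOfOrder N κ fun j => (𝓕 (u₀ j) : L2 n)) (hκ : 0 ≤ κ) (α : Fin n → ℕ)
    (φ : 𝓢(EuclideanSpace ℝ (Fin n), ℂ)) {t : ℝ} (ht : 0 ≤ t) :
    spaceDeriv α (solution Q N u₀ t : 𝓢'(EuclideanSpace ℝ (Fin n), ℂ)) (𝓕 φ) =
      ∫ ξ, (∏ i, waveVec ξ i ^ α i) * φ ξ * evol Q N (fun j => (𝓕 (u₀ j) : L2 n)) 0 t ξ := by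
  rw [spaceDeriv_coe_apply_fourier, solution, FourierTransform.fourier_fourierInv_eq]
  refine integral_congr_ae ?_
  filter_upwards [coeFn_toL2 (hK.memLp_evol h (k := 0) (by simpa using hκ) ht)] with ξ hξ
  rw [hξ]

theorem hasTemperateGrowth_prod_waveVec {n : ℕ} (α : Fin n → ℕ) :
    (fun ξ : EuclideanSpace ℝ (Fin n) => ∏ i, waveVec ξ i ^ α i).HasTemperateGrowth :=
  (isFourierMul_spaceDeriv α 0).1

theorem KernelBound.iteratedDeriv_spaceDeriv_solution (hK : KernelBound Q N L A σ)
    (h : IsDataOfOrder N κ fun j => (𝓕 (u₀ j) : L2 n)) (hκ : 0 ≤ κ) (α : Fin n → ℕ)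
    (φ : 𝓢(EuclideanSpace ℝ (Fin n), ℂ)) (k : ℕ) :
    ContDiffOn ℝ (k : ℕ∞) (fun τ => spaceDeriv α
        (solution Q N u₀ τ : 𝓢'(EuclideanSpace ℝ (Fin n), ℂ)) (𝓕 φ)) (Ici 0) ∧
    ∀ t, 0 ≤ t → Integrable (fun ξ => (∏ i, waveVec ξ i ^ α i) * φ ξ *
        evol Q N (fun j => (𝓕 (u₀ j) : L2 n)) k t ξ) ∧
      iteratedDerivWithin k (fun τ => spaceDeriv α
        (solution Q N u₀ τ : 𝓢'(EuclideanSpace ℝ (Fin n), ℂ)) (𝓕 φ)) (Ici 0) t =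
      ∫ ξ, (∏ i, waveVec ξ i ^ α i) * φ ξ * evol Q N (fun j => (𝓕 (u₀ j) : L2 n)) k t ξ := by
  have hg := hasTemperateGrowth_prod_waveVec α
  set φ' := SchwartzMap.smulLeftCLM ℂ
    (fun ξ : EuclideanSpace ℝ (Fin n) => ∏ i, waveVec ξ i ^ α i) φ with hφ'
  have hφ'ξ : ∀ ξ, (∏ i, waveVec ξ i ^ α i) * φ ξ = φ' ξ := fun ξ =>
    (SchwartzMap.smulLeftCLM_apply_apply hg φ ξ).symm
  have h0 : EqOn (fun τ => spaceDeriv α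
      (solution Q N u₀ τ : 𝓢'(EuclideanSpace ℝ (Fin n), ℂ)) (𝓕 φ))
      (fun τ => ∫ ξ, φ' ξ * evol Q N (fun j => (𝓕 (u₀ j) : L2 n)) 0 τ ξ) (Ici 0) := by
    intro t ht
    simp only [hK.spaceDeriv_solution h hκ α φ ht, hφ'ξ]
  have hd : ∀ l < k + 1, ∀ t ∈ Ici (0 : ℝ), HasDerivWithinAt
      (fun τ => ∫ ξ, φ' ξ * evol Q N (fun j => (𝓕 (u₀ j) : L2 n)) l τ ξ)
      (∫ ξ, φ' ξ * evol Q N (fun j => (𝓕 (u₀ j) : L2 n)) (l + 1) t ξ) (Ici 0) t :=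
    fun l _ t ht => (hK.pairing_evol h φ' l ht).2
  simp only [hφ'ξ]
  refine ⟨?_, fun t ht => ⟨(hK.pairing_evol h φ' k ht).1, ?_⟩⟩
  · refine ContDiffOn.congr ?_ h0
    exact contDiffOn_of_chain (G := fun l τ => ∫ ξ, φ' ξ *
      evol Q N (fun j => (𝓕 (u₀ j) : L2 n)) l τ ξ) (fun l hl => hd l (by omega))
      fun t ht => (hd k (by omega) t ht).continuousWithinAt
  · rw [iteratedDerivWithin_congr h0 ht]
    exact iteratedDerivWithin_of_chain (G := fun l τ => ∫ ξ, φ' ξ *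
      evol Q N (fun j => (𝓕 (u₀ j) : L2 n)) l τ ξ) (fun l hl => hd l (by omega)) le_rfl ht

theorem KernelBound.isSolution (hK : KernelBound Q N L A σ)
    (hdeg : ∀ ζ, (Q.csymbol ζ).natDegree ≤ N + 1) (hcoeff : ∀ ζ, (Q.csymbol ζ).coeff (N + 1) = 1)
    (h : IsDataOfOrder N κ fun j => (𝓕 (u₀ j) : L2 n)) (hκ : (N : ℝ) ≤ κ) :
    IsSolution Q (N + 1) u₀ (solution Q N u₀) where
  contDiffOn := (hK.solution_chain h hκ).1
  initial j hj := by
    have hj' : (j : ℝ) ≤ κ := le_trans (by exact_mod_cast Nat.lt_succ_iff.1 hj) hκ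
    rw [(hK.solution_chain h hj').2 0 le_rfl, evol_zero Q _ hj,
      toL2_eq_of_ae (Filter.EventuallyEq.refl _ _), FourierTransform.fourierInv_fourier_eq]
  contDiffOn_test ψ := by
    have hκ0 : 0 ≤ κ := (Nat.cast_nonneg N).trans hκ
    have := (hK.iteratedDeriv_spaceDeriv_solution h hκ0 0 (𝓕⁻ ψ) (N + 1)).1
    rw [FourierTransform.fourier_fourierInv_eq] at this
    have h0 : ∀ T : 𝓢'(EuclideanSpace ℝ (Fin n), ℂ), spaceDeriv 0 T = T := fun T => by
      have : ∀ l : List (Fin n), l.foldr (fun i S => (fun R : 𝓢'(EuclideanSpace ℝ (Fin n), ℂ) =>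
          ∂_{EuclideanSpace.single i (1 : ℝ)} R)^[(0 : Fin n → ℕ) i] S) T = T := by
        intro l
        induction l with
        | nil => rfl
        | cons i l ih => simp
      exact this _
    simpa only [h0] using this
  equation ψ t ht := by
    have hκ0 : 0 ≤ κ := (Nat.cast_nonneg N).trans hκ
    obtain ⟨φ, rfl⟩ : ∃ φ : 𝓢(EuclideanSpace ℝ (Fin n), ℂ), ψ = 𝓕 φ :=
      ⟨𝓕⁻ ψ, (FourierTransform.fourier_fourierInv_eq ψ).symm⟩
    have hI := fun d : Option (Fin n) →₀ ℕ =>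
      (hK.iteratedDeriv_spaceDeriv_solution h hκ0 (fun i => d (some i)) φ (d none)).2 t ht
    simp only [(hI _).2]
    simp only [← integral_const_mul]
    rw [← integral_finsetSum _ fun d _ => (hI d).1.const_mul _, ← integral_zero
      (EuclideanSpace ℝ (Fin n)) ℂ]
    congr 1
    ext ξ
    have := jetEval_evol Q N (fun j => (𝓕 (u₀ j) : L2 n)) t ξ (hdeg _) (hcoeff _)
    rw [← mul_zero (φ ξ), ← this, Finset.mul_sum]
    exact Finset.sum_congr rfl fun d _ => by ring

end Existence

/-! ### Uniqueness for the Cauchy problem -/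

theorem memLp_mul_bcf {n : ℕ} (g : BoundedContinuousFunction (EuclideanSpace ℝ (Fin n)) ℂ)
    (f : L2 n) : MemLp (fun ξ => g ξ * f ξ) 2 :=
  ((Lp.memLp f).const_mul (‖g‖ : ℂ)).of_le (g.continuous.aestronglyMeasurable.mul
    (Lp.aestronglyMeasurable f)) (Filter.Eventually.of_forall fun ξ => by
      rw [norm_mul, norm_mul, Complex.norm_real, norm_norm]
      gcongr
      exact g.norm_coe_le_norm ξ)

theorem fourier_sub_L2 {n : ℕ} (f g : L2 n) : (𝓕 (f - g) : L2 n) = 𝓕 f - 𝓕 g :=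
  map_sub (FourierTransform.fourierCLM ℂ (L2 n)) f g

/-- The multiplication of `L²` by a bounded continuous function. -/
def mulL2 {n : ℕ} (g : BoundedContinuousFunction (EuclideanSpace ℝ (Fin n)) ℂ) : L2 n →L[ℂ] L2 n :=
  LinearMap.mkContinuous
    { toFun := fun f => (memLp_mul_bcf g f).toLp
      map_add' := fun f f' => by
        rw [← MemLp.toLp_add]
        refine MemLp.toLp_congr _ _ ?_
        filter_upwards [Lp.coeFn_add f f'] with ξ h
        rw [h, Pi.add_apply, Pi.add_apply, mul_add]
      map_smul' := fun c f => by
        rw [RingHom.id_apply, ← MemLp.toLp_const_smul]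
        refine MemLp.toLp_congr _ _ ?_
        filter_upwards [Lp.coeFn_smul c f] with ξ h
        rw [h, Pi.smul_apply, Pi.smul_apply, smul_eq_mul, smul_eq_mul]
        ring } ‖g‖ fun f => by
    refine Lp.norm_le_mul_norm_of_ae_le_mul ?_
    filter_upwards [(memLp_mul_bcf g f).coeFn_toLp] with ξ h
    rw [LinearMap.coe_mk, AddHom.coe_mk, h, norm_mul]
    gcongr
    exact g.norm_coe_le_norm ξ

theorem coeFn_mulL2 {n : ℕ} (g : BoundedContinuousFunction (EuclideanSpace ℝ (Fin n)) ℂ) (f : L2 n) :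
    mulL2 g f =ᵐ[volume] fun ξ => g ξ * f ξ :=
  (memLp_mul_bcf g f).coeFn_toLp

theorem norm_mulL2_le {n : ℕ} {g h : BoundedContinuousFunction (EuclideanSpace ℝ (Fin n)) ℂ} {C : ℝ}
    (hgh : ∀ ξ, ‖g ξ‖ ≤ C * ‖h ξ‖) (f : L2 n) : ‖mulL2 g f‖ ≤ C * ‖mulL2 h f‖ := by
  refine Lp.norm_le_mul_norm_of_ae_le_mul ?_
  filter_upwards [coeFn_mulL2 g f, coeFn_mulL2 h f] with ξ h1 h2
  rw [h1, h2, norm_mul, norm_mul, ← mul_assoc]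
  gcongr
  exact hgh ξ

theorem eq_of_forall_pairing {n : ℕ} {f g : L2 n} (h : ∀ φ, pairing φ f = pairing φ g) : f = g :=
  Lp.ext (ae_eq_of_forall_schwartz (L2.locallyIntegrable f) (L2.locallyIntegrable g) fun φ => by
    rw [← pairing_apply, ← pairing_apply, h])

/-- A curve in `L²` with a continuous weak derivative is differentiable. -/
theorem hasDerivWithinAt_of_pairing {n : ℕ} {w R : ℝ → L2 n} (hw : ContinuousOn w (Ici 0))
    (hR : ContinuousOn R (Ici 0))
    (h : ∀ φ t, 0 ≤ t → HasDerivWithinAt (fun s => pairing φ (w s)) (pairing φ (R t)) (Ici 0) t)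
    {t : ℝ} (ht : 0 ≤ t) : HasDerivWithinAt w (R t) (Ici 0) t := by
  have hR' : Continuous fun s => R (max s 0) :=
    hR.comp_continuous (by fun_prop) fun s => mem_Ici.2 (le_max_right _ _)
  have heq : ∀ s ∈ Ici (0 : ℝ), w s = w 0 + ∫ x in (0 : ℝ)..s, R (max x 0) := by
    intro s hs
    refine eq_of_forall_pairing fun φ => ?_
    have hcomm : ∫ x in (0 : ℝ)..s, pairing φ (R (max x 0)) =
        pairing φ (∫ x in (0 : ℝ)..s, R (max x 0)) :=
      ContinuousLinearMap.intervalIntegral_comp_comm _ (hR'.intervalIntegrable 0 s)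
    rw [map_add, ← hcomm]
    have hsub : Icc 0 s ⊆ Ici (0 : ℝ) := fun x hx => hx.1
    rw [intervalIntegral.integral_eq_sub_of_hasDeriv_right_of_le hs
      (f := fun s => pairing φ (w s)) (f' := fun s => pairing φ (R (max s 0)))
      ((pairing φ).continuous.comp_continuousOn (hw.mono hsub)) (fun x hx => ?_)
      (((pairing φ).continuous.comp hR').intervalIntegrable 0 s)]
    · ring
    · rw [max_eq_left hx.1.le]
      exact (h φ x hx.1.le).mono fun y hy => hx.1.le.trans (le_of_lt hy)
  have hd : HasDerivAt (fun s => w 0 + ∫ x in (0 : ℝ)..s, R (max x 0)) (R (max t 0)) t :=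
    (hR'.integral_hasStrictDerivAt 0 t).hasDerivAt.const_add _
  rw [max_eq_left ht] at hd
  exact hd.hasDerivWithinAt.congr heq (heq t ht)

theorem exists_cutoff (n : ℕ) (r : ℝ) : ∃ χ : EuclideanSpace ℝ (Fin n) → ℂ,
    χ.HasTemperateGrowth ∧ HasCompactSupport χ ∧ ∀ ξ, ‖ξ‖ ≤ r → χ ξ = 1 := by
  set b : ContDiffBump (0 : EuclideanSpace ℝ (Fin n)) := ⟨|r| + 1, |r| + 2, by positivity, by linarith⟩
  have h1 : HasCompactSupport fun ξ => (b ξ : ℂ) := b.hasCompactSupport.comp_left Complex.ofReal_zero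
  have h2 : ContDiff ℝ ((⊤ : ℕ∞) : WithTop ℕ∞) fun ξ => (b ξ : ℂ) :=
    Complex.ofRealCLM.contDiff.comp b.contDiff
  refine ⟨fun ξ => (b ξ : ℂ), h1.hasTemperateGrowth h2, h1, fun ξ hξ => ?_⟩
  have : ξ ∈ Metric.closedBall (0 : EuclideanSpace ℝ (Fin n)) b.rIn := by
    rw [mem_closedBall_zero_iff]
    change ‖ξ‖ ≤ |r| + 1
    linarith [le_abs_self r]
  dsimp only
  rw [b.one_of_mem_closedBall this, Complex.ofReal_one]

section Uniqueness

variable {n N : ℕ} {Q : DiffOp n} {u₀ : ℕ → L2 n} {u v : ℝ → L2 n}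

theorem IsSolution.hasDerivWithinAt_timeDeriv (hu : IsSolution Q (N + 1) u₀ u) {k : ℕ} (hk : k < N)
    {t : ℝ} (ht : 0 ≤ t) :
    HasDerivWithinAt (timeDeriv k u) (timeDeriv (k + 1) u t) (Ici 0) t :=
  hasDerivWithinAt_iteratedDerivWithin hu.contDiffOn hk ht

theorem IsSolution.continuousOn_timeDeriv (hu : IsSolution Q (N + 1) u₀ u) {k : ℕ} (hk : k ≤ N) :
    ContinuousOn (timeDeriv k u) (Ici 0) :=
  hu.contDiffOn.continuousOn_iteratedDerivWithin (by exact_mod_cast hk) (uniqueDiffOn_Ici 0)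

theorem pairing_fourier {n : ℕ} (φ : 𝓢(EuclideanSpace ℝ (Fin n), ℂ)) (f : L2 n) :
    pairing φ (𝓕 f) = (f : 𝓢'(EuclideanSpace ℝ (Fin n), ℂ)) (𝓕 φ) := by
  rw [pairing_apply, L2.coe_apply_fourier]

theorem pairing_smulLeft {n : ℕ} {g : EuclideanSpace ℝ (Fin n) → ℂ} (hg : g.HasTemperateGrowth)
    (φ : 𝓢(EuclideanSpace ℝ (Fin n), ℂ)) (f : L2 n) :
    pairing (SchwartzMap.smulLeftCLM ℂ g φ) f = ∫ ξ, g ξ * φ ξ * f ξ := by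
  rw [pairing_apply]
  simp only [SchwartzMap.smulLeftCLM_apply_apply hg, smul_eq_mul]

theorem IsSolution.iteratedDeriv_pairing (hu : IsSolution Q (N + 1) u₀ u)
    (φ : 𝓢(EuclideanSpace ℝ (Fin n), ℂ)) {k : ℕ} (hk : k ≤ N) :
    EqOn (iteratedDerivWithin k (fun τ => pairing φ (𝓕 (u τ))) (Ici 0))
      (fun t => pairing φ (𝓕 (timeDeriv k u t))) (Ici 0) := by
  have := iteratedDerivWithin_of_chain (N := N)
    (G := fun k t => pairing φ (𝓕 (timeDeriv k u t))) (fun l hl t ht =>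
      ((pairing φ ∘L FourierTransform.fourierCLM ℂ (L2 n)).restrictScalars
        ℝ).hasFDerivAt.comp_hasDerivWithinAt t (hu.hasDerivWithinAt_timeDeriv hl ht)) hk
  simpa only [timeDeriv, iteratedDerivWithin_zero] using this

/-- The equation, solved for the highest order derivative, on the Fourier side. -/
theorem IsSolution.hasDerivWithinAt_pairing (hu : IsSolution Q (N + 1) u₀ u)
    (hQ : ∀ d ∈ Q.support, d none + ∑ i, d (some i) ≤ N + 1) (hQ1 : Q.timeCoeff (N + 1) = 1)
    (φ : 𝓢(EuclideanSpace ℝ (Fin n), ℂ)) {t : ℝ} (ht : 0 ≤ t) :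
    HasDerivWithinAt (fun s => pairing φ (𝓕 (timeDeriv N u s)))
      (-∑ d ∈ Q.support.erase (Finsupp.single none (N + 1)), MvPolynomial.coeff d Q *
        ∫ ξ, (∏ i, waveVec ξ i ^ d (some i)) * φ ξ * (𝓕 (timeDeriv (d none) u t) : L2 n) ξ)
      (Ici 0) t := by
  have htest : ContDiffOn ℝ ((N + 1 : ℕ) : ℕ∞) (fun τ => pairing φ (𝓕 (u τ))) (Ici 0) := by
    simp only [pairing_fourier]
    exact hu.contDiffOn_test (𝓕 φ)
  have h1 := hasDerivWithinAt_iteratedDerivWithin htest (Nat.lt_succ_self N) ht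
  refine (h1.congr (fun s hs => (hu.iteratedDeriv_pairing φ le_rfl hs).symm)
    (hu.iteratedDeriv_pairing φ le_rfl ht).symm).congr_deriv ?_
  have heq := hu.equation (𝓕 φ) t ht
  have hmem : Finsupp.single none (N + 1) ∈ Q.support := by
    rw [MvPolynomial.mem_support_iff]
    change Q.timeCoeff (N + 1) ≠ 0
    rw [hQ1]
    exact one_ne_zero
  rw [← Finset.add_sum_erase _ _ hmem] at heq
  have htop : MvPolynomial.coeff (Finsupp.single none (N + 1)) Q = 1 := hQ1
  have hα : (fun i : Fin n => (Finsupp.single (none : Option (Fin n)) (N + 1)) (some i)) =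
      fun _ => 0 := by
    ext i; simp
  rw [htop, one_mul, hα, Finsupp.single_eq_same] at heq
  have h2 : ∀ τ, spaceDeriv (fun _ : Fin n => 0)
      (u τ : 𝓢'(EuclideanSpace ℝ (Fin n), ℂ)) (𝓕 φ) = pairing φ (𝓕 (u τ)) := fun τ => by
    rw [spaceDeriv_coe_apply_fourier, pairing_apply]
    simp
  simp only [h2] at heq
  refine (eq_neg_of_add_eq_zero_left heq).trans ?_
  congr 1
  refine Finset.sum_congr rfl fun d hd => ?_
  obtain ⟨hd1, hd2⟩ := Finset.mem_erase.1 hd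
  have hdN : d none ≤ N := by
    by_contra hlt
    have := hQ d hd2
    exact hd1 ((eq_single_none_iff (D := N + 1) (by omega)).1 (by omega))
  have hg := hasTemperateGrowth_prod_waveVec fun i => d (some i)
  congr 1
  rw [← pairing_smulLeft hg]
  refine Eq.trans ?_ (hu.iteratedDeriv_pairing _ hdN ht)
  refine iteratedDerivWithin_congr (fun τ _ => ?_) ht
  simp only [spaceDeriv_coe_apply_fourier, pairing_smulLeft hg]

/-- Uniqueness: on a ball in the frequency space the equation is an ordinary differential equation
with bounded coefficients. -/
theorem IsSolution.unique (hu : IsSolution Q (N + 1) u₀ u) (hv : IsSolution Q (N + 1) u₀ v)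
    (hQ : ∀ d ∈ Q.support, d none + ∑ i, d (some i) ≤ N + 1) (hQ1 : Q.timeCoeff (N + 1) = 1) :
    EqOn v u (Ici 0) := by
  set f : ℕ → ℝ → L2 n := fun k t => 𝓕 (timeDeriv k v t - timeDeriv k u t) with hf
  have hfc : ∀ k ≤ N, ContinuousOn (f k) (Ici 0) := fun k hk =>
    (FourierTransform.fourierCLM ℂ (L2 n)).continuous.comp_continuousOn
      ((hv.continuousOn_timeDeriv hk).sub (hu.continuousOn_timeDeriv hk))
  have hfd : ∀ k < N, ∀ t, 0 ≤ t → HasDerivWithinAt (f k) (f (k + 1) t) (Ici 0) t := fun k hk t ht =>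
    ((FourierTransform.fourierCLM ℂ (L2 n)).restrictScalars ℝ).hasFDerivAt.comp_hasDerivWithinAt t
      ((hv.hasDerivWithinAt_timeDeriv hk ht).sub (hu.hasDerivWithinAt_timeDeriv hk ht))
  have hf0 : ∀ k ≤ N, f k 0 = 0 := fun k hk => by
    simp only [hf]
    rw [hv.initial k (by omega), hu.initial k (by omega), sub_self, FourierTransform.fourier_zero]
  set S := Q.support.erase (Finsupp.single none (N + 1)) with hS
  have hSN : ∀ d ∈ S, d none ≤ N := by
    intro d hd
    obtain ⟨hd1, hd2⟩ := Finset.mem_erase.1 hd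
    by_contra hlt
    have := hQ d hd2
    exact hd1 ((eq_single_none_iff (D := N + 1) (by omega)).1 (by omega))
  have hpc : ∀ d : Option (Fin n) →₀ ℕ, Continuous fun ξ : EuclideanSpace ℝ (Fin n) =>
      ∏ i, waveVec ξ i ^ d (some i) := fun d => by
    have := continuous_waveVec (n := n)
    fun_prop
  -- it is enough to show that the cut-off of the difference vanishes
  suffices hcut : ∀ r t, 0 ≤ t → ∀ᵐ ξ, ‖ξ‖ ≤ r → f 0 t ξ = 0 by
    intro t ht
    have h1 : f 0 t = 0 := by
      refine Lp.ext ?_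
      filter_upwards [ae_all_iff.2 fun j : ℕ => hcut j t ht, Lp.coeFn_zero ℂ 2 volume] with ξ h2 h3
      obtain ⟨j, hj⟩ := exists_nat_ge ‖ξ‖
      rw [h2 j hj, h3, Pi.zero_apply]
    have h2 : v t - u t = 0 := by
      have h3 := congrArg (fun g : L2 n => (𝓕⁻ g : L2 n)) h1
      simp only [hf] at h3
      rw [FourierTransform.fourierInv_fourier_eq, FourierTransform.fourierInv_zero] at h3
      simpa only [timeDeriv, iteratedDerivWithin_zero] using h3
    exact sub_eq_zero.1 h2
  intro r T hT
  obtain ⟨χ, hχg, hχc, hχ1⟩ := exists_cutoff n r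
  have hχcont : Continuous χ := hχg.1.continuous
  have hbcf : ∀ p : EuclideanSpace ℝ (Fin n) → ℂ, Continuous p →
      ∃ g : BoundedContinuousFunction (EuclideanSpace ℝ (Fin n)) ℂ, (∀ ξ, g ξ = p ξ * χ ξ) := by
    intro p hp
    have hc : Continuous fun ξ => p ξ * χ ξ := hp.mul hχcont
    obtain ⟨C, hC⟩ := hc.bounded_above_of_compact_support hχc.mul_left
    exact ⟨BoundedContinuousFunction.ofNormedAddCommGroup _ hc C hC, fun ξ => rfl⟩
  obtain ⟨X₁, hX₁⟩ := hbcf (fun _ => 1) continuous_const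
  simp only [one_mul] at hX₁
  choose G hG using fun d : Option (Fin n) →₀ ℕ => hbcf _ (hpc d)
  have hGb : ∀ d, ∃ C : ℝ, 0 ≤ C ∧ ∀ g : L2 n, ‖mulL2 (G d) g‖ ≤ C * ‖mulL2 X₁ g‖ := by
    intro d
    obtain ⟨C, hC⟩ := hχc.isCompact.exists_bound_of_continuousOn (hpc d).continuousOn
    refine ⟨max C 0, le_max_right _ _, fun g => norm_mulL2_le (fun ξ => ?_) g⟩
    rw [hG, hX₁, norm_mul]
    by_cases hξ : ξ ∈ tsupport χ
    · gcongr
      exact (hC ξ hξ).trans (le_max_left _ _)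
    · rw [image_eq_zero_of_notMem_tsupport hξ, norm_zero, mul_zero, mul_zero]
  choose C hC0 hC using hGb
  set R : ℝ → L2 n := fun t => -∑ d ∈ S, MvPolynomial.coeff d Q • mulL2 (G d) (f (d none) t) with hR
  have hRc : ContinuousOn R (Ici 0) := by
    refine (continuousOn_finsetSum _ fun d hd => ?_).neg
    exact (MvPolynomial.coeff d Q • mulL2 (G d)).continuous.comp_continuousOn (hfc _ (hSN d hd))
  have hwd : ∀ t, 0 ≤ t → HasDerivWithinAt (fun s => mulL2 X₁ (f N s)) (R t) (Ici 0) t := by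
    intro t ht
    refine hasDerivWithinAt_of_pairing
      ((mulL2 X₁).continuous.comp_continuousOn (hfc N le_rfl)) hRc (fun φ t ht => ?_) ht
    set φ' := SchwartzMap.smulLeftCLM ℂ χ φ
    have hφ' : ∀ ξ, φ' ξ = χ ξ * φ ξ := SchwartzMap.smulLeftCLM_apply_apply hχg φ
    have h1 := (hv.hasDerivWithinAt_pairing hQ hQ1 φ' ht).sub
      (hu.hasDerivWithinAt_pairing hQ hQ1 φ' ht)
    refine (h1.congr_of_mem (fun s hs => ?_) ht).congr_deriv ?_
    · rw [Pi.sub_apply, ← map_sub, ← fourier_sub_L2, pairing_apply, pairing_apply]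
      refine integral_congr_ae ?_
      filter_upwards [coeFn_mulL2 X₁ (f N s)] with ξ hξ
      rw [Function.comp_apply, hξ, hφ', hX₁]
      ring
    · rw [hR, map_neg, map_sum, neg_sub_neg, ← Finset.sum_sub_distrib, ← Finset.sum_neg_distrib]
      refine Finset.sum_congr rfl fun d hd => ?_
      have hg := hasTemperateGrowth_prod_waveVec fun i => d (some i)
      rw [← mul_sub, ← pairing_smulLeft hg, ← pairing_smulLeft hg, ← map_sub,
        ← fourier_sub_L2, map_smul, smul_eq_mul, ← mul_neg, pairing_smulLeft hg,
        pairing_apply, ← integral_neg]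
      congr 1
      refine integral_congr_ae ?_
      filter_upwards [coeFn_mulL2 (G d) (f (d none) t), Lp.coeFn_neg (f (d none) t)] with ξ hξ h3
      have h4 : (𝓕 (timeDeriv (d none) u t - timeDeriv (d none) v t) : L2 n) = -f (d none) t := by
        rw [hf, ← FourierTransform.fourier_neg, neg_sub]
      rw [hξ, hφ', hG, h4, h3, Pi.neg_apply]
      ring
  -- the jet solves a linear differential inequality and vanishes at `t = 0`
  set Y : ℝ → Fin (N + 1) → L2 n := fun t k => mulL2 X₁ (f k t) with hY
  set Y' : ℝ → Fin (N + 1) → L2 n := fun t k =>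
    if (k : ℕ) < N then mulL2 X₁ (f (k + 1) t) else R t with hY'
  have hYd : ∀ t, 0 ≤ t → HasDerivWithinAt Y (Y' t) (Ici 0) t := by
    intro t ht
    refine hasDerivWithinAt_pi.2 fun k => ?_
    simp only [hY, hY']
    split_ifs with hk
    · exact ((mulL2 X₁).restrictScalars ℝ).hasFDerivAt.comp_hasDerivWithinAt t (hfd k hk t ht)
    · have : (k : ℕ) = N := by omega
      rw [this]
      exact hwd t ht
  set K : ℝ := 1 + ∑ d ∈ S, ‖MvPolynomial.coeff d Q‖ * C d with hK
  have hK0 : 0 ≤ ∑ d ∈ S, ‖MvPolynomial.coeff d Q‖ * C d :=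
    Finset.sum_nonneg fun d _ => mul_nonneg (norm_nonneg _) (hC0 d)
  have hcomp : ∀ t, ∀ k ≤ N, ‖mulL2 X₁ (f k t)‖ ≤ ‖Y t‖ := fun t k hk =>
    norm_le_pi_norm (Y t) (⟨k, by omega⟩ : Fin (N + 1))
  have hbound : ∀ t ∈ Ico 0 T, ‖Y' t‖ ≤ K * ‖Y t‖ + 0 := by
    intro t _
    rw [add_zero]
    refine (pi_norm_le_iff_of_nonneg (by positivity)).2 fun k => ?_
    simp only [hY']
    split_ifs with hk
    · refine (hcomp t _ hk).trans (le_mul_of_one_le_left (norm_nonneg _) (by linarith))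
    · rw [hR, norm_neg]
      calc ‖∑ d ∈ S, MvPolynomial.coeff d Q • mulL2 (G d) (f (d none) t)‖
          ≤ ∑ d ∈ S, ‖MvPolynomial.coeff d Q‖ * C d * ‖Y t‖ := by
            refine norm_sum_le_of_le _ fun d hd => ?_
            rw [norm_smul, mul_assoc]
            gcongr
            refine (hC d _).trans ?_
            have := hC0 d
            gcongr
            exact hcomp t _ (hSN d hd)
        _ ≤ K * ‖Y t‖ := by
            rw [← Finset.sum_mul]
            gcongr
            linarith
  have hYT := norm_le_gronwallBound_of_norm_deriv_right_le (f := Y) (f' := Y') (δ := 0) (a := 0)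
    (b := T) (fun t ht => (hYd t ht.1).continuousWithinAt.mono fun x hx => hx.1)
    (fun t ht => (hYd t ht.1).mono fun x hx => ht.1.trans hx) (by
      have : Y 0 = 0 := by
        ext1 k
        simp only [hY]
        rw [hf0 k (by omega), map_zero, Pi.zero_apply]
      rw [this, norm_zero]) hbound T ⟨hT, le_rfl⟩
  rw [gronwallBound_ε0_δ0] at hYT
  have h0 : mulL2 X₁ (f 0 T) = 0 := norm_le_zero_iff.1 ((hcomp T 0 (by omega)).trans hYT)
  filter_upwards [coeFn_mulL2 X₁ (f 0 T), Lp.coeFn_zero ℂ 2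
    (volume : Measure (EuclideanSpace ℝ (Fin n)))] with ξ h1 h2 hξ
  rw [h0, h2, hX₁, hχ1 ξ hξ, one_mul] at h1
  exact h1.symm

end Uniqueness

/-! ### Decay estimates for the heat kernel -/

theorem eLpNorm_two_sq {α E : Type*} [MeasurableSpace α] {μ : Measure α} [NormedAddCommGroup E]
    (f : α → E) : eLpNorm f 2 μ ^ 2 = ∫⁻ x, ‖f x‖ₑ ^ 2 ∂μ := by
  have := eLpNorm_nnreal_pow_eq_lintegral (μ := μ) (f := f) (p := 2) two_ne_zero
  simpa using this

theorem eLpNorm_weight_sq {n : ℕ} {w : EuclideanSpace ℝ (Fin n) → ℝ} (hw : ∀ ξ, 0 ≤ w ξ)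
    (g : EuclideanSpace ℝ (Fin n) → ℂ) :
    eLpNorm (fun ξ => (w ξ : ℂ) * g ξ) 2 ^ 2 = ∫⁻ ξ, ENNReal.ofReal (w ξ ^ 2) * ‖g ξ‖ₑ ^ 2 := by
  rw [eLpNorm_two_sq]
  refine lintegral_congr fun ξ => ?_
  rw [enorm_mul, mul_pow, ENNReal.ofReal_pow (hw ξ), ← ofReal_norm (w ξ : ℂ), Complex.norm_real,
    Real.norm_of_nonneg (hw ξ)]

theorem ENNReal.le_of_sq_le_sq {x y : ℝ≥0∞} (h : x ^ 2 ≤ y ^ 2) : x ≤ y :=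
  (ENNReal.pow_le_pow_left_iff two_ne_zero).1 h

theorem exists_one_add_rpow_le_exp (p : ℝ) {σ : ℝ} (hσ : 0 < σ) : ∃ C : ℝ, 0 < C ∧
    ∀ x, 0 ≤ x → (1 + x) ^ p ≤ C * Real.exp (σ * x) := by
  obtain ⟨M, hM⟩ := exists_nat_ge p
  refine ⟨M.factorial * Real.exp σ * σ⁻¹ ^ M, by positivity, fun x hx => ?_⟩
  have h1 := Real.pow_div_factorial_le_exp (σ * (1 + x)) (by positivity) M
  rw [div_le_iff₀ (by positivity)] at h1
  calc (1 + x) ^ p ≤ (1 + x) ^ (M : ℝ) := Real.rpow_le_rpow_of_exponent_le (by linarith) hM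
    _ = σ⁻¹ ^ M * (σ * (1 + x)) ^ M := by
      rw [Real.rpow_natCast, ← mul_pow, inv_mul_cancel_left₀ hσ.ne']
    _ ≤ σ⁻¹ ^ M * (Real.exp (σ * (1 + x)) * M.factorial) := by gcongr
    _ = _ := by rw [mul_add, Real.exp_add]; ring_nf

/-- Splitting a function at the level `l`. -/
theorem exists_split {n : ℕ} {f : L2 n} {q l : ℝ} (hq1 : 1 ≤ q) (hq2 : q ≤ 2) (hl : 0 < l)
    (hf : ∫⁻ x, ‖f x‖ₑ ^ q ≠ ∞) : ∃ g h : L2 n, f = g + h ∧ Integrable g ∧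
      eLpNorm g 1 volume ≤ ENNReal.ofReal (l ^ (1 - q)) * ∫⁻ x, ‖f x‖ₑ ^ q ∧
      eLpNorm h 2 volume ^ 2 ≤ ENNReal.ofReal (l ^ (2 - q)) * ∫⁻ x, ‖f x‖ₑ ^ q := by
  set S : Set (EuclideanSpace ℝ (Fin n)) := {x | l < ‖f x‖} with hS
  have hSm : MeasurableSet S :=
    measurableSet_lt measurable_const (Lp.stronglyMeasurable f).norm.measurable
  have hg := (Lp.memLp f).indicator hSm
  have hh := (Lp.memLp f).indicator hSm.compl
  have hof : ∀ (x) (p : ℝ), 0 ≤ p → ‖f x‖ₑ ^ p = ENNReal.ofReal (‖f x‖ ^ p) := fun x p hp => by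
    rw [← ofReal_norm, ENNReal.ofReal_rpow_of_nonneg (norm_nonneg _) hp]
  have hle1 : eLpNorm (toL2 (S.indicator f)) 1 volume ≤
      ENNReal.ofReal (l ^ (1 - q)) * ∫⁻ x, ‖f x‖ₑ ^ q := by
    rw [eLpNorm_congr_ae (coeFn_toL2 hg), eLpNorm_one_eq_lintegral_enorm,
      ← lintegral_const_mul' _ _ ENNReal.ofReal_ne_top]
    refine lintegral_mono fun x => ?_
    by_cases hx : x ∈ S
    · dsimp only
      rw [indicator_of_mem hx, hof x q (by linarith), ← ENNReal.ofReal_mul (by positivity),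
        ← ofReal_norm]
      refine ENNReal.ofReal_le_ofReal ?_
      have hx0 : 0 < ‖f x‖ := hl.trans hx
      have h1 : ‖f x‖ ^ (1 - q) ≤ l ^ (1 - q) :=
        Real.rpow_le_rpow_of_nonpos hl (le_of_lt hx) (by linarith)
      calc ‖f x‖ = ‖f x‖ ^ (1 - q) * ‖f x‖ ^ q := by
            rw [← Real.rpow_add hx0, sub_add_cancel, Real.rpow_one]
        _ ≤ _ := by gcongr
    · simp [indicator_of_notMem hx]
  refine ⟨toL2 (S.indicator f), toL2 (Sᶜ.indicator f), ?_, ?_, hle1, ?_⟩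
  · refine Lp.ext ?_
    filter_upwards [coeFn_toL2 hg, coeFn_toL2 hh,
      Lp.coeFn_add (toL2 (S.indicator f)) (toL2 (Sᶜ.indicator f))] with x h1 h2 h3
    rw [h3, Pi.add_apply, h1, h2]
    exact (congrFun (indicator_self_add_compl S f) x).symm
  · refine memLp_one_iff_integrable.1 ⟨Lp.aestronglyMeasurable _, hle1.trans_lt ?_⟩
    exact ENNReal.mul_lt_top ENNReal.ofReal_lt_top hf.lt_top
  · rw [eLpNorm_congr_ae (coeFn_toL2 hh), eLpNorm_two_sq,
      ← lintegral_const_mul' _ _ ENNReal.ofReal_ne_top]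
    refine lintegral_mono fun x => ?_
    by_cases hx : x ∈ S
    · simp [indicator_of_notMem (fun h : x ∈ Sᶜ => h hx)]
    · dsimp only
      rw [indicator_of_mem (show x ∈ Sᶜ from hx), hof x q (by linarith),
        ← ENNReal.ofReal_mul (by positivity), ← ofReal_norm, ← ENNReal.ofReal_pow (norm_nonneg _)]
      refine ENNReal.ofReal_le_ofReal ?_
      rcases (norm_nonneg (f x)).eq_or_lt with h0 | h0
      · rw [← h0, zero_pow two_ne_zero]; positivity
      · have h1 : ‖f x‖ ^ (2 - q) ≤ l ^ (2 - q) :=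
          Real.rpow_le_rpow h0.le (not_lt.1 hx) (by linarith)
        calc ‖f x‖ ^ 2 = ‖f x‖ ^ (2 - q) * ‖f x‖ ^ q := by
              rw [← Real.rpow_add h0, sub_add_cancel, Real.rpow_ofNat]
          _ ≤ _ := by gcongr

theorem eLpNorm_gaussian_le {n : ℕ} {τ : ℝ} (hτ : 0 < τ) :
    eLpNorm (fun ξ : EuclideanSpace ℝ (Fin n) => (Real.exp (-τ * rad ξ ^ 2) : ℂ)) 2 ≤
      ENNReal.ofReal (τ ^ (-((n : ℝ) / 4))) := by
  refine ENNReal.le_of_sq_le_sq ?_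
  have h0 := Real.pi_pos
  have hb : 0 < 8 * Real.pi ^ 2 * τ := by positivity
  have hint := GaussianFourier.integral_rexp_neg_mul_sq_norm (V := EuclideanSpace ℝ (Fin n)) hb
  rw [finrank_euclideanSpace_fin] at hint
  have hpos : 0 < (Real.pi / (8 * Real.pi ^ 2 * τ)) ^ ((n : ℝ) / 2) := by positivity
  have hi := Integrable.of_integral_ne_zero (hint.trans_ne hpos.ne')
  have h1 := ofReal_integral_eq_lintegral_ofReal hi
    (Filter.Eventually.of_forall fun _ => (Real.exp_pos _).le)
  have h2 := eLpNorm_weight_sq (w := fun ξ : EuclideanSpace ℝ (Fin n) => Real.exp (-τ * rad ξ ^ 2))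
    (fun ξ => (Real.exp_pos _).le) fun _ => 1
  simp only [mul_one, enorm_one, one_pow] at h2
  rw [h2, ← ENNReal.ofReal_pow (by positivity)]
  have h3 : ∀ ξ : EuclideanSpace ℝ (Fin n), Real.exp (-τ * rad ξ ^ 2) ^ 2 =
      Real.exp (-(8 * Real.pi ^ 2 * τ) * ‖ξ‖ ^ 2) := fun ξ => by
    rw [← Real.exp_nat_mul, rad]
    congr 1
    push_cast
    ring
  simp only [h3]
  rw [← h1, hint]
  refine ENNReal.ofReal_le_ofReal ?_
  rw [← Real.rpow_natCast (_ ^ _), ← Real.rpow_mul hτ.le,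
    show -((n : ℝ) / 4) * (2 : ℕ) = -((n : ℝ) / 2) by push_cast; ring, Real.rpow_neg hτ.le,
    ← Real.inv_rpow hτ.le]
  refine Real.rpow_le_rpow (by positivity) ?_ (by positivity)
  rw [div_le_iff₀ hb, show τ⁻¹ * (8 * Real.pi ^ 2 * τ) = 8 * Real.pi ^ 2 by field_simp]
  nlinarith [Real.pi_gt_three]

/-- The decay rate `n (1/q - 1/2)` of the heat equation, from `L^q` to `L²`. -/
def heatRate (n : ℕ) (q : ℝ) : ℝ := n * (1 / q - 1 / 2)

theorem eLpNorm_fourier {n : ℕ} (f : L2 n) : eLpNorm (𝓕 f : L2 n) 2 volume = eLpNorm f 2 volume := by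
  rw [← Lp.enorm_def, ← Lp.enorm_def, ← ofReal_norm, ← ofReal_norm, Lp.norm_fourier_eq]

/-- The `L^q`-`L²` estimate for the heat semigroup: the part of the datum above the level `l` is
estimated through its `L¹` norm, the rest through its `L²` norm. -/
theorem eLpNorm_heat_le {n : ℕ} {q τ : ℝ} (hq1 : 1 ≤ q) (hq2 : q ≤ 2) (hτ : 0 < τ) (f : L2 n)
    (hf : MemLp f (ENNReal.ofReal q)) :
    eLpNorm (fun ξ => (Real.exp (-τ * rad ξ ^ 2) : ℂ) * (𝓕 f : L2 n) ξ) 2 ≤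
      ENNReal.ofReal (2 * τ ^ (-(heatRate n q / 2))) * eLpNorm f (ENNReal.ofReal q) volume := by
  have hq0 : 0 < q := by linarith
  have hqE : ENNReal.ofReal q ≠ 0 := (ENNReal.ofReal_pos.2 hq0).ne'
  set M := (eLpNorm f (ENNReal.ofReal q) volume).toReal with hM
  have hMe : eLpNorm f (ENNReal.ofReal q) volume = ENNReal.ofReal M :=
    (ENNReal.ofReal_toReal hf.2.ne).symm
  rcases (ENNReal.toReal_nonneg : 0 ≤ M).eq_or_lt with h0 | hM0
  · have h1 : (f : EuclideanSpace ℝ (Fin n) → ℂ) =ᵐ[volume] 0 := by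
      rw [← eLpNorm_eq_zero_iff hf.1 hqE, hMe, hM, ← h0, ENNReal.ofReal_zero]
    have h2 : f = 0 := (Lp.eq_zero_iff_ae_eq_zero).2 h1
    rw [h2, FourierTransform.fourier_zero]
    have h3 : (fun ξ => (Real.exp (-τ * rad ξ ^ 2) : ℂ) * (0 : L2 n) ξ) =ᵐ[volume] 0 := by
      filter_upwards [Lp.coeFn_zero ℂ 2 (volume : Measure (EuclideanSpace ℝ (Fin n)))] with ξ hξ
      rw [hξ, Pi.zero_apply, mul_zero]
    rw [eLpNorm_congr_ae h3, eLpNorm_zero]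
    exact zero_le
  have hI : ∫⁻ x, ‖f x‖ₑ ^ q = ENNReal.ofReal (M ^ q) := by
    have h1 := eLpNorm_eq_lintegral_rpow_enorm_toReal (f := f) (μ := volume) hqE
      ENNReal.ofReal_ne_top
    rw [ENNReal.toReal_ofReal hq0.le] at h1
    rw [← ENNReal.ofReal_rpow_of_nonneg hM0.le hq0.le, ← hMe, h1, ← ENNReal.rpow_mul,
      one_div_mul_cancel hq0.ne', ENNReal.rpow_one]
  set l := M * τ ^ (-((n : ℝ) / (2 * q))) with hl
  have hl0 : 0 < l := by positivity
  obtain ⟨g, h, hgh, hg, hg1, hh⟩ := exists_split hq1 hq2 hl0 (hI.trans_ne ENNReal.ofReal_ne_top)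
  rw [hI, ← ENNReal.ofReal_mul (by positivity)] at hg1 hh
  -- both parts have the size `M τ^{-n(1/q - 1/2)/2}`
  have hlp : ∀ p, l ^ (p - q) * M ^ q = M ^ p * τ ^ (-((n : ℝ) / (2 * q)) * (p - q)) := fun p => by
    rw [hl, Real.mul_rpow hM0.le (by positivity), ← Real.rpow_mul hτ.le, mul_right_comm,
      ← Real.rpow_add hM0, sub_add_cancel]
  have hE1 : l ^ (1 - q) * M ^ q * τ ^ (-((n : ℝ) / 4)) = τ ^ (-(heatRate n q / 2)) * M := by
    rw [hlp, mul_assoc, ← Real.rpow_add hτ, Real.rpow_one, mul_comm, heatRate]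
    congr 2
    field_simp
    ring
  have hE2 : l ^ (2 - q) * M ^ q = (τ ^ (-(heatRate n q / 2)) * M) ^ 2 := by
    rw [hlp, mul_pow, Real.rpow_ofNat, mul_comm, ← Real.rpow_natCast (τ ^ _), ← Real.rpow_mul hτ.le,
      heatRate]
    congr 2
    push_cast
    field_simp
  have hsum : (fun ξ => (Real.exp (-τ * rad ξ ^ 2) : ℂ) * (𝓕 f : L2 n) ξ) =ᵐ[volume]
      (fun ξ => (Real.exp (-τ * rad ξ ^ 2) : ℂ) * (𝓕 g : L2 n) ξ) +
      fun ξ => (Real.exp (-τ * rad ξ ^ 2) : ℂ) * (𝓕 h : L2 n) ξ := by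
    have h1 : (𝓕 f : L2 n) = 𝓕 g + 𝓕 h := by rw [hgh, FourierTransform.fourier_add]
    rw [h1]
    filter_upwards [Lp.coeFn_add (𝓕 g : L2 n) (𝓕 h)] with ξ hξ
    rw [hξ, Pi.add_apply, Pi.add_apply, mul_add]
  have hmeas : ∀ f : L2 n, AEStronglyMeasurable
      (fun ξ => (Real.exp (-τ * rad ξ ^ 2) : ℂ) * (𝓕 f : L2 n) ξ) volume := fun f => by
    have := continuous_rad (n := n)
    exact (Continuous.aestronglyMeasurable (by fun_prop)).mul (Lp.aestronglyMeasurable _)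
  have hpart1 : eLpNorm (fun ξ => (Real.exp (-τ * rad ξ ^ 2) : ℂ) * (𝓕 g : L2 n) ξ) 2 ≤
      ENNReal.ofReal (τ ^ (-(heatRate n q / 2)) * M) := by
    have h1 : eLpNorm (fun ξ => (Real.exp (-τ * rad ξ ^ 2) : ℂ) * (𝓕 g : L2 n) ξ) 2 ≤
        eLpNorm (((l ^ (1 - q) * M ^ q : ℝ) : ℂ) •
          fun ξ : EuclideanSpace ℝ (Fin n) => (Real.exp (-τ * rad ξ ^ 2) : ℂ)) 2 := by
      refine eLpNorm_mono_enorm_ae ?_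
      filter_upwards [enorm_fourier_le_ae g hg] with ξ hξ
      rw [Pi.smul_apply, smul_eq_mul, enorm_mul, enorm_mul, mul_comm]
      gcongr
      refine hξ.trans (hg1.trans_eq ?_)
      rw [← ofReal_norm (_ : ℂ), Complex.norm_real, Real.norm_of_nonneg (by positivity)]
    refine h1.trans (eLpNorm_const_smul_le.trans ?_)
    rw [← hE1, ENNReal.ofReal_mul (by positivity), ← ofReal_norm, Complex.norm_real,
      Real.norm_of_nonneg (by positivity)]
    gcongr
    exact eLpNorm_gaussian_le hτ
  have hpart2 : eLpNorm (fun ξ => (Real.exp (-τ * rad ξ ^ 2) : ℂ) * (𝓕 h : L2 n) ξ) 2 ≤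
      ENNReal.ofReal (τ ^ (-(heatRate n q / 2)) * M) := by
    have h1 : eLpNorm (fun ξ => (Real.exp (-τ * rad ξ ^ 2) : ℂ) * (𝓕 h : L2 n) ξ) 2 ≤
        eLpNorm (𝓕 h : L2 n) 2 volume := by
      refine eLpNorm_mono fun ξ => ?_
      rw [norm_mul, Complex.norm_real, Real.norm_of_nonneg (Real.exp_pos _).le]
      refine mul_le_of_le_one_left (norm_nonneg _) (Real.exp_le_one_iff.2 ?_)
      nlinarith [sq_nonneg (rad ξ)]
    rw [eLpNorm_fourier] at h1
    refine h1.trans (ENNReal.le_of_sq_le_sq (hh.trans_eq ?_))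
    rw [hE2, ENNReal.ofReal_pow (by positivity)]
  rw [eLpNorm_congr_ae hsum, hMe, ← ENNReal.ofReal_mul (by positivity)]
  refine (eLpNorm_add_le (hmeas g) (hmeas h) (by norm_num)).trans
    ((add_le_add hpart1 hpart2).trans_eq ?_)
  rw [← ENNReal.ofReal_add (by positivity) (by positivity)]
  congr 1
  ring

/-- The power `r^{2a}`, for `a < 0`, as a superposition of gaussians. -/
theorem ofReal_rpow_le_lintegral {a r : ℝ} (ha : a < 0) (hr : 0 ≤ r) :
    ENNReal.ofReal ((r ^ a) ^ 2) ≤ ENNReal.ofReal (Real.Gamma (-a))⁻¹ *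
      ∫⁻ θ in Ioi (0 : ℝ), ENNReal.ofReal (θ ^ (-a - 1) * Real.exp (-(r ^ 2 * θ))) := by
  rcases hr.eq_or_lt with rfl | hr
  -- for `r = 0` the left hand side is `0`, by the convention `0 ^ a = 0` for real powers
  · simp [Real.zero_rpow ha.ne]
  have hint := Real.integral_rpow_mul_exp_neg_mul_Ioi (neg_pos.2 ha) (pow_pos hr 2)
  have hG : 0 < Real.Gamma (-a) := Real.Gamma_pos_of_pos (neg_pos.2 ha)
  have hi := Integrable.of_integral_ne_zero (hint.trans_ne (by positivity))
  rw [← ofReal_integral_eq_lintegral_ofReal hi, hint, ← ENNReal.ofReal_mul (by positivity)]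
  · refine (congrArg ENNReal.ofReal ?_).le
    rw [one_div, Real.inv_rpow (by positivity), Real.rpow_neg (by positivity), inv_inv, mul_comm,
      mul_assoc, mul_inv_cancel₀ hG.ne', mul_one, ← Real.rpow_natCast, ← Real.rpow_natCast,
      ← Real.rpow_mul hr.le, ← Real.rpow_mul hr.le, mul_comm]
  · refine (ae_restrict_iff' measurableSet_Ioi).2 (Filter.Eventually.of_forall fun θ hθ => ?_)
    have : 0 < θ := hθ
    positivity

/-- The integrals over `θ ≤ τ` and `θ > τ` are of the same size. -/
theorem lintegral_rpow_mul_rpow_le {a b τ : ℝ} (ha : a < 0) (hab : 0 < b + a) (hτ : 0 < τ) :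
    ∫⁻ θ in Ioi (0 : ℝ), ENNReal.ofReal (θ ^ (-a - 1) * (τ + θ) ^ (-b)) ≤
      ENNReal.ofReal (((-a)⁻¹ + (b + a)⁻¹) * τ ^ (-(b + a))) := by
  rw [← Ioc_union_Ioi_eq_Ioi hτ.le]
  refine (lintegral_union_le _ _ _).trans ?_
  rw [add_mul, ENNReal.ofReal_add (by have := neg_pos.2 ha; positivity) (by positivity)]
  refine add_le_add ?_ ?_
  · have hint : ∫ θ in Ioc 0 τ, τ ^ (-b) * θ ^ (-a - 1) = (-a)⁻¹ * τ ^ (-(b + a)) := by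
      rw [integral_const_mul, ← intervalIntegral.integral_of_le hτ.le,
        integral_rpow (Or.inl (by linarith)), sub_add_cancel, Real.zero_rpow (by linarith), sub_zero,
        mul_div_assoc', ← Real.rpow_add hτ, div_eq_inv_mul]
      congr 2
      ring
    have hi := Integrable.of_integral_ne_zero
      (hint.trans_ne (by have := neg_pos.2 ha; positivity))
    rw [← hint, ofReal_integral_eq_lintegral_ofReal hi]
    · refine setLIntegral_mono' measurableSet_Ioc fun θ hθ => ENNReal.ofReal_le_ofReal ?_
      have hθ0 : 0 < θ := hθ.1
      rw [mul_comm]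
      exact mul_le_mul_of_nonneg_right (Real.rpow_le_rpow_of_nonpos hτ (by linarith) (by linarith))
        (by positivity)
    · refine (ae_restrict_iff' measurableSet_Ioc).2 (Filter.Eventually.of_forall fun θ hθ => ?_)
      have : 0 < θ := hθ.1
      positivity
  · have hint : ∫ θ in Ioi τ, θ ^ (-a - 1 - b) = (b + a)⁻¹ * τ ^ (-(b + a)) := by
      rw [integral_Ioi_rpow_of_lt (by linarith) hτ, show -a - 1 - b + 1 = -(b + a) by ring,
        neg_div_neg_eq, div_eq_inv_mul]
    have hi := Integrable.of_integral_ne_zero (hint.trans_ne (by positivity))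
    rw [← hint, ofReal_integral_eq_lintegral_ofReal hi]
    · refine setLIntegral_mono' measurableSet_Ioi fun θ hθ => ENNReal.ofReal_le_ofReal ?_
      have hθ0 : 0 < θ := hτ.trans hθ
      rw [sub_eq_add_neg _ b, Real.rpow_add hθ0]
      exact mul_le_mul_of_nonneg_left (Real.rpow_le_rpow_of_nonpos hθ0 (by linarith) (by linarith))
        (by positivity)
    · refine (ae_restrict_iff' measurableSet_Ioi).2 (Filter.Eventually.of_forall fun θ hθ => ?_)
      have : 0 < θ := hτ.trans hθ
      positivity

theorem heatRate_nonneg (n : ℕ) {q : ℝ} (hq1 : 1 ≤ q) (hq2 : q ≤ 2) : 0 ≤ heatRate n q := by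
  have : 1 / 2 ≤ 1 / q := one_div_le_one_div_of_le (by linarith) hq2
  exact mul_nonneg (Nat.cast_nonneg n) (by linarith)

/-- The estimates for the derivatives of order `a` of the solution of the heat equation; negative
orders are allowed, as long as the resulting rate is positive. -/
theorem exists_heat_decay (n : ℕ) {q a : ℝ} (hq1 : 1 ≤ q) (hq2 : q ≤ 2)
    (ha : 0 ≤ a ∨ 0 < heatRate n q + a) : ∃ C : ℝ, 0 < C ∧ ∀ τ, 0 < τ → ∀ f : L2 n,
      MemLp f (ENNReal.ofReal q) →
      eLpNorm (fun ξ => ((rad ξ ^ a * Real.exp (-τ * rad ξ ^ 2) : ℝ) : ℂ) * (𝓕 f : L2 n) ξ) 2 ≤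
        ENNReal.ofReal (C * τ ^ (-((heatRate n q + a) / 2))) *
          eLpNorm f (ENNReal.ofReal q) volume := by
  have hb := heatRate_nonneg n hq1 hq2
  rcases le_or_gt 0 a with ha0 | ha0
  · obtain ⟨C, hC, hCe⟩ := exists_one_add_rpow_le_exp (a / 2) one_pos
    refine ⟨C * (2 : ℝ) ^ (a / 2) * (2 * 2 ^ (heatRate n q / 2)), by positivity,
      fun τ hτ f hf => ?_⟩
    have hpt : ∀ ξ : EuclideanSpace ℝ (Fin n), rad ξ ^ a * Real.exp (-τ * rad ξ ^ 2) ≤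
        C * (τ / 2) ^ (-(a / 2)) * Real.exp (-(τ / 2) * rad ξ ^ 2) := by
      intro ξ
      have hr := rad_nonneg ξ
      have h1 := hCe (τ / 2 * rad ξ ^ 2) (by positivity)
      rw [one_mul] at h1
      have h2 : (τ / 2 * rad ξ ^ 2) ^ (a / 2) ≤ (1 + τ / 2 * rad ξ ^ 2) ^ (a / 2) :=
        Real.rpow_le_rpow (by positivity) (by linarith) (by positivity)
      have h3 : rad ξ ^ a = (τ / 2) ^ (-(a / 2)) * (τ / 2 * rad ξ ^ 2) ^ (a / 2) := by
        rw [Real.mul_rpow (by positivity) (by positivity), ← mul_assoc,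
          ← Real.rpow_add (by positivity), neg_add_cancel, Real.rpow_zero, one_mul,
          ← Real.rpow_natCast, ← Real.rpow_mul hr]
        congr 1
        push_cast
        ring
      have h4 : Real.exp (-τ * rad ξ ^ 2) =
          Real.exp (-(τ / 2) * rad ξ ^ 2) * Real.exp (-(τ / 2 * rad ξ ^ 2)) := by
        rw [← Real.exp_add]
        congr 1
        ring
      have h5 := Real.exp_pos (τ / 2 * rad ξ ^ 2)
      calc rad ξ ^ a * Real.exp (-τ * rad ξ ^ 2)
          = (τ / 2) ^ (-(a / 2)) * Real.exp (-(τ / 2) * rad ξ ^ 2) *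
            ((τ / 2 * rad ξ ^ 2) ^ (a / 2) * Real.exp (-(τ / 2 * rad ξ ^ 2))) := by
            rw [h3, h4]; ring
        _ ≤ (τ / 2) ^ (-(a / 2)) * Real.exp (-(τ / 2) * rad ξ ^ 2) *
            (C * Real.exp (τ / 2 * rad ξ ^ 2) * Real.exp (-(τ / 2 * rad ξ ^ 2))) := by
            gcongr
            exact h2.trans h1
        _ = _ := by
            rw [Real.exp_neg]
            field_simp
    have h1 : eLpNorm (fun ξ => ((rad ξ ^ a * Real.exp (-τ * rad ξ ^ 2) : ℝ) : ℂ) *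
        (𝓕 f : L2 n) ξ) 2 ≤ eLpNorm (((C * (τ / 2) ^ (-(a / 2)) : ℝ) : ℂ) •
          fun ξ => (Real.exp (-(τ / 2) * rad ξ ^ 2) : ℂ) * (𝓕 f : L2 n) ξ) 2 := by
      refine eLpNorm_mono fun ξ => ?_
      have hr := rad_nonneg ξ
      rw [Pi.smul_apply, smul_eq_mul, ← mul_assoc, norm_mul, norm_mul, ← Complex.ofReal_mul,
        Complex.norm_real, Complex.norm_real, Real.norm_of_nonneg (by positivity),
        Real.norm_of_nonneg (by positivity)]
      exact mul_le_mul_of_nonneg_right (hpt ξ) (norm_nonneg _)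
    refine h1.trans (eLpNorm_const_smul_le.trans ((mul_le_mul_right (eLpNorm_heat_le hq1 hq2
      (half_pos hτ) f hf) _).trans_eq ?_))
    rw [← mul_assoc, ← ofReal_norm, Complex.norm_real, Real.norm_of_nonneg (by positivity),
      ← ENNReal.ofReal_mul (by positivity)]
    congr 2
    rw [show -((heatRate n q + a) / 2) = -(a / 2) + -(heatRate n q / 2) by ring,
      Real.rpow_add hτ, Real.div_rpow hτ.le two_pos.le, Real.div_rpow hτ.le two_pos.le,
      Real.rpow_neg two_pos.le, Real.rpow_neg two_pos.le]
    field_simp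
  · have hab : 0 < heatRate n q + a := ha.resolve_left (not_le.2 ha0)
    have hG : 0 < Real.Gamma (-a) := Real.Gamma_pos_of_pos (neg_pos.2 ha0)
    set B := (Real.Gamma (-a))⁻¹ * (4 * 2 ^ heatRate n q *
      (((-a)⁻¹ + (heatRate n q + a)⁻¹) * 2 ^ (-(heatRate n q + a)))) with hB
    have hB0 : 0 < B := by have := neg_pos.2 ha0; positivity
    refine ⟨Real.sqrt B, Real.sqrt_pos.2 hB0, fun τ hτ f hf => ENNReal.le_of_sq_le_sq ?_⟩
    set F := (𝓕 f : L2 n) with hF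
    set E := eLpNorm f (ENNReal.ofReal q) volume with hE
    have hmeas : AEMeasurable (fun ξ => ‖F ξ‖ₑ ^ 2) volume :=
      (Lp.aestronglyMeasurable F).enorm.pow_const 2
    have hr := continuous_rad (n := n)
    have hheat : ∀ θ, 0 < θ → ∫⁻ ξ, ENNReal.ofReal (Real.exp (-((2 * τ + θ) / 2) * rad ξ ^ 2) ^ 2) *
        ‖F ξ‖ₑ ^ 2 ≤ ENNReal.ofReal (4 * 2 ^ heatRate n q * (2 * τ + θ) ^ (-heatRate n q)) * E ^ 2 := by
      intro θ hθ
      rw [← eLpNorm_weight_sq fun ξ => (Real.exp_pos _).le]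
      refine (pow_le_pow_left' (eLpNorm_heat_le hq1 hq2 (by positivity) f hf) 2).trans_eq ?_
      rw [mul_pow, ← ENNReal.ofReal_pow (by positivity)]
      congr 2
      rw [mul_pow, ← Real.rpow_natCast (_ ^ _), ← Real.rpow_mul (by positivity),
        show -(heatRate n q / 2) * (2 : ℕ) = -heatRate n q by push_cast; ring,
        Real.div_rpow (by positivity) two_pos.le, Real.rpow_neg two_pos.le]
      field_simp
      norm_num
    rw [eLpNorm_weight_sq fun ξ => by have := rad_nonneg ξ; positivity]
    calc ∫⁻ ξ, ENNReal.ofReal ((rad ξ ^ a * Real.exp (-τ * rad ξ ^ 2)) ^ 2) * ‖F ξ‖ₑ ^ 2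
        ≤ ∫⁻ ξ, ENNReal.ofReal (Real.Gamma (-a))⁻¹ * ∫⁻ θ in Ioi (0 : ℝ),
            ENNReal.ofReal (θ ^ (-a - 1)) *
            (ENNReal.ofReal (Real.exp (-((2 * τ + θ) / 2) * rad ξ ^ 2) ^ 2) * ‖F ξ‖ₑ ^ 2) := by
          refine lintegral_mono fun ξ => ?_
          rw [mul_pow, ENNReal.ofReal_mul (by positivity), mul_assoc]
          refine (mul_le_mul_left (ofReal_rpow_le_lintegral ha0 (rad_nonneg ξ)) _).trans_eq ?_
          rw [mul_assoc, ← lintegral_mul_const _ (by fun_prop)]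
          congr 1
          refine setLIntegral_congr_fun measurableSet_Ioi fun θ hθ => ?_
          have hθ0 : 0 < θ := hθ
          rw [← mul_assoc, ← mul_assoc, ← ENNReal.ofReal_mul (by positivity),
            ← ENNReal.ofReal_mul (by positivity), mul_assoc]
          congr 3
          rw [← Real.exp_nat_mul, ← Real.exp_nat_mul, ← Real.exp_add]
          congr 1
          push_cast
          ring
      _ = ENNReal.ofReal (Real.Gamma (-a))⁻¹ * ∫⁻ θ in Ioi (0 : ℝ), ENNReal.ofReal (θ ^ (-a - 1)) *
            ∫⁻ ξ, ENNReal.ofReal (Real.exp (-((2 * τ + θ) / 2) * rad ξ ^ 2) ^ 2) * ‖F ξ‖ₑ ^ 2 := by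
          rw [lintegral_const_mul' _ _ ENNReal.ofReal_ne_top, lintegral_lintegral_swap]
          · congr 1
            refine lintegral_congr fun θ => ?_
            rw [lintegral_const_mul' _ _ ENNReal.ofReal_ne_top]
          · have h1 : Measurable fun p : EuclideanSpace ℝ (Fin n) × ℝ =>
                ENNReal.ofReal (p.2 ^ (-a - 1)) := by fun_prop
            have h2 : Measurable fun p : EuclideanSpace ℝ (Fin n) × ℝ =>
                ENNReal.ofReal (Real.exp (-((2 * τ + p.2) / 2) * rad p.1 ^ 2) ^ 2) := by
              have := hr.measurable
              fun_prop
            exact h1.aemeasurable.mul (h2.aemeasurable.mul hmeas.comp_fst)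
      _ ≤ ENNReal.ofReal (Real.Gamma (-a))⁻¹ * ∫⁻ θ in Ioi (0 : ℝ),
            ENNReal.ofReal (4 * 2 ^ heatRate n q) * E ^ 2 *
              ENNReal.ofReal (θ ^ (-a - 1) * (2 * τ + θ) ^ (-heatRate n q)) := by
          refine mul_le_mul_right ?_ _
          refine setLIntegral_mono' measurableSet_Ioi fun θ hθ => ?_
          have hθ0 : 0 < θ := hθ
          refine (mul_le_mul_right (hheat θ hθ) _).trans_eq ?_
          rw [ENNReal.ofReal_mul (q := (2 * τ + θ) ^ (-heatRate n q)) (by positivity),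
            ENNReal.ofReal_mul (q := (2 * τ + θ) ^ (-heatRate n q)) (by positivity)]
          ring
      _ ≤ ENNReal.ofReal (Real.Gamma (-a))⁻¹ * (ENNReal.ofReal (4 * 2 ^ heatRate n q) * E ^ 2 *
            ENNReal.ofReal (((-a)⁻¹ + (heatRate n q + a)⁻¹) * (2 * τ) ^ (-(heatRate n q + a)))) := by
          rw [lintegral_const_mul' _ _ (ENNReal.mul_ne_top ENNReal.ofReal_ne_top
            (ENNReal.pow_ne_top hf.2.ne))]
          gcongr
          exact lintegral_rpow_mul_rpow_le ha0 hab (by positivity)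
      _ = (ENNReal.ofReal (Real.sqrt B * τ ^ (-((heatRate n q + a) / 2))) * E) ^ 2 := by
          have hn := neg_pos.2 ha0
          rw [mul_pow, ← ENNReal.ofReal_pow (by positivity), mul_pow, Real.sq_sqrt hB0.le,
            ← Real.rpow_natCast (τ ^ _), ← Real.rpow_mul hτ.le,
            show -((heatRate n q + a) / 2) * (2 : ℕ) = -(heatRate n q + a) by push_cast; ring, hB,
            Real.mul_rpow two_pos.le hτ.le, mul_right_comm (ENNReal.ofReal (4 * 2 ^ heatRate n q)),
            ← mul_assoc, ← ENNReal.ofReal_mul (by positivity), ← ENNReal.ofReal_mul (by positivity)]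
          congr 2
          ring

/-! ### Decay of the solutions -/

section Decay

variable {n : ℕ} {Q : DiffOp n} {N L : ℕ} {A : ℕ → ℝ} {σ : ℝ}

/-- The kernel is bounded by a derivative of the heat kernel at the time `σ (1 + t)`, plus an
exponentially decaying term. The shift of the time by `1` costs only a constant for `|2πξ| ≤ 1`, and
it makes the bound uniform as `t → 0`. -/
theorem KernelBound.norm_weight_mul_kern_le (hK : KernelBound Q N L A σ) {j k : ℕ} (hj : j < N + 1)
    {s t : ℝ} (hs : 0 ≤ s) (ht : 0 ≤ t) {ξ : EuclideanSpace ℝ (Fin n)} (hξ : ξ ≠ 0) :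
    rad ξ ^ s * ‖kern Q N j k t ξ‖ ≤
      A k * Real.exp σ * (rad ξ ^ ((k : ℝ) + s - (min j L : ℕ)) *
        Real.exp (-(σ * (1 + t)) * rad ξ ^ 2)) +
      A k * 2 ^ |((k : ℝ) + s - j) / 2| * Real.exp (-σ * t) * bracket ((k : ℝ) + s - j) ξ := by
  have hσ := hK.pos
  have hA := hK.nonneg k
  have hr : 0 < rad ξ := by
    unfold rad
    have := norm_pos_iff.2 hξ
    have := Real.pi_pos
    positivity
  have hbr := bracket_pos ((k : ℝ) + s - j) ξ
  rcases le_total (rad ξ) 1 with h1 | h1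
  · have hs1 : rad ξ ^ s ≤ 1 := Real.rpow_le_one hr.le h1 hs
    have hexp : Real.exp (-(σ * rad ξ ^ 2) * t) ≤
        Real.exp σ * Real.exp (-(σ * (1 + t)) * rad ξ ^ 2) := by
      rw [← Real.exp_add]
      refine Real.exp_le_exp.2 ?_
      have : rad ξ ^ 2 ≤ 1 := by nlinarith
      nlinarith
    have hpow : rad ξ ^ ((k : ℝ) + s - (min j L : ℕ)) =
        rad ξ ^ s * (rad ξ ^ k * (rad ξ)⁻¹ ^ min j L) := by
      rw [Real.rpow_sub hr, Real.rpow_add hr, Real.rpow_natCast, Real.rpow_natCast, inv_pow]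
      ring
    calc rad ξ ^ s * ‖kern Q N j k t ξ‖
        ≤ rad ξ ^ s * (A k * (rad ξ ^ k * (rad ξ)⁻¹ ^ min j L *
            Real.exp (-(σ * rad ξ ^ 2) * t) + Real.exp (-σ * t))) := by
          gcongr
          exact hK.low ξ j k t hξ hj ht h1
      _ = A k * (rad ξ ^ ((k : ℝ) + s - (min j L : ℕ)) * Real.exp (-(σ * rad ξ ^ 2) * t)) +
            A k * Real.exp (-σ * t) * rad ξ ^ s := by
          rw [hpow]; ring
      _ ≤ A k * (rad ξ ^ ((k : ℝ) + s - (min j L : ℕ)) *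
            (Real.exp σ * Real.exp (-(σ * (1 + t)) * rad ξ ^ 2))) +
            A k * Real.exp (-σ * t) *
              (2 ^ |((k : ℝ) + s - j) / 2| * bracket ((k : ℝ) + s - j) ξ) := by
          gcongr
          exact hs1.trans (one_le_bracket h1 _)
      _ = _ := by ring
  · calc rad ξ ^ s * ‖kern Q N j k t ξ‖
        ≤ rad ξ ^ s * (A k * (rad ξ ^ ((k : ℝ) - j) * Real.exp (-σ * t))) := by
          gcongr
          exact hK.high_rpow hj ht h1
      _ = A k * Real.exp (-σ * t) * rad ξ ^ ((k : ℝ) + s - j) := by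
          rw [show (k : ℝ) + s - j = s + (k - j) by ring, Real.rpow_add hr]
          ring
      _ ≤ A k * Real.exp (-σ * t) *
            (2 ^ |((k : ℝ) + s - j) / 2| * bracket ((k : ℝ) + s - j) ξ) := by
          gcongr
          exact rpow_rad_le_bracket h1 _
      _ = A k * 2 ^ |((k : ℝ) + s - j) / 2| * Real.exp (-σ * t) * bracket ((k : ℝ) + s - j) ξ := by
          ring
      _ ≤ _ := le_add_of_nonneg_left (by positivity)

theorem KernelBound.exists_kern_decay (hn : 1 ≤ n) (hK : KernelBound Q N L A σ) {j : ℕ}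
    (hj : j < N + 1) (k : ℕ) {s q : ℝ} (hs : 0 ≤ s) (hq1 : 1 ≤ q) (hq2 : q ≤ 2)
    (h : 0 ≤ (k : ℝ) + s - L ∨ 0 < heatRate n q + (k + s - L)) :
    ∃ C : ℝ, 0 < C ∧ ∀ t, 0 ≤ t → ∀ f : L2 n, MemLp f (ENNReal.ofReal q) →
      eLpNorm (fun ξ => ((rad ξ ^ s : ℝ) : ℂ) * (kern Q N j k t ξ * (𝓕 f : L2 n) ξ)) 2 ≤
        ENNReal.ofReal (C * (1 + t) ^ (-((heatRate n q + (k + s - (min j L : ℕ))) / 2))) *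
          dataNorm q (k + s - j) f := by
  have hσ := hK.pos
  have hA := hK.nonneg k
  have hmin : ((min j L : ℕ) : ℝ) ≤ L := by exact_mod_cast min_le_right j L
  set a := (k : ℝ) + s - (min j L : ℕ) with ha
  set p := -((heatRate n q + a) / 2) with hp
  obtain ⟨C₁, hC₁, hheat⟩ := exists_heat_decay n (a := a) hq1 hq2
    (h.imp (fun h => by linarith) fun h => by linarith)
  obtain ⟨C₂, hC₂, hexp⟩ := exists_one_add_rpow_le_exp (-p) hσ
  set B : ℝ := 2 ^ |((k : ℝ) + s - j) / 2| with hB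
  have hB0 : 0 < B := by positivity
  set K₁ := A k * Real.exp σ * (C₁ * σ ^ p) with hK₁
  set K₂ := A k * B * C₂ with hK₂
  have hK₁0 : 0 ≤ K₁ := by positivity
  have hK₂0 : 0 ≤ K₂ := by positivity
  refine ⟨K₁ + K₂ + 1, by positivity, fun t ht f hf => ?_⟩
  have hrad := continuous_rad (n := n)
  set F := (𝓕 f : L2 n) with hF
  set g₁ : EuclideanSpace ℝ (Fin n) → ℂ := fun ξ =>
    ((rad ξ ^ a * Real.exp (-(σ * (1 + t)) * rad ξ ^ 2) : ℝ) : ℂ) * F ξ with hg₁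
  set g₂ : EuclideanSpace ℝ (Fin n) → ℂ := fun ξ => (bracket ((k : ℝ) + s - j) ξ : ℂ) * F ξ with hg₂
  have hm₁ : AEStronglyMeasurable g₁ volume := by
    have h1 : Measurable fun ξ : EuclideanSpace ℝ (Fin n) =>
        ((rad ξ ^ a * Real.exp (-(σ * (1 + t)) * rad ξ ^ 2) : ℝ) : ℂ) := by
      have := hrad.measurable
      fun_prop
    exact h1.aestronglyMeasurable.mul (Lp.aestronglyMeasurable F)
  have hm₂ : AEStronglyMeasurable g₂ volume :=
    (Complex.continuous_ofReal.comp (continuous_bracket _)).aestronglyMeasurable.mul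
      (Lp.aestronglyMeasurable F)
  have : Nonempty (Fin n) := ⟨⟨0, hn⟩⟩
  have hne : ∀ᵐ ξ : EuclideanSpace ℝ (Fin n), ξ ≠ 0 := compl_mem_ae_iff.2 (measure_singleton 0)
  have hpt : ∀ᵐ ξ : EuclideanSpace ℝ (Fin n),
      ‖((rad ξ ^ s : ℝ) : ℂ) * (kern Q N j k t ξ * F ξ)‖ ≤
      ‖A k * Real.exp σ * ‖g₁ ξ‖ + A k * B * Real.exp (-σ * t) * ‖g₂ ξ‖‖ := by
    filter_upwards [hne] with ξ hξ
    have hr := rad_nonneg ξ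
    have hbr := bracket_pos ((k : ℝ) + s - j) ξ
    rw [Real.norm_of_nonneg (by positivity), hg₁, hg₂]
    simp only [norm_mul, Complex.norm_real]
    rw [Real.norm_of_nonneg (by positivity), Real.norm_of_nonneg (by positivity),
      Real.norm_of_nonneg (by positivity), Real.norm_of_nonneg hbr.le]
    have := mul_le_mul_of_nonneg_right (hK.norm_weight_mul_kern_le (k := k) hj hs ht hξ)
      (norm_nonneg (F ξ))
    refine le_trans (le_of_eq ?_) (this.trans (le_of_eq ?_)) <;> ring
  have hconst : ∀ (c : ℝ) (g : EuclideanSpace ℝ (Fin n) → ℂ), 0 ≤ c →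
      eLpNorm (fun ξ => c * ‖g ξ‖) 2 volume ≤ ENNReal.ofReal c * eLpNorm g 2 volume := by
    intro c g hc
    have := eLpNorm_const_smul_le (c := c) (f := fun ξ => ‖g ξ‖) (p := 2)
      (μ := (volume : Measure (EuclideanSpace ℝ (Fin n))))
    rwa [eLpNorm_norm, ← ofReal_norm, Real.norm_of_nonneg hc] at this
  have hexp' : Real.exp (-σ * t) ≤ C₂ * (1 + t) ^ p := by
    have h1 := hexp t ht
    rw [Real.rpow_neg (by positivity), inv_le_iff_one_le_mul₀ (by positivity)] at h1
    rw [neg_mul, Real.exp_neg, inv_le_iff_one_le_mul₀ (Real.exp_pos _)]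
    linarith
  have h1 : eLpNorm (fun ξ => ((rad ξ ^ s : ℝ) : ℂ) * (kern Q N j k t ξ * F ξ)) 2 ≤
      ENNReal.ofReal (A k * Real.exp σ) * eLpNorm g₁ 2 volume +
        ENNReal.ofReal (A k * B * Real.exp (-σ * t)) * eLpNorm g₂ 2 volume :=
    (eLpNorm_mono_ae hpt).trans ((eLpNorm_add_le (hm₁.norm.const_mul _) (hm₂.norm.const_mul _)
      (by norm_num)).trans (add_le_add (hconst _ _ (by positivity)) (hconst _ _ (by positivity))))
  have h2 : ENNReal.ofReal (A k * Real.exp σ) * eLpNorm g₁ 2 volume ≤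
      ENNReal.ofReal ((K₁ + K₂ + 1) * (1 + t) ^ p) * eLpNorm f (ENNReal.ofReal q) volume := by
    refine (mul_le_mul_right (hheat _ (by positivity) f hf) _).trans ?_
    rw [← mul_assoc, ← ENNReal.ofReal_mul (by positivity), Real.mul_rpow hσ.le (by positivity)]
    refine mul_le_mul_left (ENNReal.ofReal_le_ofReal ?_) _
    calc A k * Real.exp σ * (C₁ * (σ ^ p * (1 + t) ^ p)) = K₁ * (1 + t) ^ p := by rw [hK₁]; ring
      _ ≤ _ := mul_le_mul_of_nonneg_right (by linarith) (by positivity)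
  have h3 : ENNReal.ofReal (A k * B * Real.exp (-σ * t)) * eLpNorm g₂ 2 volume ≤
      ENNReal.ofReal ((K₁ + K₂ + 1) * (1 + t) ^ p) * sobolevNorm (k + s - j) f := by
    rw [sobolevNorm_eq]
    refine mul_le_mul_left (ENNReal.ofReal_le_ofReal ?_) _
    calc A k * B * Real.exp (-σ * t) ≤ A k * B * (C₂ * (1 + t) ^ p) := by gcongr
      _ = K₂ * (1 + t) ^ p := by rw [hK₂]; ring
      _ ≤ _ := mul_le_mul_of_nonneg_right (by linarith) (by positivity)
  rw [dataNorm, mul_add]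
  exact h1.trans (add_le_add h2 h3)

theorem KernelBound.exists_solution_decay (hn : 1 ≤ n) (hK : KernelBound Q N L A σ) (k : ℕ)
    {s q κ : ℝ} (hs : 0 ≤ s) (hκ : (k : ℝ) + s ≤ κ) (hq1 : 1 ≤ q) (hq2 : q ≤ 2)
    (h : 0 ≤ (k : ℝ) + s - L ∨ 0 < heatRate n q + (k + s - L)) :
    ∃ C : ℝ, 0 < C ∧ ∀ u₀ : ℕ → L2 n, AdmissibleData (N + 1) κ q u₀ → ∀ t, 0 ≤ t →
      homSobolevNorm s (timeDeriv k (solution Q N u₀) t) ≤ ∑ j ∈ Finset.range (N + 1),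
        ENNReal.ofReal (C * (1 + t) ^ (-((heatRate n q + (k + s - (min j L : ℕ))) / 2))) *
          dataNorm q (k + s - j) (u₀ j) := by
  have h1 : ∀ j : Fin (N + 1), _ := fun j => hK.exists_kern_decay hn j.2 k hs hq1 hq2 h
  choose C hC hdecay using h1
  refine ⟨∑ j, C j, Finset.sum_pos (fun j _ => hC j) Finset.univ_nonempty, fun u₀ hu₀ t ht => ?_⟩
  have hdata := isDataOfOrder_of_admissibleData hu₀
  rw [(hK.solution_chain hdata (by linarith)).2 t ht, homSobolevNorm,
    FourierTransform.fourier_fourierInv_eq]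
  have hae : (fun ξ => ((rad ξ ^ s : ℝ) : ℂ) *
      toL2 (evol Q N (fun j => (𝓕 (u₀ j) : L2 n)) k t) ξ) =ᵐ[volume]
      ∑ j ∈ Finset.range (N + 1), fun ξ => ((rad ξ ^ s : ℝ) : ℂ) *
        (kern Q N j k t ξ * (𝓕 (u₀ j) : L2 n) ξ) := by
    filter_upwards [coeFn_toL2 (hK.memLp_evol hdata (k := k) (by linarith) ht)] with ξ hξ
    rw [hξ, evol, Finset.mul_sum, Finset.sum_apply]
  refine (eLpNorm_congr_ae hae).le.trans ((eLpNorm_sum_le (fun j _ => ?_) (by norm_num)).trans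
    (Finset.sum_le_sum fun j hj => ?_))
  · have := (continuous_rad (n := n)).measurable
    have h2 : Measurable fun ξ : EuclideanSpace ℝ (Fin n) => ((rad ξ ^ s : ℝ) : ℂ) := by fun_prop
    exact h2.aestronglyMeasurable.mul ((continuous_kern Q N j k t).aestronglyMeasurable.mul
      (Lp.aestronglyMeasurable _))
  · have hj' := Finset.mem_range.1 hj
    refine (hdecay ⟨j, hj'⟩ t ht (u₀ j) (hu₀ j hj').2).trans ?_
    gcongr
    exact Finset.single_le_sum (f := C) (fun i _ => (hC i).le) (Finset.mem_univ _)

end Decay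

/-! ### The Cauchy problem for sums of hyperbolic operators -/

theorem DiffOp.timeCoeff_add {n : ℕ} (P Q : DiffOp n) (k : ℕ) :
    (P + Q).timeCoeff k = P.timeCoeff k + Q.timeCoeff k := MvPolynomial.coeff_add _ _ _

theorem DiffOp.timeCoeff_eq_zero {n D k : ℕ} {P : DiffOp n} (hP : P.IsHomogeneous D) (hk : k ≠ D) :
    P.timeCoeff k = 0 :=
  hP.coeff_eq_zero (by rwa [Finsupp.degree_single])

theorem DiffOp.coeff_csymbol_zero {n D : ℕ} {P : DiffOp n} (hP : P.IsHomogeneous D) (k : ℕ) :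
    (P.csymbol 0).coeff k = P.timeCoeff k := by
  rcases lt_trichotomy k D with h | rfl | h
  · have := coeff_csymbol_smul hP 0 0 k
    simp only [zero_mul] at this
    rw [timeCoeff_eq_zero hP h.ne]
    refine this.trans ?_
    rw [zero_pow (by omega), zero_mul]
  · exact coeff_csymbol_self hP 0
  · rw [timeCoeff_eq_zero hP h.ne', coeff_csymbol_eq_zero hP 0 h]

section Sum

variable {n D ε : ℕ} {P P₁ P₂ : DiffOp n}

theorem natDegree_csymbol_sum_le (hP : P.IsHomogeneous (D + 2)) (hP₁ : P₁.IsHomogeneous (D + 1))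
    (hP₂ : P₂.IsHomogeneous D) (ζ : Fin n → ℂ) : ((P + P₁ + P₂).csymbol ζ).natDegree ≤ D + 2 := by
  rw [DiffOp.csymbol_add, DiffOp.csymbol_add]
  refine natDegree_add_le_of_degree_le (natDegree_add_le_of_degree_le
    (DiffOp.natDegree_csymbol_le hP ζ) ((DiffOp.natDegree_csymbol_le hP₁ ζ).trans (by omega)))
    ((DiffOp.natDegree_csymbol_le hP₂ ζ).trans (by omega))

theorem coeff_csymbol_sum (hP : P.IsHomogeneous (D + 2)) (hP1 : P.timeCoeff (D + 2) = 1)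
    (hP₁ : P₁.IsHomogeneous (D + 1)) (hP₂ : P₂.IsHomogeneous D) (ζ : Fin n → ℂ) :
    ((P + P₁ + P₂).csymbol ζ).coeff (D + 2) = 1 := by
  rw [DiffOp.csymbol_add, DiffOp.csymbol_add, coeff_add, coeff_add, DiffOp.coeff_csymbol_self hP,
    DiffOp.coeff_csymbol_eq_zero hP₁ ζ (by omega), DiffOp.coeff_csymbol_eq_zero hP₂ ζ (by omega),
    hP1, add_zero, add_zero]

theorem timeCoeff_sum (hP1 : P.timeCoeff (D + 2) = 1)
    (hP₁ : P₁.IsHomogeneous (D + 1)) (hP₂ : P₂.IsHomogeneous D) :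
    (P + P₁ + P₂).timeCoeff (D + 2) = 1 := by
  rw [DiffOp.timeCoeff_add, DiffOp.timeCoeff_add, hP1, DiffOp.timeCoeff_eq_zero hP₁ (by omega),
    DiffOp.timeCoeff_eq_zero hP₂ (by omega), add_zero, add_zero]

theorem order_le_of_mem_support_sum (hP : P.IsHomogeneous (D + 2)) (hP₁ : P₁.IsHomogeneous (D + 1))
    (hP₂ : P₂.IsHomogeneous D) {d : Option (Fin n) →₀ ℕ} (hd : d ∈ (P + P₁ + P₂).support) :
    d none + ∑ i, d (some i) ≤ D + 2 := by
  rcases Finset.mem_union.1 (MvPolynomial.support_add hd) with h | h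
  · rcases Finset.mem_union.1 (MvPolynomial.support_add h) with h | h
    · exact (none_add_eq_of_mem_support hP h).le
    · exact (none_add_eq_of_mem_support hP₁ h).le.trans (by omega)
  · exact (none_add_eq_of_mem_support hP₂ h).le.trans (by omega)

/-- The bounds of `exists_fundSol_bound`, with the frequency `2πξ = r ω` in polar coordinates. The
case `ε = 0` is that of `P₂ = 0`. -/
theorem exists_kernelBound (hε : ε = 0 ∨ ε = 1) (hεD : ε ≤ D) {c : ℝ}
    (hP : P.IsHomogeneous (D + 2)) (hP1 : P.timeCoeff (D + 2) = 1)
    (hP₁ : P₁.IsHomogeneous (D + 1)) (ht : P₁.timeCoeff (D + 1) = c) (hc : 0 < c)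
    (hP₂ : P₂.IsHomogeneous D) (hP₂' : P₂.IsHomogeneous (D + 1 - ε))
    (hint : ∀ ω : EuclideanSpace ℝ (Fin n), ‖ω‖ = 1 →
      StrictlyInterlace (P₁.symbol ω) (P.symbol ω))
    (hη : ∀ B, ∃ θ Θ : ℝ, 0 < θ ∧ 0 < Θ ∧ ∀ p ∈ rootSet (N := D + 1) P₁ c B,
      ∃ η : Fin (D + 1) → ℝ, (∀ i, ε * θ ≤ η i ∧ η i ≤ ε * Θ) ∧
      P₂.symbol p.1 = ∑ i, C (η i : ℂ) * nodalErase (fun i => (p.2 i : ℂ)) i)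
    (hstable : ∃ σ₀ : ℝ, 0 < σ₀ ∧ ∀ σ < σ₀,
      StableFilter (1 + ε) (fun i => ((P + P₁ + P₂).csymbol 0).coeff (D + 1 - ε + i)) σ) :
    ∃ (A : ℕ → ℝ) (σ : ℝ), KernelBound (P + P₁ + P₂) (D + 1) (D - ε) A σ := by
  obtain ⟨B, -, hB⟩ := exists_mem_rootSet hP₁ hc ht fun ω hω => by
    obtain ⟨-, -, d, b, a, hb, -, hab⟩ := hint ω hω
    exact ⟨d, b, (strictMono_of_interlace' hab).monotone, hb⟩
  obtain ⟨A, σ, hA, hσ, h⟩ := exists_fundSol_bound hε hεD hP hP1 hP₁ ht hc hP₂ hP₂' hB hint (hη B)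
    hstable
  have hmain : ∀ (ξ : EuclideanSpace ℝ (Fin n)) (j k : ℕ) (t : ℝ), ξ ≠ 0 → j < D + 1 + 1 → 0 ≤ t →
      (1 ≤ rad ξ → ‖kern (P + P₁ + P₂) (D + 1) j k t ξ‖ ≤
        A k * (rad ξ ^ k * ((rad ξ)⁻¹ ^ j * Real.exp (-σ * t)))) ∧
      (rad ξ ≤ 1 → ‖kern (P + P₁ + P₂) (D + 1) j k t ξ‖ ≤ A k * (rad ξ ^ k *
        (rad ξ)⁻¹ ^ min j (D - ε) * Real.exp (-(σ * rad ξ ^ 2) * t) + Real.exp (-σ * t))) := by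
    intro ξ j k t hξ hj ht
    have hn := norm_pos_iff.2 hξ
    have hpi := Real.pi_pos
    have hwave : (waveVec ξ) = fun i => Complex.I * (rad ξ : ℂ) * ((‖ξ‖⁻¹ • ξ) i : ℝ) := by
      ext i
      have h1 : (‖ξ‖ : ℂ) ≠ 0 := by exact_mod_cast hn.ne'
      rw [waveVec, rad, PiLp.smul_apply, smul_eq_mul]
      push_cast
      field_simp
    rw [kern, hwave]
    exact h (‖ξ‖⁻¹ • ξ) (rad ξ) j k t (by rw [norm_smul, norm_inv, norm_norm, inv_mul_cancel₀ hn.ne'])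
      (by unfold rad; positivity) hj ht
  exact ⟨A, σ, hA, hσ, fun ξ j k t hξ hj ht => (hmain ξ j k t hξ hj ht).1,
    fun ξ j k t hξ hj ht => (hmain ξ j k t hξ hj ht).2⟩

/-- For `P_m + P_{m-1}`, the stable factor at the frequency `0` is `∂_t + c`. -/
theorem exists_kernelBound_one (hP : P.IsStrictlyHyperbolic (D + 2)) (hP1 : P.timeCoeff (D + 2) = 1)
    (hP₁ : P₁.IsStrictlyHyperbolic (D + 1))
    (hint : ∀ ω : EuclideanSpace ℝ (Fin n), ‖ω‖ = 1 →
      StrictlyInterlace (P₁.symbol ω) (P.symbol ω)) :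
    ∃ (A : ℕ → ℝ) (σ : ℝ), KernelBound (P + P₁ + 0) (D + 1) D A σ := by
  obtain ⟨c, hc, hct⟩ := hP₁.timeCoeff_pos
  refine exists_kernelBound (ε := 0) (Or.inl rfl) (Nat.zero_le _) hP.homogeneous hP1 hP₁.homogeneous
    hct hc (MvPolynomial.isHomogeneous_zero _ _ _) (MvPolynomial.isHomogeneous_zero _ _ _) hint ?_ ?_
  · refine fun B => ⟨1, 1, one_pos, one_pos, fun p _ => ⟨fun _ => 0, by simp, ?_⟩⟩
    simp [DiffOp.symbol]
  · have hcoeff : ∀ k, ((P + P₁ + 0).csymbol 0).coeff k = P.timeCoeff k + P₁.timeCoeff k := by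
      intro k
      rw [add_zero, DiffOp.csymbol_add, coeff_add, DiffOp.coeff_csymbol_zero hP.homogeneous,
        DiffOp.coeff_csymbol_zero hP₁.homogeneous]
    refine ⟨c, hc, fun σ hσ => stableFilter_one (c := c) ?_ ?_ hσ⟩
    · change ((P + P₁ + 0).csymbol 0).coeff (D + 1) = c
      rw [hcoeff, DiffOp.timeCoeff_eq_zero hP.homogeneous (by omega), hct, zero_add]
    · change ((P + P₁ + 0).csymbol 0).coeff (D + 2) = 1
      rw [hcoeff, DiffOp.timeCoeff_eq_zero hP₁.homogeneous (by omega), hP1, add_zero]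

/-- For `P_m + P_{m-1} + P_{m-2}`, the stable factor at the frequency `0` is `∂_t² + c ∂_t + d`,
where `d > 0` is the leading coefficient of `P_{m-2}`. -/
theorem exists_kernelBound_two (hP : P.IsStrictlyHyperbolic (D + 3)) (hP1 : P.timeCoeff (D + 3) = 1)
    (hP₁ : P₁.IsStrictlyHyperbolic (D + 2)) (hP₂ : P₂.IsStrictlyHyperbolic (D + 1))
    (hint : ∀ ω : EuclideanSpace ℝ (Fin n), ‖ω‖ = 1 →
      StrictlyInterlace (P₁.symbol ω) (P.symbol ω))
    (hint₂ : ∀ ω : EuclideanSpace ℝ (Fin n), ‖ω‖ = 1 →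
      StrictlyInterlace (P₂.symbol ω) (P₁.symbol ω)) :
    ∃ (A : ℕ → ℝ) (σ : ℝ), KernelBound (P + P₁ + P₂) (D + 2) D A σ := by
  obtain ⟨c, hc, hct⟩ := hP₁.timeCoeff_pos
  obtain ⟨d, hd, hdt⟩ := hP₂.timeCoeff_pos
  refine exists_kernelBound (D := D + 1) (ε := 1) (Or.inr rfl) (by omega) hP.homogeneous hP1
    hP₁.homogeneous hct hc hP₂.homogeneous hP₂.homogeneous hint (fun B => ?_) ?_
  · simpa using exists_decomposition_of_interlaced (B := B)
      hP₁.homogeneous hct hc hP₂.homogeneous hdt hd hint₂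
  · have hcoeff : ∀ k, ((P + P₁ + P₂).csymbol 0).coeff k =
        P.timeCoeff k + P₁.timeCoeff k + P₂.timeCoeff k := by
      intro k
      rw [DiffOp.csymbol_add, DiffOp.csymbol_add, coeff_add, coeff_add,
        DiffOp.coeff_csymbol_zero hP.homogeneous, DiffOp.coeff_csymbol_zero hP₁.homogeneous,
        DiffOp.coeff_csymbol_zero hP₂.homogeneous]
    refine stableFilter_two hc hd ?_ ?_ ?_
    · change ((P + P₁ + P₂).csymbol 0).coeff (D + 1) = d
      rw [hcoeff, DiffOp.timeCoeff_eq_zero hP.homogeneous (by omega),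
        DiffOp.timeCoeff_eq_zero hP₁.homogeneous (by omega), hdt, zero_add, zero_add]
    · change ((P + P₁ + P₂).csymbol 0).coeff (D + 2) = c
      rw [hcoeff, DiffOp.timeCoeff_eq_zero hP.homogeneous (by omega),
        DiffOp.timeCoeff_eq_zero hP₂.homogeneous (by omega), hct, zero_add, add_zero]
    · change ((P + P₁ + P₂).csymbol 0).coeff (D + 3) = 1
      rw [hcoeff, DiffOp.timeCoeff_eq_zero hP₁.homogeneous (by omega),
        DiffOp.timeCoeff_eq_zero hP₂.homogeneous (by omega), hP1, add_zero, add_zero]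

/-- Well-posedness and decay, for the operators whose fundamental solutions have the bounds of
`KernelBound`. -/
theorem KernelBound.cauchyProblem (hn : 1 ≤ n) {L : ℕ} {A : ℕ → ℝ} {σ : ℝ} (hLD : L ≤ D + 2)
    (hK : KernelBound (P + P₁ + P₂) (D + 1) L A σ) (hP : P.IsHomogeneous (D + 2))
    (hP1 : P.timeCoeff (D + 2) = 1) (hP₁ : P₁.IsHomogeneous (D + 1)) (hP₂ : P₂.IsHomogeneous D)
    {s₀ q : ℝ} (hs₀ : ((D + 1 : ℕ) : ℝ) ≤ s₀) (hq1 : 1 ≤ q) (hq2 : q ≤ 2) :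
    (∀ u₀ : ℕ → L2 n, AdmissibleData (D + 2) s₀ q u₀ →
        ∃ u : ℝ → L2 n, IsSolution (P + P₁ + P₂) (D + 2) u₀ u ∧
          ∀ v : ℝ → L2 n, IsSolution (P + P₁ + P₂) (D + 2) u₀ v → EqOn v u (Ici 0)) ∧
      ∀ (k : ℕ) (s : ℝ), 0 ≤ s → (k : ℝ) + s ≤ s₀ →
        ((q = 2 ∧ (L : ℝ) ≤ k + s) ∨
          (q < 2 ∧ (L : ℝ) < n * (1 / q - 1 / 2) + k + s)) →
        ∃ C : ℝ, 0 < C ∧ ∀ (u₀ : ℕ → L2 n) (u : ℝ → L2 n),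
          AdmissibleData (D + 2) s₀ q u₀ → IsSolution (P + P₁ + P₂) (D + 2) u₀ u →
          ContDiffOn ℝ (k : ℕ∞) u (Ici 0) ∧
          ∀ t : ℝ, 0 ≤ t →
            homSobolevNorm s (timeDeriv k u t) ≤
              ENNReal.ofReal (C * (1 + t) ^
                  (-((n : ℝ) / 2) * (1 / q - 1 / 2) - (k + s - (L : ℝ)) / 2)) *
                ∑ j ∈ Finset.Ico L (D + 2), dataNorm q (k + s - j) (u₀ j) +
              ENNReal.ofReal C * ∑ j ∈ Finset.range L,
                ENNReal.ofReal ((1 + t) ^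
                  (-((n : ℝ) / 2) * (1 / q - 1 / 2) - (k + s - (j : ℝ)) / 2)) *
                dataNorm q (k + s - j) (u₀ j) := by
  have hsol : ∀ u₀ : ℕ → L2 n, AdmissibleData (D + 2) s₀ q u₀ →
      IsSolution (P + P₁ + P₂) (D + 2) u₀ (solution (P + P₁ + P₂) (D + 1) u₀) := fun u₀ hu₀ =>
    hK.isSolution (natDegree_csymbol_sum_le hP hP₁ hP₂) (coeff_csymbol_sum hP hP1 hP₁ hP₂)
      (isDataOfOrder_of_admissibleData hu₀) hs₀
  have huniq : ∀ (u₀ : ℕ → L2 n) (v : ℝ → L2 n), AdmissibleData (D + 2) s₀ q u₀ →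
      IsSolution (P + P₁ + P₂) (D + 2) u₀ v →
      EqOn v (solution (P + P₁ + P₂) (D + 1) u₀) (Ici 0) := fun u₀ v hu₀ hv =>
    (hsol u₀ hu₀).unique hv (fun d hd => order_le_of_mem_support_sum hP hP₁ hP₂ hd)
      (timeCoeff_sum hP1 hP₁ hP₂)
  refine ⟨fun u₀ hu₀ => ⟨_, hsol u₀ hu₀, fun v hv => huniq u₀ v hu₀ hv⟩, fun k s hs hks hcond => ?_⟩
  have hcond' : 0 ≤ (k : ℝ) + s - L ∨ 0 < heatRate n q + (k + s - L) := by
    refine hcond.imp (fun h => by linarith [h.2]) fun h => ?_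
    rw [heatRate]
    linarith [h.2]
  obtain ⟨C, hC, hdecay⟩ := hK.exists_solution_decay hn k hs hks hq1 hq2 hcond'
  refine ⟨C, hC, fun u₀ u hu₀ hu => ?_⟩
  have heq := huniq u₀ u hu₀ hu
  refine ⟨((hK.solution_chain (isDataOfOrder_of_admissibleData hu₀) (by linarith)).1).congr heq,
    fun t ht => ?_⟩
  have hderiv : timeDeriv k u t = timeDeriv k (solution (P + P₁ + P₂) (D + 1) u₀) t :=
    iteratedDerivWithin_congr heq ht
  have hrate : ∀ x : ℝ, -((heatRate n q + x) / 2) = -((n : ℝ) / 2) * (1 / q - 1 / 2) - x / 2 :=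
    fun x => by rw [heatRate]; ring
  rw [hderiv]
  refine (hdecay u₀ hu₀ t ht).trans_eq ?_
  rw [← Finset.sum_range_add_sum_Ico _ hLD, add_comm]
  congr 1
  · rw [Finset.mul_sum]
    refine Finset.sum_congr rfl fun j hj => ?_
    rw [min_eq_right (Finset.mem_Ico.1 hj).1, hrate]
  · rw [Finset.mul_sum]
    refine Finset.sum_congr rfl fun j hj => ?_
    rw [min_eq_left (Finset.mem_range.1 hj).le, hrate, ENNReal.ofReal_mul hC.le, mul_assoc]

end Sum

end HypDecay

end

theorem theorem1 (n m : ℕ) (hn : 1 ≤ n) (hm : 3 ≤ m)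
    (Pm Pm1 : HypDecay.DiffOp n)
    (hPm : Pm.IsStrictlyHyperbolic m)
    (hPm_one : Pm.timeCoeff m = 1)
    (hPm1 : Pm1.IsStrictlyHyperbolic (m - 1))
    (hint : ∀ ξ : EuclideanSpace ℝ (Fin n), ‖ξ‖ = 1 →
      HypDecay.StrictlyInterlace (Pm1.symbol ξ) (Pm.symbol ξ))
    (s₀ q : ℝ) (hs₀ : (m : ℝ) - 1 ≤ s₀) (hq1 : 1 ≤ q) (hq2 : q ≤ 2) :
    -- the Cauchy problem for `Q₁ = P_m + P_{m-1}`
    ((∀ u₀ : ℕ → HypDecay.L2 n, HypDecay.AdmissibleData m s₀ q u₀ →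
        ∃ u : ℝ → HypDecay.L2 n, HypDecay.IsSolution (Pm + Pm1) m u₀ u ∧
          ∀ v : ℝ → HypDecay.L2 n, HypDecay.IsSolution (Pm + Pm1) m u₀ v → EqOn v u (Ici 0)) ∧
      ∀ (k : ℕ) (s : ℝ), 0 ≤ s → (k : ℝ) + s ≤ s₀ →
        ((q = 2 ∧ (m : ℝ) - 2 ≤ k + s) ∨
          (q < 2 ∧ (m : ℝ) - 2 < n * (1 / q - 1 / 2) + k + s)) →
        ∃ C : ℝ, 0 < C ∧ ∀ (u₀ : ℕ → HypDecay.L2 n) (u : ℝ → HypDecay.L2 n),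
          HypDecay.AdmissibleData m s₀ q u₀ → HypDecay.IsSolution (Pm + Pm1) m u₀ u →
          ContDiffOn ℝ (k : ℕ∞) u (Ici 0) ∧
          ∀ t : ℝ, 0 ≤ t →
            HypDecay.homSobolevNorm s (HypDecay.timeDeriv k u t) ≤
              ENNReal.ofReal (C * (1 + t) ^
                  (-((n : ℝ) / 2) * (1 / q - 1 / 2) - (k + s - ((m : ℝ) - 2)) / 2)) *
                ∑ j ∈ Finset.Ico (m - 2) m, HypDecay.dataNorm q (k + s - j) (u₀ j) +
              ENNReal.ofReal C * ∑ j ∈ Finset.range (m - 2),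
                ENNReal.ofReal ((1 + t) ^
                  (-((n : ℝ) / 2) * (1 / q - 1 / 2) - (k + s - (j : ℝ)) / 2)) *
                HypDecay.dataNorm q (k + s - j) (u₀ j)) ∧
    -- the Cauchy problem for `Q₂ = P_m + P_{m-1} + P_{m-2}`
    (∀ Pm2 : HypDecay.DiffOp n, Pm2.IsStrictlyHyperbolic (m - 2) →
      (∀ ξ : EuclideanSpace ℝ (Fin n), ‖ξ‖ = 1 →
        HypDecay.StrictlyInterlace (Pm2.symbol ξ) (Pm1.symbol ξ)) →
      (∀ u₀ : ℕ → HypDecay.L2 n, HypDecay.AdmissibleData m s₀ q u₀ →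
        ∃ u : ℝ → HypDecay.L2 n, HypDecay.IsSolution (Pm + Pm1 + Pm2) m u₀ u ∧
          ∀ v : ℝ → HypDecay.L2 n,
            HypDecay.IsSolution (Pm + Pm1 + Pm2) m u₀ v → EqOn v u (Ici 0)) ∧
      ∀ (k : ℕ) (s : ℝ), 0 ≤ s → (k : ℝ) + s ≤ s₀ →
        ((q = 2 ∧ (m : ℝ) - 3 ≤ k + s) ∨
          (q < 2 ∧ (m : ℝ) - 3 < n * (1 / q - 1 / 2) + k + s)) →
        ∃ C : ℝ, 0 < C ∧ ∀ (u₀ : ℕ → HypDecay.L2 n) (u : ℝ → HypDecay.L2 n),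
          HypDecay.AdmissibleData m s₀ q u₀ → HypDecay.IsSolution (Pm + Pm1 + Pm2) m u₀ u →
          ContDiffOn ℝ (k : ℕ∞) u (Ici 0) ∧
          ∀ t : ℝ, 0 ≤ t →
            HypDecay.homSobolevNorm s (HypDecay.timeDeriv k u t) ≤
              ENNReal.ofReal (C * (1 + t) ^
                  (-((n : ℝ) / 2) * (1 / q - 1 / 2) - (k + s - ((m : ℝ) - 3)) / 2)) *
                ∑ j ∈ Finset.Ico (m - 3) m, HypDecay.dataNorm q (k + s - j) (u₀ j) +
              ENNReal.ofReal C * ∑ j ∈ Finset.range (m - 3),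
                ENNReal.ofReal ((1 + t) ^
                  (-((n : ℝ) / 2) * (1 / q - 1 / 2) - (k + s - (j : ℝ)) / 2)) *
                HypDecay.dataNorm q (k + s - j) (u₀ j)) := by
  obtain ⟨D, rfl⟩ : ∃ D, m = D + 3 := ⟨m - 3, by omega⟩
  have h2 : ((D + 3 : ℕ) : ℝ) - 2 = ((D + 1 : ℕ) : ℝ) := by push_cast; ring
  have h3 : ((D + 3 : ℕ) : ℝ) - 3 = (D : ℝ) := by push_cast; ring
  have hs : ((D + 1 + 1 : ℕ) : ℝ) ≤ s₀ := by push_cast at hs₀ ⊢; linarith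
  rw [h2, h3]
  refine ⟨?_, fun Pm2 hPm2 hint2 => ?_⟩
  · obtain ⟨A, σ, hK⟩ := HypDecay.exists_kernelBound_one (D := D + 1) hPm hPm_one hPm1 hint
    have := hK.cauchyProblem hn (by omega) hPm.homogeneous hPm_one hPm1.homogeneous
      (MvPolynomial.isHomogeneous_zero _ _ _) hs hq1 hq2
    rw [add_zero] at this
    exact this
  · obtain ⟨A, σ, hK⟩ := HypDecay.exists_kernelBound_two hPm hPm_one hPm1 hPm2 hint hint2
    exact hK.cauchyProblem (D := D + 1) hn (by omega) hPm.homogeneous hPm_one hPm1.homogeneous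
      hPm2.homogeneous hs hq1 hq2
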